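/- **Conventions.** Fix a universal oracle prefix Turing machine $U$. For an oracle $A\subseteq\mathbb{N}$ and binary strings $\sigma,\tau$, let $K^A(\sigma\mid\tau)$ be the least length of a string $\pi$ with $U^A(\pi,\tau)=\sigma$; through a standard binary encoding this extends to rational vectors. For sets $E\subseteq\mathbb{R}^m$, $F\subseteq\mathbb{R}^n$ put $$K^A(E\mid\tau)=\min_{p\in E\cap\mathbb{Q}^m}K^A(p\mid\tau),\qquad K^A(E\mid F)=\max_{q\in F\cap\mathbb{Q}^n}K^A(E\mid q).$$ With $B_\rho(x)$ the open Euclidean ball of radius $\rho$ about $x$ and $\lambda$ the empty string, let $$K^A_r(x)=K^A(B_{2^{-r}}(x)\mid\lambda),\qquad K^A_{r,s}(x\mid y)=K^A(B_{2^{-r}}(x)\mid B_{2^{-s}}(y)),\qquad \dim^A(x)=\liminf_{r\to\infty}\frac{K^A_r(x)}{r}.$$ A direction $e\in\mathcal{S}^1\subset\mathbb{R}^2$ is identified with the number $a\in[0,1)$ such that $e=(\cos 2\pi a,\sin 2\pi a)$; in particular $\dim^A(e)=\dim^A(a)$. The superscript $A,e$ denotes the Turing join of $A$ with an oracle that encodes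 $2^{-r}\lfloor 2^r a\rfloor$ for all $r\in\mathbb{N}$. Finally, $p_e x=\langle e,x\rangle\in\mathbb{R}$ is the coordinate of the orthogonal projection of $x$ onto the line spanned by $e$. **Theorem.** Let $A\subseteq\mathbb{N}$, $x\in\mathbb{R}^2$, $e\in\mathcal{S}^1$, and let $\delta,\varepsilon\in\mathbb{Q}\cap(0,1)$ satisfy $\delta<\frac{\varepsilon}{4}\dim^A(e)$. Then there is $R\in\mathbb{N}$ such that, for every $r\ge R$ with $$K_r^{A,e}(x)\ge K_r^A(x)-\delta r$$ and every $s\in\mathbb{N}$, $$K^{A,e}_{r,s}(p_e x\mid p_e x)\ \ge\ \tfrac12 K^A_{r,s}(x\mid x)-\varepsilon r .$$ -/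

import Mathlib

open scoped ENNReal

namespace AlgInfo

/-! ### Oracle machines -/

/-- Programs for partial recursive functions `ℕ ⇀ ℕ` with access to an oracle set. The syntax is
that of `Nat.Partrec.Code`, with one additional instruction that queries the oracle. -/
inductive OracleCode : Type
  | zero : OracleCode
  | succ : OracleCode
  | left : OracleCode
  | right : OracleCode
  | oracle : OracleCode
  | pair : OracleCode → OracleCode → OracleCode
  | comp : OracleCode → OracleCode → OracleCode
  | prec : OracleCode → OracleCode → OracleCode
  | rfind' : OracleCode → OracleCode

namespace OracleCode

open Classical in
/-- The partial function computed by a program with oracle `A`; a query `n` is answered by `1`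
if `n ∈ A` and by `0` otherwise. All other clauses are those of `Nat.Partrec.Code.eval`. -/
noncomputable def eval (A : Set ℕ) : OracleCode → ℕ →. ℕ
  | zero => pure 0
  | succ => fun n => Part.some (n + 1)
  | left => fun n => Part.some n.unpair.1
  | right => fun n => Part.some n.unpair.2
  | oracle => fun n => Part.some (if n ∈ A then 1 else 0)
  | pair cf cg => fun n => Nat.pair <$> eval A cf n <*> eval A cg n
  | comp cf cg => fun n => eval A cg n >>= eval A cf
  | prec cf cg =>
    Nat.unpaired fun a n =>
      n.rec (eval A cf a) fun y IH => do
        let i ← IH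
        eval A cg (Nat.pair a (Nat.pair y i))
  | rfind' cf =>
    Nat.unpaired fun a m =>
      (Nat.rfind fun n => (fun k => k = 0) <$> eval A cf (Nat.pair a (n + m))).map (· + m)

/-- The machine with program `c` run on binary strings: `c.run A π τ` is the output string
`c^A(π, τ)`, if there is one. -/
noncomputable def run (c : OracleCode) (A : Set ℕ) (π τ : List Bool) : Part (List Bool) :=
  (c.eval A (Nat.pair (Encodable.encode π) (Encodable.encode τ))).bind fun n =>
    (Encodable.decode (α := List Bool) n : Part (List Bool))

/-- `c` is an oracle prefix machine: for every oracle and every condition `τ`, the set of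
halting programs is prefix-free. -/
def IsPrefixMachine (c : OracleCode) : Prop :=
  ∀ (A : Set ℕ) (τ π π' : List Bool),
    (c.run A π τ).Dom → (c.run A π' τ).Dom → π <+: π' → π = π'

/-- `U` is a universal oracle prefix machine: it is an oracle prefix machine which simulates every
oracle prefix machine `M`, for all oracles, with programs that are longer only by a constant
that depends on `M` alone. -/
def IsUniversal (U : OracleCode) : Prop :=
  U.IsPrefixMachine ∧
    ∀ M : OracleCode, M.IsPrefixMachine →
      ∃ c : ℕ, ∀ (A : Set ℕ) (π τ σ : List Bool), σ ∈ M.run A π τ →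
        ∃ π' : List Bool, π'.length ≤ π.length + c ∧ σ ∈ U.run A π' τ

end OracleCode

/-! ### Oracles -/

/-- The Turing join of two oracles. -/
def join (A B : Set ℕ) : Set ℕ :=
  {m | (∃ n ∈ A, m = 2 * n) ∨ ∃ n ∈ B, m = 2 * n + 1}

/-- An oracle that encodes the dyadic truncations `2 ^ (-r) * ⌊2 ^ r * a⌋` of the real number `a`
for all `r`, as the graph of `r ↦ ⌊2 ^ r * a⌋`. -/
def realOracle (a : ℝ) : Set ℕ :=
  {m | ∃ r : ℕ, m = Nat.pair r (Encodable.encode ⌊(2 : ℝ) ^ r * a⌋)}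

/-! ### Kolmogorov complexity -/

/-- Prefix Kolmogorov complexity `K^A(σ ∣ τ)` of a string given a string, with respect to the
machine `U`. -/
noncomputable def K (U : OracleCode) (A : Set ℕ) (σ τ : List Bool) : ℕ∞ :=
  ⨅ π : List Bool, ⨅ _ : σ ∈ U.run A π τ, (π.length : ℕ∞)

/-- The binary string that encodes a rational vector: the vector is coded as the list of the pairs
(numerator, denominator) of its coordinates, hence as a natural number, which is written in
binary. -/
def ratCode {n : ℕ} (q : Fin n → ℚ) : List Bool :=
  Nat.bits (Encodable.encode
    (List.ofFn fun i => Nat.pair (Encodable.encode (q i).num) (q i).den))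

/-- A rational vector as a point of `ℝⁿ`. -/
noncomputable def ratPoint {n : ℕ} (q : Fin n → ℚ) : EuclideanSpace ℝ (Fin n) :=
  WithLp.toLp 2 fun i => (q i : ℝ)

/-- `K^A(E ∣ τ)`: the least complexity, given `τ`, of a rational point in `E`. -/
noncomputable def KSet (U : OracleCode) (A : Set ℕ) {n : ℕ} (E : Set (EuclideanSpace ℝ (Fin n)))
    (τ : List Bool) : ℕ∞ :=
  ⨅ q : Fin n → ℚ, ⨅ _ : ratPoint q ∈ E, K U A (ratCode q) τ

/-- `K^A(E ∣ F)`: the largest value of `K^A(E ∣ q)` over the rational points `q` in `F`. -/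
noncomputable def KSetGiven (U : OracleCode) (A : Set ℕ) {m n : ℕ}
    (E : Set (EuclideanSpace ℝ (Fin m))) (F : Set (EuclideanSpace ℝ (Fin n))) : ℕ∞ :=
  ⨆ q : Fin n → ℚ, ⨆ _ : ratPoint q ∈ F, KSet U A E (ratCode q)

/-- `K^A_r(x)`, the complexity of `x` at precision `r`. -/
noncomputable def Kr (U : OracleCode) (A : Set ℕ) {n : ℕ} (r : ℕ)
    (x : EuclideanSpace ℝ (Fin n)) : ℕ∞ :=
  KSet U A (Metric.ball x ((2 : ℝ)⁻¹ ^ r)) []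

/-- `K^A_{r,s}(x ∣ y)`, the complexity of `x` at precision `r` given `y` at precision `s`. -/
noncomputable def Krs (U : OracleCode) (A : Set ℕ) {m n : ℕ} (r s : ℕ)
    (x : EuclideanSpace ℝ (Fin m)) (y : EuclideanSpace ℝ (Fin n)) : ℕ∞ :=
  KSetGiven U A (Metric.ball x ((2 : ℝ)⁻¹ ^ r)) (Metric.ball y ((2 : ℝ)⁻¹ ^ s))

/-- The effective Hausdorff dimension `dim^A(x) = liminf_{r → ∞} K^A_r(x) / r`. -/
noncomputable def effDim (U : OracleCode) (A : Set ℕ) {n : ℕ} (x : EuclideanSpace ℝ (Fin n)) :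
    ℝ≥0∞ :=
  Filter.liminf (fun r : ℕ => (Kr U A r x : ℝ≥0∞) / (r : ℝ≥0∞)) Filter.atTop

/-! ### Directions and projections -/

/-- The number `a ∈ [0, 1)` with `e = (cos (2πa), sin (2πa))`, for a unit vector `e`. -/
noncomputable def angle (e : EuclideanSpace ℝ (Fin 2)) : ℝ :=
  Int.fract (Complex.arg ⟨e 0, e 1⟩ / (2 * Real.pi))

theorem angle_spec (e : EuclideanSpace ℝ (Fin 2)) (he : e ∈ Metric.sphere 0 1) :
    angle e ∈ Set.Ico (0 : ℝ) 1 ∧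
      e = !₂[Real.cos (2 * Real.pi * angle e), Real.sin (2 * Real.pi * angle e)] := by
  refine ⟨⟨Int.fract_nonneg _, Int.fract_lt_one _⟩, ?_⟩
  set z : ℂ := ⟨e 0, e 1⟩ with hz
  have hn : ‖z‖ = 1 := by
    have h : ‖e‖ = 1 := by simpa using he
    rw [EuclideanSpace.norm_eq, Fin.sum_univ_two] at h
    rw [Complex.norm_def, Complex.normSq_mk]
    simpa [sq] using h
  have h0 : z ≠ 0 := by
    intro h
    simp [h] at hn
  have ha : 2 * Real.pi * angle e =
      Complex.arg z - (⌊Complex.arg z / (2 * Real.pi)⌋ : ℤ) * (2 * Real.pi) := by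
    have hp : (2 * Real.pi) ≠ 0 := by positivity
    unfold angle
    rw [Int.fract, ← hz]
    field_simp
  rw [ha, Real.cos_sub_int_mul_two_pi, Real.sin_sub_int_mul_two_pi, Complex.cos_arg h0,
    Complex.sin_arg, hn]
  ext i
  fin_cases i <;> simp [hz]

/-- The coordinate `p_e x` of the orthogonal projection of `x` onto the line spanned by the unit
vector `e`, as a point of `ℝ = ℝ¹`. -/
noncomputable def proj (e x : EuclideanSpace ℝ (Fin 2)) : EuclideanSpace ℝ (Fin 1) :=
  !₂[inner ℝ e x]

/-- A direction `e` identified with its angle `a ∈ [0, 1)`, as a point of `ℝ = ℝ¹`. -/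
noncomputable def dirPoint (e : EuclideanSpace ℝ (Fin 2)) : EuclideanSpace ℝ (Fin 1) :=
  !₂[angle e]

/-- The oracle `A, e`: the join of `A` with an oracle that encodes the direction `e`. -/
noncomputable def withDir (A : Set ℕ) (e : EuclideanSpace ℝ (Fin 2)) : Set ℕ :=
  join A (realOracle (angle e))

end AlgInfo

/-!
The argument is a counting argument with finite objects. The point `x` is replaced by the points
`q` and `z` below it on the grids of mesh about `2 ^ (-r)` and `2 ^ (-s)`, and `K_{r,s}(x ∣ x)` by
the complexity `N` of `q` given `z` (`exists_Krs_le`). Suppose that some program of length at most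
`H` computes the projection of `x` in the direction `e` at precision `r` from the one at precision
`s`, with the oracle `A, e`. In this case `q` is said to be *reached* from `z` in the direction
`e` (`Reaches`, `exists_reaches`). Reaching is an enumerable relation, and it uses only finitely
many digits of the direction, so that it makes sense for arbitrary directions with finite binary
expansions, without the oracle `e`. The claim to be proved is `N ≤ 2 * H + 2 * ε * r`.

Since the oracle `e` does not help much with `x`, the chain rule (`exists_chain_upper`,
`exists_chain_lower`) shows that the complexity of `q` given `z` remains at least `N - δ r - o(r)`
if `e` is added to the oracle (`exists_oracle_bounds`). An element of a small enumerable set is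
simple (`exists_count_bound`). Therefore at least about `2 ^ (N - δ r)` points of complexity at
most `N` given `z` are reached in the direction `e` (`exists_le_encard_reached`).

The same principle is applied to the direction. Its truncation to `t ≈ ε r / 2` digits has
complexity about `t * dim(e) > 2 δ r` by the hypothesis on the dimension, also given `z` up to a
loss of `δ r`, because a point whose complexity does not decrease with the oracle `e` contains
little information about `e`. Hence `e` is only one of more than `2 ^ (δ r)` directions, with
different truncations, in which so many simple points are reached (`exists_le_encard_richDirs`).
The first and the last digit of the truncation may be prescribed, and then any two of these
directions are at distance at least `2 ^ (-t)` modulo a half turn.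

Two projections determine a point, with an error that is inverse to the angle between them. So for
two of these directions, each pair of programs of length at most `H` accounts for at most
`2 ^ (2 t + O(1))` points which are reached in both (`encard_isClose_le`, `card_le_of_reaches`).
There are only `2 ^ (N + 1)` simple points altogether. If the common points were few, then
`2 ^ (δ r + 2)` directions with `2 ^ (N - δ r)` points each would need more
(`card_mul_le_of_card_inter_le`, `le_of_card_richDirs`). Thus
`N ≤ 2 * H + 2 * t + 2 * δ * r + o(r)` (`exists_core_bound`), and `2 * t ≤ ε * r` while
`2 * δ < ε`, because the dimension of a direction is at most `2`.

Everything has to be enumerable uniformly in the oracle (`CE`), and such relations are turned into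
prefix machines by `OracleCode.exists_machine`. In particular, projections in given directions are
computed with rational numbers: Wallis' product for `π / 2` and the powers `(1 + i y / k) ^ k`
lead to primitive recursive approximations of sine and cosine (`dir_approx`).
-/

namespace AlgInfo

/-! ### Oracle machines and finite oracles -/

open Classical in
/-- The first `k` bits of the characteristic sequence of the oracle `B`. -/
noncomputable def pre (B : Set ℕ) (k : ℕ) : List Bool :=
  (List.range k).map fun i => decide (i ∈ B)

@[simp] theorem length_pre (B : Set ℕ) (k : ℕ) : (pre B k).length = k := by simp [pre]

theorem pre_prefix (B : Set ℕ) {k l : ℕ} (h : k ≤ l) : pre B k <+: pre B l := by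
  unfold pre
  apply List.IsPrefix.map
  rw [List.prefix_iff_eq_take]
  simp [List.take_range, h]

theorem pre_succ (B : Set ℕ) (k : ℕ) [Decidable (k ∈ B)] :
    pre B (k + 1) = pre B k ++ [decide (k ∈ B)] := by
  simp only [pre, List.range_succ, List.map_append, List.map_cons, List.map_nil]
  congr 2
  congr

theorem getElem?_of_prefix {α : Type*} {σ τ : List α} (h : σ <+: τ) {i : ℕ} {b : α}
    (hb : σ[i]? = some b) : τ[i]? = some b := by
  obtain ⟨t, rfl⟩ := h
  obtain ⟨hi, -⟩ := List.getElem?_eq_some_iff.1 hb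
  rwa [List.getElem?_append_left hi]

theorem take_pre (B : Set ℕ) {k l : ℕ} (h : k ≤ l) : (pre B l).take k = pre B k := by
  have := List.prefix_iff_eq_take.1 (pre_prefix B h)
  simpa using this.symm

theorem getElem?_pre (B : Set ℕ) (k i : ℕ) [Decidable (i ∈ B)] :
    (pre B k)[i]? = if i < k then some (decide (i ∈ B)) else none := by
  unfold pre
  by_cases h : i < k
  · simp [h]
  · simp [h]

namespace OracleCode

theorem eval_pair_of_eq {B : Set ℕ} {cf cg : OracleCode} {n x y : ℕ}
    (hf : cf.eval B n = Part.some x) (hg : cg.eval B n = Part.some y) :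
    (pair cf cg).eval B n = Part.some (Nat.pair x y) := by
  simp [eval, hf, hg, Seq.seq]

theorem eval_comp (B : Set ℕ) (cf cg : OracleCode) (n : ℕ) :
    (comp cf cg).eval B n = (cg.eval B n).bind fun x => cf.eval B x := rfl

theorem eval_comp_of_eq {B : Set ℕ} {cf cg : OracleCode} {n x : ℕ}
    (hg : cg.eval B n = Part.some x) : (comp cf cg).eval B n = cf.eval B x := by
  rw [eval_comp, hg, Part.bind_some]

theorem eval_prec_zero (B : Set ℕ) (cf cg : OracleCode) (a : ℕ) :
    (prec cf cg).eval B (Nat.pair a 0) = cf.eval B a := by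
  simp [eval, Nat.unpaired]

theorem eval_prec_succ (B : Set ℕ) (cf cg : OracleCode) (a y : ℕ) :
    (prec cf cg).eval B (Nat.pair a (y + 1)) =
      ((prec cf cg).eval B (Nat.pair a y)).bind
        fun i => cg.eval B (Nat.pair a (Nat.pair y i)) := by
  simp [eval, Nat.unpaired]

theorem mem_eval_comp {B : Set ℕ} {cf cg : OracleCode} {n m : ℕ} :
    m ∈ (comp cf cg).eval B n ↔ ∃ x ∈ cg.eval B n, m ∈ cf.eval B x := by
  rw [eval_comp, Part.mem_bind_iff]

theorem mem_eval_pair {B : Set ℕ} {cf cg : OracleCode} {n m : ℕ} :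
    m ∈ (pair cf cg).eval B n ↔
      ∃ x ∈ cf.eval B n, ∃ y ∈ cg.eval B n, Nat.pair x y = m := by
  simp [eval, Seq.seq]

theorem mem_eval_prec_succ {B : Set ℕ} {cf cg : OracleCode} {a y m : ℕ} :
    m ∈ (prec cf cg).eval B (Nat.pair a (y + 1)) ↔
      ∃ x ∈ (prec cf cg).eval B (Nat.pair a y),
        m ∈ cg.eval B (Nat.pair a (Nat.pair y x)) := by
  rw [eval_prec_succ, Part.mem_bind_iff]

theorem mem_eval_rfind' {B : Set ℕ} {cf : OracleCode} {a b m : ℕ} :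
    m ∈ (rfind' cf).eval B (Nat.pair a b) ↔ ∃ j, m = j + b ∧
      0 ∈ cf.eval B (Nat.pair a (j + b)) ∧
      ∀ i < j, ∃ v, v + 1 ∈ cf.eval B (Nat.pair a (i + b)) := by
  have h : (rfind' cf).eval B (Nat.pair a b) = (Nat.rfind (show ℕ →. Bool from
      fun n => (cf.eval B (Nat.pair a (n + b))).map fun k => decide (k = 0))).map (· + b) := by
    simp only [eval, Nat.unpaired, Nat.unpair_pair]
    rfl
  rw [h, Part.mem_map_iff]
  refine exists_congr fun j => ?_
  rw [and_comm, eq_comm]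
  refine and_congr_right fun _ => ?_
  rw [Nat.mem_rfind]
  refine and_congr ⟨fun h => ?_, fun h => ?_⟩ ⟨fun h i hi => ?_, fun h i hi => ?_⟩
  · obtain ⟨x, hx, h0⟩ := (Part.mem_map_iff _).1 h
    have : x = 0 := by simpa using h0
    exact this ▸ hx
  · exact (Part.mem_map_iff _).2 ⟨0, h, by simp⟩
  · obtain ⟨x, hx, h0⟩ := (Part.mem_map_iff _).1 (h hi)
    cases x with
    | zero => simp at h0
    | succ v => exact ⟨v, hx⟩
  · obtain ⟨v, hv⟩ := h i hi
    exact (Part.mem_map_iff _).2 ⟨v + 1, hv, by simp⟩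

theorem exists_of_primrec {f : ℕ → ℕ} (hf : Nat.Primrec f) :
    ∃ c : OracleCode, ∀ (B : Set ℕ) (n : ℕ), c.eval B n = Part.some (f n) := by
  induction hf with
  | zero => exact ⟨zero, fun B n => rfl⟩
  | succ => exact ⟨succ, fun B n => rfl⟩
  | left => exact ⟨left, fun B n => rfl⟩
  | right => exact ⟨right, fun B n => rfl⟩
  | pair _ _ ihf ihg =>
    obtain ⟨cf, hf⟩ := ihf
    obtain ⟨cg, hg⟩ := ihg
    exact ⟨pair cf cg, fun B n => eval_pair_of_eq (hf B n) (hg B n)⟩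
  | comp _ _ ihf ihg =>
    obtain ⟨cf, hf⟩ := ihf
    obtain ⟨cg, hg⟩ := ihg
    exact ⟨comp cf cg, fun B n => by rw [eval_comp_of_eq (hg B n), hf]⟩
  | @prec f g _ _ ihf ihg =>
    obtain ⟨cf, hf⟩ := ihf
    obtain ⟨cg, hg⟩ := ihg
    refine ⟨prec cf cg, fun B n => ?_⟩
    obtain ⟨a, y, rfl⟩ : ∃ a y, n = Nat.pair a y := ⟨_, _, (Nat.pair_unpair n).symm⟩
    simp only [Nat.unpaired, Nat.unpair_pair]
    induction y with
    | zero => exact (eval_prec_zero B cf cg a).trans (hf B a)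
    | succ y ih => rw [eval_prec_succ, ih, Part.bind_some, hg]

/-- An oracle program that writes down the first `k` bits of its oracle; the other argument is only
carried along. -/
theorem exists_prefix_code :
    ∃ c : OracleCode, ∀ (B : Set ℕ) (a k : ℕ),
      c.eval B (Nat.pair a k) = Part.some (Encodable.encode (pre B k)) := by
  have hp : Primrec fun n : ℕ => Encodable.encode
      (((Encodable.decode n.unpair.1 : Option (List Bool)).getD []) ++
        [decide (n.unpair.2 = 1)]) := by
    refine Primrec.encode.comp (Primrec.list_concat.comp ?_ ?_)
    · exact Primrec.option_getD.comp (Primrec.decode.comp (Primrec.fst.comp Primrec.unpair))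
        (Primrec.const _)
    · exact PrimrecPred.decide
        (Primrec.eq.comp (Primrec.snd.comp Primrec.unpair) (Primrec.const 1))
  obtain ⟨ca, hca⟩ := exists_of_primrec (Primrec.nat_iff.1 hp)
  obtain ⟨cz, hcz⟩ := exists_of_primrec
    (Primrec.nat_iff.1 (Primrec.const (α := ℕ) (Encodable.encode ([] : List Bool))))
  refine ⟨prec cz (comp ca (pair (comp right right) (comp oracle (comp left right)))),
    fun B a k => ?_⟩
  classical
  have ho : ∀ k i, eval B (pair (comp right right) (comp oracle (comp left right)))
      (Nat.pair a (Nat.pair k i)) = Part.some (Nat.pair i (if k ∈ B then 1 else 0)) := by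
    intro k i
    have h1 : eval B right (Nat.pair a (Nat.pair k i)) = Part.some (Nat.pair k i) := by
      simp [eval]
    have h2 : eval B (comp left right) (Nat.pair a (Nat.pair k i)) = Part.some k := by
      rw [eval_comp_of_eq h1]; simp [eval]
    refine eval_pair_of_eq ?_ ?_
    · rw [eval_comp_of_eq h1]; simp [eval]
    · rw [eval_comp_of_eq h2]; rfl
  induction k with
  | zero => rw [eval_prec_zero, hcz]; simp [pre]
  | succ k ih =>
    have : (decide ((if k ∈ B then 1 else 0) = 1)) = decide (k ∈ B) := by
      by_cases h : k ∈ B <;> simp [h]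
    rw [eval_prec_succ, ih, Part.bind_some, eval_comp_of_eq (ho _ _), hca]
    simp only [Nat.unpair_pair, Encodable.encodek, Option.getD_some, this, pre_succ B k]

/-- An oracle program that looks at longer and longer finite parts of the oracle, until the
primitive recursive function `H` returns a value. -/
theorem exists_search_code {H : List Bool → ℕ → Option ℕ} (hH : Primrec₂ H) :
    ∃ c : OracleCode, ∀ (B : Set ℕ) (n m : ℕ), m ∈ c.eval B n ↔
      ∃ k, H (pre B k) n = some m ∧ ∀ k' < k, H (pre B k') n = none := by
  have hdec : Primrec fun n : ℕ => (Encodable.decode n.unpair.2 : Option (List Bool)).getD [] :=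
    Primrec.option_getD.comp (Primrec.decode.comp (Primrec.snd.comp Primrec.unpair))
      (Primrec.const _)
  have hval : Primrec fun n : ℕ =>
      H ((Encodable.decode n.unpair.2 : Option (List Bool)).getD []) n.unpair.1 :=
    hH.comp hdec (Primrec.fst.comp Primrec.unpair)
  have htest := Primrec.cond (Primrec.option_isSome.comp hval) (Primrec.const 0) (Primrec.const 1)
  obtain ⟨ct, hct⟩ := exists_of_primrec (Primrec.nat_iff.1 htest)
  obtain ⟨cv, hcv⟩ := exists_of_primrec
    (Primrec.nat_iff.1 (Primrec.option_getD.comp hval (Primrec.const 0)))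
  obtain ⟨cp, hcp⟩ := exists_prefix_code
  obtain ⟨cid, hcid⟩ := exists_of_primrec (Primrec.nat_iff.1 Primrec.id)
  let T := comp ct (pair left cp)
  have hT : ∀ B n k, T.eval B (Nat.pair n k) =
      Part.some (bif (H (pre B k) n).isSome then 0 else 1) := by
    intro B n k
    have h : eval B (pair left cp) (Nat.pair n k) =
        Part.some (Nat.pair n (Encodable.encode (pre B k))) :=
      eval_pair_of_eq (by simp [eval]) (hcp B n k)
    rw [eval_comp_of_eq h, hct]
    simp
  let S := comp cv (pair left cp)
  have hS : ∀ B n k, S.eval B (Nat.pair n k) = Part.some ((H (pre B k) n).getD 0) := by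
    intro B n k
    have h : eval B (pair left cp) (Nat.pair n k) =
        Part.some (Nat.pair n (Encodable.encode (pre B k))) :=
      eval_pair_of_eq (by simp [eval]) (hcp B n k)
    rw [eval_comp_of_eq h, hcv]
    simp
  refine ⟨comp S (pair cid (comp (rfind' T) (pair cid zero))), fun B n m => ?_⟩
  have hr : ∀ k, k ∈ eval B (comp (rfind' T) (pair cid zero)) n ↔
      (H (pre B k) n).isSome = true ∧ ∀ k' < k, H (pre B k') n = none := by
    intro k
    have h0 : eval B (comp (rfind' T) (pair cid zero)) n = eval B (rfind' T) (Nat.pair n 0) :=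
      eval_comp_of_eq (eval_pair_of_eq (hcid B n) rfl)
    rw [h0, mem_eval_rfind']
    simp only [add_zero, hT, Part.mem_some_iff, exists_eq_left']
    refine and_congr ?_ (forall₂_congr fun k' _ => ?_)
    · cases H (pre B k) n <;> simp
    · cases H (pre B k') n <;> simp
  have hc : m ∈ eval B (comp S (pair cid (comp (rfind' T) (pair cid zero)))) n ↔
      ∃ k, k ∈ eval B (comp (rfind' T) (pair cid zero)) n ∧ m = (H (pre B k) n).getD 0 := by
    generalize comp (rfind' T) (pair cid zero) = D at *
    rw [eval_comp]
    have : eval B (pair cid D) n = (eval B D n).map (Nat.pair n) := by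
      simp [eval, hcid, Seq.seq]
    simp [this, hS]
  rw [hc]
  refine exists_congr fun k => ?_
  rw [hr]
  cases h : H (pre B k) n with
  | none => simp
  | some v =>
    simp only [Option.isSome_some, true_and, Option.getD_some, Option.some.injEq, and_comm]
    refine and_congr_left fun _ => eq_comm

/-- The computation of a program with a finite part `σ` of the oracle, with unbounded searches cut
off at `σ.length`; it fails where it would leave the known part. -/
def evs : OracleCode → List Bool → ℕ → Option ℕ
  | zero, _, _ => some 0
  | succ, _, n => some (n + 1)
  | left, _, n => some n.unpair.1
  | right, _, n => some n.unpair.2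
  | oracle, σ, n => (σ[n]?).map fun b => bif b then 1 else 0
  | pair cf cg, σ, n => (evs cf σ n).bind fun x => (evs cg σ n).map fun y => Nat.pair x y
  | comp cf cg, σ, n => (evs cg σ n).bind (evs cf σ)
  | prec cf cg, σ, n =>
    Nat.rec (evs cf σ n.unpair.1)
      (fun y IH => IH.bind fun i => evs cg σ (Nat.pair n.unpair.1 (Nat.pair y i))) n.unpair.2
  | rfind' cf, σ, n =>
    let g := fun i => evs cf σ (Nat.pair n.unpair.1 (i + n.unpair.2))
    let j := (List.range σ.length).findIdx fun i => g i == none || g i == some 0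
    if j < σ.length then (g j).map fun _ => j + n.unpair.2 else none

theorem primrec_evs (c : OracleCode) : Primrec₂ (evs c) := by
  have h1 : Primrec fun n : ℕ => n.unpair.1 := Primrec.fst.comp Primrec.unpair
  have h2 : Primrec fun n : ℕ => n.unpair.2 := Primrec.snd.comp Primrec.unpair
  induction c with
  | zero => exact Primrec.const _
  | succ => exact Primrec.option_some.comp (Primrec.succ.comp Primrec.snd)
  | left => exact Primrec.option_some.comp (h1.comp Primrec.snd)
  | right => exact Primrec.option_some.comp (h2.comp Primrec.snd)
  | oracle =>
    exact Primrec.option_map Primrec.list_getElem?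
      (Primrec.cond Primrec.snd (Primrec.const 1) (Primrec.const 0)).to₂
  | pair cf cg hf hg =>
    refine Primrec.option_bind hf (Primrec₂.mk (Primrec.option_map
      (hg.comp (Primrec.fst.comp Primrec.fst) (Primrec.snd.comp Primrec.fst)) (Primrec₂.mk ?_)))
    exact Primrec₂.natPair.comp (Primrec.snd.comp Primrec.fst) Primrec.snd
  | comp cf cg hf hg =>
    exact Primrec.option_bind hg
      (Primrec₂.mk (hf.comp (Primrec.fst.comp Primrec.fst) Primrec.snd))
  | prec cf cg hf hg =>
    refine Primrec.nat_rec' (f := fun p : List Bool × ℕ => p.2.unpair.2)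
      (g := fun p => evs cf p.1 p.2.unpair.1)
      (h := fun p q => q.2.bind fun i => evs cg p.1 (Nat.pair p.2.unpair.1 (Nat.pair q.1 i)))
      (h2.comp Primrec.snd) (hf.comp Primrec.fst (h1.comp Primrec.snd)) ?_
    refine Primrec₂.mk (Primrec.option_bind (Primrec.snd.comp Primrec.snd) (Primrec₂.mk ?_))
    refine hg.comp (Primrec.fst.comp (Primrec.fst.comp Primrec.fst)) ?_
    refine Primrec₂.natPair.comp ?_ (Primrec₂.natPair.comp ?_ Primrec.snd)
    · exact h1.comp (Primrec.snd.comp (Primrec.fst.comp Primrec.fst))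
    · exact Primrec.fst.comp (Primrec.snd.comp Primrec.fst)
  | rfind' cf hf =>
    have hg : Primrec₂ fun (p : List Bool × ℕ) (i : ℕ) =>
        evs cf p.1 (Nat.pair p.2.unpair.1 (i + p.2.unpair.2)) := by
      refine Primrec₂.mk (hf.comp (Primrec.fst.comp Primrec.fst) (Primrec₂.natPair.comp
        (h1.comp (Primrec.snd.comp Primrec.fst)) (Primrec.nat_add.comp Primrec.snd
        (h2.comp (Primrec.snd.comp Primrec.fst)))))
    have hlen : Primrec fun p : List Bool × ℕ => p.1.length :=
      Primrec.list_length.comp Primrec.fst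
    have hp : Primrec fun o : Option ℕ => o == none || o == some 0 :=
      (Primrec.option_casesOn (f := fun _ => true) (g := fun _ n => decide (n = 0)) Primrec.id
        (Primrec.const true) (Primrec₂.mk (PrimrecPred.decide
          (Primrec.eq.comp Primrec.snd (Primrec.const 0))))).of_eq fun o => by
        cases o with
        | none => rfl
        | some n => cases n <;> rfl
    have hj : Primrec fun p : List Bool × ℕ => (List.range p.1.length).findIdx fun i =>
        evs cf p.1 (Nat.pair p.2.unpair.1 (i + p.2.unpair.2)) == none ||
          evs cf p.1 (Nat.pair p.2.unpair.1 (i + p.2.unpair.2)) == some 0 :=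
      Primrec.list_findIdx (Primrec.list_range.comp hlen) (Primrec₂.mk (hp.comp hg))
    refine Primrec.ite (Primrec.nat_lt.comp hj hlen) ?_ (Primrec.const _)
    exact Primrec.option_map (hg.comp Primrec.id hj) (Primrec₂.mk
      (Primrec.nat_add.comp (hj.comp Primrec.fst) (h2.comp (Primrec.snd.comp Primrec.fst))))

/-- The bounded computation of an unbounded search in the form of `mem_eval_rfind'`; the cut-off at
the length of the known part of the oracle appears as the bound `j < σ.length`. -/
theorem mem_evs_rfind' (cf : OracleCode) (σ : List Bool) (n m : ℕ) :
    evs (rfind' cf) σ n = some m ↔ ∃ j < σ.length, m = j + n.unpair.2 ∧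
      evs cf σ (Nat.pair n.unpair.1 (j + n.unpair.2)) = some 0 ∧
      ∀ i < j, ∃ v, evs cf σ (Nat.pair n.unpair.1 (i + n.unpair.2)) = some (v + 1) := by
  simp only [evs]
  set g := fun i => evs cf σ (Nat.pair n.unpair.1 (i + n.unpair.2)) with hg
  set j := (List.range σ.length).findIdx fun i => g i == none || g i == some 0 with hj
  constructor
  · intro h
    split_ifs at h with hlt
    have hlt' : j < (List.range σ.length).length := by simpa using hlt
    have h1 := List.findIdx_getElem (w := hlt')
    have h2 : ∀ i < j, ∃ v, g i = some (v + 1) := by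
      intro i hi
      have := List.not_of_lt_findIdx hi
      simp only [List.getElem_range] at this
      cases hgi : g i with
      | none => simp [hgi] at this
      | some v =>
        cases v with
        | zero => simp [hgi] at this
        | succ v => exact ⟨v, rfl⟩
    rw [Option.map_eq_some_iff] at h
    obtain ⟨v, hv, rfl⟩ := h
    refine ⟨j, hlt, rfl, ?_, h2⟩
    simp only [List.getElem_range] at h1
    change g j = some 0
    change (g j == none || g j == some 0) = true at h1
    change g j = some v at hv
    simpa [hv] using h1
  · rintro ⟨i, hi, rfl, h0, hlt⟩
    have : j = i := by
      rw [hj, List.findIdx_eq (by simpa using hi)]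
      refine ⟨by simp [hg, h0], fun k hk => ?_⟩
      obtain ⟨v, hv⟩ := hlt k hk
      simp [hg, hv]
    rw [this, if_pos hi]
    simp [h0]

/-- A computation is not changed by further knowledge of the oracle. -/
theorem evs_mono (c : OracleCode) {σ τ : List Bool} (h : σ <+: τ) :
    ∀ {n m : ℕ}, evs c σ n = some m → evs c τ n = some m := by
  induction c with
  | zero => exact id
  | succ => exact id
  | left => exact id
  | right => exact id
  | oracle =>
    intro n m hm
    simp only [evs, Option.map_eq_some_iff] at hm ⊢
    obtain ⟨b, hb, hm⟩ := hm
    exact ⟨b, getElem?_of_prefix h hb, hm⟩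
  | pair cf cg hf hg =>
    intro n m hm
    simp only [evs, Option.bind_eq_some_iff, Option.map_eq_some_iff] at hm ⊢
    obtain ⟨x, hx, y, hy, hm⟩ := hm
    exact ⟨x, hf hx, y, hg hy, hm⟩
  | comp cf cg hf hg =>
    intro n m hm
    simp only [evs, Option.bind_eq_some_iff] at hm ⊢
    obtain ⟨x, hx, hm⟩ := hm
    exact ⟨x, hg hx, hf hm⟩
  | prec cf cg hf hg =>
    intro n m
    simp only [evs]
    induction n.unpair.2 generalizing m with
    | zero => exact hf
    | succ y ih =>
      intro hm
      simp only [Option.bind_eq_some_iff] at hm ⊢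
      obtain ⟨x, hx, hm⟩ := hm
      exact ⟨x, ih hx, hg hm⟩
  | rfind' cf hf =>
    intro n m hm
    rw [mem_evs_rfind'] at hm ⊢
    obtain ⟨j, hj, rfl, h0, hlt⟩ := hm
    refine ⟨j, hj.trans_le h.length_le, rfl, hf h0, fun i hi => ?_⟩
    obtain ⟨v, hv⟩ := hlt i hi
    exact ⟨v, hf hv⟩

theorem evs_pre_mono (c : OracleCode) (B : Set ℕ) {k l : ℕ} (h : k ≤ l) {n m : ℕ}
    (hm : evs c (pre B k) n = some m) : evs c (pre B l) n = some m :=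
  evs_mono c (pre_prefix B h) hm

/-- A halting computation uses only a finite part of the oracle. -/
theorem mem_eval_iff (c : OracleCode) (B : Set ℕ) :
    ∀ {n m : ℕ}, m ∈ c.eval B n ↔ ∃ k, evs c (pre B k) n = some m := by
  induction c with
  | zero => intro n m; simp [eval, evs, pure, PFun.pure, eq_comm]
  | succ => intro n m; simp [eval, evs, eq_comm]
  | left => intro n m; simp [eval, evs, eq_comm]
  | right => intro n m; simp [eval, evs, eq_comm]
  | oracle =>
    intro n m
    classical
    simp only [eval, evs, Part.mem_some_iff, getElem?_pre]
    constructor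
    · rintro rfl
      exact ⟨n + 1, by by_cases h : n ∈ B <;> simp [h]⟩
    · rintro ⟨k, hk⟩
      split_ifs at hk
      · by_cases h : n ∈ B <;> simp [h] at hk ⊢ <;> exact hk.symm
      · simp at hk
  | pair cf cg hf hg =>
    intro n m
    simp only [mem_eval_pair, evs, Option.bind_eq_some_iff, Option.map_eq_some_iff, hf, hg]
    constructor
    · rintro ⟨x, ⟨k, hk⟩, y, ⟨l, hl⟩, rfl⟩
      exact ⟨max k l, x, evs_pre_mono cf B (le_max_left _ _) hk, y,
        evs_pre_mono cg B (le_max_right _ _) hl, rfl⟩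
    · rintro ⟨k, x, hx, y, hy, rfl⟩
      exact ⟨x, ⟨k, hx⟩, y, ⟨k, hy⟩, rfl⟩
  | comp cf cg hf hg =>
    intro n m
    simp only [mem_eval_comp, evs, Option.bind_eq_some_iff, hf, hg]
    constructor
    · rintro ⟨x, ⟨k, hk⟩, ⟨l, hl⟩⟩
      exact ⟨max k l, x, evs_pre_mono cg B (le_max_left _ _) hk,
        evs_pre_mono cf B (le_max_right _ _) hl⟩
    · rintro ⟨k, x, hx, hy⟩
      exact ⟨x, ⟨k, hx⟩, ⟨k, hy⟩⟩
  | prec cf cg hf hg =>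
    intro n m
    obtain ⟨a, y, rfl⟩ : ∃ a y, n = Nat.pair a y := ⟨_, _, (Nat.pair_unpair n).symm⟩
    induction y generalizing m with
    | zero =>
      have hs : ∀ k, evs (prec cf cg) (pre B k) (Nat.pair a 0) = evs cf (pre B k) a := by
        intro k
        simp [evs, Nat.unpair_pair]
      simp only [eval_prec_zero, hs, hf]
    | succ y ih =>
      have hs : ∀ k, evs (prec cf cg) (pre B k) (Nat.pair a (y + 1)) =
          (evs (prec cf cg) (pre B k) (Nat.pair a y)).bind
            fun i => evs cg (pre B k) (Nat.pair a (Nat.pair y i)) := by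
        intro k
        simp only [evs, Nat.unpair_pair]
      simp only [mem_eval_prec_succ, hs, Option.bind_eq_some_iff, ih, hg]
      constructor
      · rintro ⟨x, ⟨k, hk⟩, ⟨l, hl⟩⟩
        exact ⟨max k l, x, evs_pre_mono _ B (le_max_left _ _) hk,
          evs_pre_mono cg B (le_max_right _ _) hl⟩
      · rintro ⟨k, x, hx, hy⟩
        exact ⟨x, ⟨k, hx⟩, ⟨k, hy⟩⟩
  | rfind' cf hf =>
    intro n m
    obtain ⟨a, b, rfl⟩ : ∃ a y, n = Nat.pair a y := ⟨_, _, (Nat.pair_unpair n).symm⟩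
    simp only [mem_evs_rfind', mem_eval_rfind', length_pre, hf, Nat.unpair_pair]
    constructor
    · rintro ⟨j, rfl, ⟨k, hk⟩, hlt⟩
      have : ∀ i, ∃ l, i < j → ∃ v, evs cf (pre B l) (Nat.pair a (i + b)) = some (v + 1) := by
        intro i
        by_cases hi : i < j
        · obtain ⟨v, l, hl⟩ := hlt i hi
          exact ⟨l, fun _ => ⟨v, hl⟩⟩
        · exact ⟨0, fun h => absurd h hi⟩
      choose l hl using this
      refine ⟨max (max k (j + 1)) ((Finset.range j).sup l), j, ?_, rfl, ?_, fun i hi => ?_⟩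
      · exact lt_of_lt_of_le (Nat.lt_succ_self j) ((le_max_right _ _).trans (le_max_left _ _))
      · exact evs_pre_mono cf B ((le_max_left _ _).trans (le_max_left _ _)) hk
      · obtain ⟨v, hv⟩ := hl i hi
        exact ⟨v, evs_pre_mono cf B ((Finset.le_sup (f := l) (Finset.mem_range.2 hi)).trans
          (le_max_right _ _)) hv⟩
    · rintro ⟨k, j, -, rfl, h0, hlt⟩
      refine ⟨j, rfl, ⟨k, h0⟩, fun i hi => ?_⟩
      obtain ⟨v, hv⟩ := hlt i hi
      exact ⟨v, k, hv⟩

end OracleCode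

/-! ### Relations enumerable uniformly in an oracle -/

section CE

variable {α β : Type*} [Primcodable α] [Primcodable β]

theorem primrecRel_exists_lt {R : ℕ → α → Prop} (hR : PrimrecRel R) :
    PrimrecRel fun n a => ∃ i < n, R i a :=
  (hR.exists_mem_list.comp (Primrec.list_range.comp Primrec.fst) Primrec.snd).of_eq (by simp)

theorem primrecRel_forall_lt {R : ℕ → α → Prop} (hR : PrimrecRel R) :
    PrimrecRel fun n a => ∀ i < n, R i a :=
  (hR.forall_mem_list.comp (Primrec.list_range.comp Primrec.fst) Primrec.snd).of_eq (by simp)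

/-- The relation `R B a` is enumerable with the oracle `B`, uniformly in `B`: it holds if and only
if a primitive recursive test accepts `a` and some finite part of the oracle. -/
def CE (R : Set ℕ → α → Prop) : Prop :=
  ∃ F : List Bool → α → Prop, PrimrecRel F ∧ (∀ σ τ a, σ <+: τ → F σ a → F τ a) ∧
    ∀ B a, R B a ↔ ∃ k, F (pre B k) a

/-- The monotonicity of the test is not a restriction: every test may be run on all initial segments
of the known part of the oracle. -/
theorem CE.of_test {R : Set ℕ → α → Prop} {F : List Bool → α → Prop} (hF : PrimrecRel F)
    (h : ∀ B a, R B a ↔ ∃ k, F (pre B k) a) : CE R := by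
  refine ⟨fun σ a => ∃ i < σ.length + 1, F (σ.take i) a, ?_, ?_, fun B a => ?_⟩
  · have h1 : PrimrecRel fun (i : ℕ) (p : List Bool × α) => F (p.1.take i) p.2 :=
      PrimrecRel.comp hF (Primrec.list_take.comp Primrec.fst (Primrec.fst.comp Primrec.snd))
        (Primrec.snd.comp Primrec.snd)
    have h2 := primrecRel_exists_lt h1
    have h3 : PrimrecPred fun p : List Bool × α => ∃ i < p.1.length + 1, F (p.1.take i) p.2 :=
      PrimrecRel.comp h2 (Primrec.succ.comp (Primrec.list_length.comp Primrec.fst)) Primrec.id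
    exact h3
  · rintro σ τ a ⟨t, rfl⟩ ⟨i, hi, h⟩
    refine ⟨i, hi.trans_le (by simp), ?_⟩
    rwa [List.take_append_of_le_length (by omega)]
  · rw [h]
    constructor
    · rintro ⟨k, hk⟩
      exact ⟨k, k, by simp, by rwa [take_pre B le_rfl]⟩
    · rintro ⟨k, i, hi, h⟩
      rw [length_pre] at hi
      exact ⟨i, by rwa [take_pre B (by omega)] at h⟩

theorem CE.of_eq {R R' : Set ℕ → α → Prop} (h : CE R) (hR : ∀ B a, R B a ↔ R' B a) : CE R' := by
  obtain ⟨F, h1, h2, h3⟩ := h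
  exact ⟨F, h1, h2, fun B a => (hR B a).symm.trans (h3 B a)⟩

theorem CE.of_primrecPred {p : α → Prop} (hp : PrimrecPred p) : CE fun _ a => p a :=
  ⟨fun _ a => p a, PrimrecPred.comp hp Primrec.snd, fun _ _ _ _ => id, fun _ _ => by simp⟩

theorem CE.and {R S : Set ℕ → α → Prop} (hR : CE R) (hS : CE S) : CE fun B a => R B a ∧ S B a := by
  obtain ⟨F, h1, h2, h3⟩ := hR
  obtain ⟨G, g1, g2, g3⟩ := hS
  refine ⟨fun σ a => F σ a ∧ G σ a, PrimrecPred.and h1 g1,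
    fun σ τ a h hh => ⟨h2 _ _ _ h hh.1, g2 _ _ _ h hh.2⟩, fun B a => ?_⟩
  simp only [h3, g3]
  constructor
  · rintro ⟨⟨k, hk⟩, ⟨l, hl⟩⟩
    exact ⟨max k l, h2 _ _ _ (pre_prefix B (le_max_left _ _)) hk,
      g2 _ _ _ (pre_prefix B (le_max_right _ _)) hl⟩
  · rintro ⟨k, hk, hl⟩
    exact ⟨⟨k, hk⟩, ⟨k, hl⟩⟩

theorem CE.comp {R : Set ℕ → β → Prop} (hR : CE R) {f : α → β} (hf : Primrec f) :
    CE fun B a => R B (f a) := by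
  obtain ⟨F, h1, h2, h3⟩ := hR
  exact ⟨fun σ a => F σ (f a), PrimrecRel.comp h1 Primrec.fst (hf.comp Primrec.snd),
    fun σ τ a h => h2 _ _ _ h, fun B a => h3 _ _⟩

theorem CE.exists {R : Set ℕ → α × β → Prop} (hR : CE R) : CE fun B a => ∃ b, R B (a, b) := by
  obtain ⟨F, h1, h2, h3⟩ := hR
  refine ⟨fun σ a => ∃ n < σ.length, ∃ b ∈ (Encodable.decode (α := β) n).toList, F σ (a, b),
    ?_, ?_, fun B a => ?_⟩
  · have e1 : PrimrecRel fun (b : β) (p : List Bool × α) => F p.1 (p.2, b) :=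
      PrimrecRel.comp h1 (Primrec.fst.comp Primrec.snd)
        ((Primrec.snd.comp Primrec.snd).pair Primrec.fst)
    have e2 : PrimrecRel fun (n : ℕ) (p : List Bool × α) =>
        ∃ b ∈ (Encodable.decode (α := β) n).toList, F p.1 (p.2, b) :=
      (PrimrecRel.exists_mem_list e1).comp
        (Primrec.optionToList.comp (Primrec.decode.comp Primrec.fst)) Primrec.snd
    have e3 := primrecRel_exists_lt e2
    have e4 : PrimrecPred fun p : List Bool × α => ∃ n < p.1.length,
        ∃ b ∈ (Encodable.decode (α := β) n).toList, F p.1 (p.2, b) :=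
      PrimrecRel.comp e3 (Primrec.list_length.comp Primrec.fst) Primrec.id
    exact e4
  · rintro σ τ a h ⟨n, hn, b, hb, hF⟩
    exact ⟨n, hn.trans_le h.length_le, b, hb, h2 _ _ _ h hF⟩
  · simp only [h3, length_pre]
    constructor
    · rintro ⟨b, k, hk⟩
      refine ⟨max k (Encodable.encode b + 1), Encodable.encode b,
        lt_of_lt_of_le (Nat.lt_succ_self _) (le_max_right _ _), b, by simp, ?_⟩
      exact h2 _ _ _ (pre_prefix B (le_max_left _ _)) hk
    · rintro ⟨k, n, -, b, -, h⟩
      exact ⟨b, k, h⟩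

theorem CE.forall_mem_list {R : Set ℕ → α × β → Prop} (hR : CE R) {l : α → List β}
    (hl : Primrec l) : CE fun B a => ∀ b ∈ l a, R B (a, b) := by
  obtain ⟨F, h1, h2, h3⟩ := hR
  refine ⟨fun σ a => ∀ b ∈ l a, F σ (a, b), ?_, fun σ τ a h hh b hb => h2 _ _ _ h (hh b hb),
    fun B a => ?_⟩
  · have e1 : PrimrecRel fun (b : β) (p : List Bool × α) => F p.1 (p.2, b) :=
      PrimrecRel.comp h1 (Primrec.fst.comp Primrec.snd)
        ((Primrec.snd.comp Primrec.snd).pair Primrec.fst)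
    exact (PrimrecRel.forall_mem_list e1).comp (hl.comp Primrec.snd) Primrec.id
  · simp only [h3]
    constructor
    · intro h
      generalize l a = L at h
      induction L with
      | nil => exact ⟨0, by simp⟩
      | cons b L ih =>
        obtain ⟨k, hk⟩ := ih fun b hb => h b (List.mem_cons_of_mem _ hb)
        obtain ⟨j, hj⟩ := h b List.mem_cons_self
        refine ⟨max k j, fun c hc => ?_⟩
        rcases List.mem_cons.1 hc with rfl | hc
        · exact h2 _ _ _ (pre_prefix B (le_max_right _ _)) hj
        · exact h2 _ _ _ (pre_prefix B (le_max_left _ _)) (hk c hc)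
    · rintro ⟨k, hk⟩ b hb
      exact ⟨k, hk b hb⟩

theorem ce_mem : CE fun B (n : ℕ) => n ∈ B := by
  refine CE.of_test (F := fun σ n => σ[n]? = some true)
    (Primrec.eq.comp Primrec.list_getElem? (Primrec.const _)) fun B n => ?_
  classical
  simp only [getElem?_pre]
  constructor
  · intro h
    exact ⟨n + 1, by simp [h]⟩
  · rintro ⟨k, hk⟩
    split_ifs at hk
    simpa using hk

theorem primrec_nodup : PrimrecPred fun l : List β => l.Nodup := by
  classical
  have e1 : PrimrecRel fun (i : ℕ) (p : List β × ℕ) => ¬ p.1[i]? = p.1[p.2]? :=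
    PrimrecPred.not (Primrec.eq.comp
      (Primrec.list_getElem?.comp (Primrec.fst.comp Primrec.snd) Primrec.fst)
      (Primrec.list_getElem?.comp (Primrec.fst.comp Primrec.snd) (Primrec.snd.comp Primrec.snd)))
  have e1' := primrecRel_forall_lt e1
  have e2' : PrimrecPred fun p : ℕ × List β => ∀ i < p.1, ¬ p.2[i]? = p.2[p.1]? :=
    PrimrecRel.comp e1' Primrec.fst (Primrec.snd.pair Primrec.fst)
  have e2 : PrimrecRel fun (j : ℕ) (l : List β) => ∀ i < j, ¬ l[i]? = l[j]? := e2'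
  have e2'' := primrecRel_forall_lt e2
  have e3 : PrimrecPred fun l : List β => ∀ j < l.length, ∀ i < j, ¬ l[i]? = l[j]? :=
    PrimrecRel.comp e2'' Primrec.list_length Primrec.id
  refine e3.of_eq fun l => ?_
  rw [List.nodup_iff_getElem?_ne_getElem?]
  exact ⟨fun h i j hij hj => h j hj i hij, fun h j hj i hij => h i j hij hj⟩

/-- It is enumerable that an enumerable set has at least a given number of elements. -/
theorem CE.le_encard {R : Set ℕ → α × β → Prop} (hR : CE R) {th : α → ℕ} (hth : Primrec th) :
    CE fun B a => (th a : ℕ∞) ≤ {b | R B (a, b)}.encard := by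
  have e1 : CE fun B (p : α × List β) => ∀ b ∈ p.2, R B (p.1, b) :=
    CE.forall_mem_list (R := fun B (q : (α × List β) × β) => R B (q.1.1, q.2))
      (hR.comp ((Primrec.fst.comp Primrec.fst).pair Primrec.snd)) Primrec.snd
  have e2 : PrimrecPred fun p : α × List β => p.2.Nodup ∧ p.2.length = th p.1 :=
    PrimrecPred.and (primrec_nodup.comp Primrec.snd)
      (Primrec.eq.comp (Primrec.list_length.comp Primrec.snd) (hth.comp Primrec.fst))
  refine CE.of_eq (CE.exists ((CE.of_primrecPred e2).and e1)) fun B a => ?_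
  classical
  constructor
  · rintro ⟨l, ⟨hn, hl⟩, h⟩
    rw [← hl, ← List.toFinset_card_of_nodup hn, ← Set.encard_coe_eq_coe_finsetCard]
    exact Set.encard_le_encard fun b hb => h b (by simpa using hb)
  · intro h
    obtain ⟨t, ht, hc⟩ := Set.exists_subset_encard_eq h
    have hfin : t.Finite := Set.finite_of_encard_eq_coe hc
    refine ⟨hfin.toFinset.toList, ⟨Finset.nodup_toList _, ?_⟩, fun b hb => ht (by simpa using hb)⟩
    rw [Finset.length_toList]
    rw [hfin.encard_eq_coe_toFinset_card] at hc
    exact_mod_cast hc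

/-- The left half of a Turing join. -/
def leftPart (B : Set ℕ) : Set ℕ := {n | 2 * n ∈ B}

@[simp] theorem leftPart_join (A B : Set ℕ) : leftPart (join A B) = A := by
  ext n
  simp only [leftPart, join, Set.mem_ofPred_eq]
  constructor
  · rintro (⟨m, hm, h⟩ | ⟨m, hm, h⟩)
    · obtain rfl : n = m := by omega
      exact hm
    · omega
  · intro h
    exact Or.inl ⟨n, h, rfl⟩

theorem CE.leftPart {R : Set ℕ → α → Prop} (hR : CE R) :
    CE fun B a => R (AlgInfo.leftPart B) a := by
  obtain ⟨F, h1, h2, h3⟩ := hR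
  refine CE.of_test (F := fun σ a =>
    F ((List.range (σ.length / 2)).map fun i => (σ[2 * i]?).getD false) a) ?_ fun B a => ?_
  · refine PrimrecRel.comp h1 (Primrec.list_map ?_ (Primrec₂.mk ?_)) Primrec.snd
    · exact Primrec.list_range.comp (Primrec.nat_div.comp
        (Primrec.list_length.comp Primrec.fst) (Primrec.const 2))
    · exact Primrec.option_getD.comp (Primrec.list_getElem?.comp (Primrec.fst.comp Primrec.fst)
        (Primrec.nat_mul.comp (Primrec.const 2) Primrec.snd)) (Primrec.const false)
  · have key : ∀ k, ((List.range ((pre B k).length / 2)).map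
        fun i => ((pre B k)[2 * i]?).getD false) = pre (AlgInfo.leftPart B) (k / 2) := by
      classical
      intro k
      rw [length_pre]
      unfold pre
      refine List.map_congr_left fun i hi => ?_
      have hi' : 2 * i < k := by
        have := List.mem_range.1 hi
        omega
      simp only [List.getElem?_map, List.getElem?_range hi', Option.map_some, Option.getD_some]
      rfl
    simp only [key, h3]
    constructor
    · rintro ⟨k, hk⟩
      exact ⟨2 * k, by simpa using hk⟩
    · rintro ⟨k, hk⟩
      exact ⟨_, hk⟩

end CE

/-! ### Binary notation -/

theorem primrec_bits : Primrec Nat.bits := by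
  let g : Unit → List (List Bool) → Option (List Bool) := fun _ L =>
    if L.length = 0 then some [] else (L[L.length / 2]?).map fun l => L.length.bodd :: l
  have hlen : Primrec fun p : Unit × List (List Bool) => p.2.length :=
    Primrec.list_length.comp Primrec.snd
  have hg : Primrec₂ g := by
    refine Primrec.ite (Primrec.eq.comp hlen (Primrec.const 0)) (Primrec.const _)
      (Primrec.option_map (Primrec.list_getElem?.comp Primrec.snd
        (Primrec.nat_div.comp hlen (Primrec.const 2))) (Primrec₂.mk ?_))
    exact Primrec.list_cons.comp (Primrec.nat_bodd.comp (hlen.comp Primrec.fst)) Primrec.snd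
  have := Primrec.nat_strong_rec (fun (_ : Unit) n => Nat.bits n) hg fun _ n => by
    rcases Nat.eq_zero_or_pos n with rfl | hn
    · simp [g]
    · have h2 : n / 2 < n := Nat.div_lt_self hn one_lt_two
      have hb : Nat.bits n = n.bodd :: Nat.bits (n / 2) := by
        conv_lhs => rw [← Nat.bit_bodd_div2 n]
        rw [Nat.bits_append_bit _ _ ?_, Nat.div2_val]
        intro h
        by_contra hc
        have := Nat.bit_bodd_div2 n
        simp only [Bool.not_eq_true] at hc
        rw [h, hc] at this
        simp at this
        omega
      simp [g, hn.ne', h2, hb]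
  exact this.comp (Primrec.const ()) Primrec.id

/-- The number with a given list of binary digits, least significant digit first. -/
def ofBits (l : List Bool) : ℕ := l.foldr Nat.bit 0

theorem primrec_ofBits : Primrec ofBits := by
  refine Primrec.list_foldr (h := fun _ p => Nat.bit p.1 p.2) Primrec.id (Primrec.const 0)
    (Primrec₂.mk ?_)
  refine (Primrec.cond (Primrec.fst.comp Primrec.snd)
    (Primrec.nat_double_succ.comp (Primrec.snd.comp Primrec.snd))
    (Primrec.nat_double.comp (Primrec.snd.comp Primrec.snd))).of_eq fun p => ?_
  cases h : p.2.1 <;> simp [Nat.bit]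

@[simp] theorem ofBits_bits (n : ℕ) : ofBits n.bits = n := by
  induction n using Nat.binaryRec' with
  | zero => simp [ofBits]
  | bit b n h ih =>
    rw [Nat.bits_append_bit _ _ h]
    change Nat.bit b (ofBits n.bits) = _
    rw [ih]

theorem bits_injective : Function.Injective Nat.bits :=
  Function.LeftInverse.injective ofBits_bits

/-! ### Runs of a machine -/

namespace OracleCode

/-- With the finite oracle `σ`, the machine `c` maps the program `π` under the condition `b` to
the output `a`; conditions and outputs are numbers in binary. -/
def runs (c : OracleCode) (σ π : List Bool) (b a : ℕ) : Prop :=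
  ((evs c σ (Nat.pair (Encodable.encode π) (Encodable.encode b.bits))).bind
    (Encodable.decode (α := List Bool))) = some a.bits

theorem primrec_runs (c : OracleCode) :
    PrimrecRel fun (σ : List Bool) (p : List Bool × ℕ × ℕ) => c.runs σ p.1 p.2.1 p.2.2 := by
  refine Primrec.eq.comp (Primrec.option_bind ((primrec_evs c).comp Primrec.fst
    (Primrec₂.natPair.comp (Primrec.encode.comp (Primrec.fst.comp Primrec.snd)) ?_))
    (Primrec₂.mk (Primrec.decode.comp Primrec.snd))) ?_
  · exact Primrec.encode.comp (primrec_bits.comp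
      (Primrec.fst.comp (Primrec.snd.comp Primrec.snd)))
  · exact Primrec.option_some.comp (primrec_bits.comp
      (Primrec.snd.comp (Primrec.snd.comp Primrec.snd)))

theorem runs_mono (c : OracleCode) {σ τ π : List Bool} {b a : ℕ} (h : σ <+: τ)
    (hr : c.runs σ π b a) : c.runs τ π b a := by
  unfold runs at *
  rw [Option.bind_eq_some_iff] at *
  obtain ⟨n, hn, h'⟩ := hr
  exact ⟨n, evs_mono c h hn, h'⟩

theorem runs_unique (c : OracleCode) {σ π : List Bool} {b a a' : ℕ}
    (h : c.runs σ π b a) (h' : c.runs σ π b a') : a = a' :=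
  bits_injective (Option.some_injective _ (h.symm.trans h'))

theorem mem_run_iff (c : OracleCode) (B : Set ℕ) (π : List Bool) (b a : ℕ) :
    a.bits ∈ c.run B π b.bits ↔ ∃ k, c.runs (pre B k) π b a := by
  unfold run runs
  simp only [Part.mem_bind_iff, mem_eval_iff, Option.bind_eq_some_iff, Part.mem_coe, Option.mem_def]
  constructor
  · rintro ⟨n, ⟨k, hk⟩, h⟩
    exact ⟨k, n, hk, h⟩
  · rintro ⟨k, n, hk, h⟩
    exact ⟨n, ⟨k, hk⟩, h⟩

theorem ce_run (c : OracleCode) :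
    CE fun B (p : List Bool × ℕ × ℕ) => p.2.2.bits ∈ c.run B p.1 p.2.1.bits :=
  ⟨_, primrec_runs c, fun _ _ _ h => runs_mono c h, fun B p => mem_run_iff c B p.1 p.2.1 p.2.2⟩

/-- Every enumerable relation that is prefix-free and single-valued in the program is computed by
an oracle prefix machine. -/
theorem exists_machine {R : Set ℕ → List Bool × ℕ × ℕ → Prop} (hR : CE R)
    (hpf : ∀ B π π' b a a', R B (π, b, a) → R B (π', b, a') → π <+: π' → π = π' ∧ a = a') :
    ∃ c : OracleCode, c.IsPrefixMachine ∧
      ∀ B π b a, R B (π, b, a) → a.bits ∈ c.run B π b.bits := by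
  obtain ⟨F, h1, h2, h3⟩ := hR
  let Q : ℕ → List Bool × List Bool × ℕ → Prop := fun a p => F p.1 (p.2.1, p.2.2, a)
  have hQ' : PrimrecPred fun q : ℕ × List Bool × List Bool × ℕ => F q.2.1 (q.2.2.1, q.2.2.2, q.1) :=
    PrimrecRel.comp h1 (Primrec.fst.comp Primrec.snd)
      ((Primrec.fst.comp (Primrec.snd.comp Primrec.snd)).pair
        ((Primrec.snd.comp (Primrec.snd.comp Primrec.snd)).pair Primrec.fst))
  have hQ : PrimrecRel Q := hQ'
  classical
  -- On oracle part `σ` the outputs below `σ.length` are tried.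
  let J : List Bool → List Bool → ℕ → ℕ := fun σ π b =>
    (List.range σ.length).findIdx fun a => decide (Q a (σ, π, b))
  let H : List Bool → ℕ → Option ℕ := fun σ n =>
    let π := (Encodable.decode (α := List Bool) n.unpair.1).getD []
    let b := ofBits ((Encodable.decode (α := List Bool) n.unpair.2).getD [])
    if J σ π b < σ.length then some (Encodable.encode (J σ π b).bits) else none
  have hH : Primrec₂ H := by
    have hπ : Primrec fun p : List Bool × ℕ =>
        (Encodable.decode (α := List Bool) p.2.unpair.1).getD [] :=
      Primrec.option_getD.comp (Primrec.decode.comp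
        (Primrec.fst.comp (Primrec.unpair.comp Primrec.snd))) (Primrec.const _)
    have hb : Primrec fun p : List Bool × ℕ =>
        ofBits ((Encodable.decode (α := List Bool) p.2.unpair.2).getD []) :=
      primrec_ofBits.comp (Primrec.option_getD.comp (Primrec.decode.comp
        (Primrec.snd.comp (Primrec.unpair.comp Primrec.snd))) (Primrec.const _))
    have hlen : Primrec fun p : List Bool × ℕ => p.1.length :=
      Primrec.list_length.comp Primrec.fst
    have hJ : Primrec fun p : List Bool × ℕ =>
        J p.1 ((Encodable.decode (α := List Bool) p.2.unpair.1).getD [])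
          (ofBits ((Encodable.decode (α := List Bool) p.2.unpair.2).getD [])) := by
      refine Primrec.list_findIdx (Primrec.list_range.comp hlen) (Primrec₂.mk ?_)
      exact PrimrecPred.decide (PrimrecRel.comp hQ Primrec.snd ((Primrec.fst.comp Primrec.fst).pair
        ((hπ.comp Primrec.fst).pair (hb.comp Primrec.fst))))
    exact Primrec.ite (Primrec.nat_lt.comp hJ hlen)
      (Primrec.option_some.comp (Primrec.encode.comp (primrec_bits.comp hJ))) (Primrec.const none)
  obtain ⟨c, hc⟩ := exists_search_code hH
  have hHs : ∀ B k π τ m, H (pre B k) (Nat.pair (Encodable.encode π) (Encodable.encode τ)) = some m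
      → ∃ a, m = Encodable.encode a.bits ∧ R B (π, ofBits τ, a) := by
    intro B k π τ m h
    simp only [H, Nat.unpair_pair, Encodable.encodek, Option.getD_some] at h
    split_ifs at h with hlt
    refine ⟨_, (Option.some_injective _ h).symm, (h3 _ _).2 ⟨k, ?_⟩⟩
    have h1 := List.findIdx_getElem (xs := List.range (pre B k).length)
      (p := fun a => decide (Q a (pre B k, π, ofBits τ))) (w := by rwa [List.length_range])
    rw [List.getElem_range] at h1
    exact of_decide_eq_true h1
  refine ⟨c, ?_, ?_⟩
  · intro B τ π π' hd hd' hpre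
    have key : ∀ π, (c.run B π τ).Dom → ∃ a, R B (π, ofBits τ, a) := by
      intro π hd
      obtain ⟨l, hl⟩ := Part.dom_iff_mem.1 hd
      obtain ⟨m, hm, -⟩ := (Part.mem_bind_iff).1 hl
      obtain ⟨k, hk, -⟩ := (hc _ _ _).1 hm
      obtain ⟨a, -, ha⟩ := hHs B k π τ m hk
      exact ⟨a, ha⟩
    obtain ⟨a, ha⟩ := key π hd
    obtain ⟨a', ha'⟩ := key π' hd'
    exact (hpf B π π' _ a a' ha ha' hpre).1
  · intro B π b a hR
    obtain ⟨k, hk⟩ := (h3 _ _).1 hR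
    have hex : ∃ k, (H (pre B k) (Nat.pair (Encodable.encode π)
        (Encodable.encode b.bits))).isSome := by
      refine ⟨max k (a + 1), ?_⟩
      have hF : Q a (pre B (max k (a + 1)), π, b) := h2 _ _ _ (pre_prefix B (le_max_left _ _)) hk
      have : J (pre B (max k (a + 1))) π b < (pre B (max k (a + 1))).length := by
        have hlt : a < (pre B (max k (a + 1))).length := by simp
        refine lt_of_lt_of_eq (List.findIdx_lt_length.2 ⟨a, List.mem_range.2 hlt, ?_⟩)
          List.length_range
        exact decide_eq_true hF
      simp only [H, Nat.unpair_pair, Encodable.encodek, Option.getD_some, ofBits_bits, if_pos this]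
      rfl
    have hspec := Nat.find_spec hex
    obtain ⟨m, hm⟩ := Option.isSome_iff_exists.1 hspec
    obtain ⟨a', rfl, ha'⟩ := hHs B _ π b.bits m hm
    rw [ofBits_bits] at ha'
    obtain ⟨-, rfl⟩ := hpf B π π b a a' hR ha' List.prefix_rfl
    refine Part.mem_bind_iff.2 ⟨_, (hc _ _ _).2 ⟨_, hm, fun k' hk' => ?_⟩, ?_⟩
    · simpa using Nat.find_min hex hk'
    · simp

end OracleCode

/-! ### Self-delimiting codes -/

/-- A self-delimiting code for bit strings: every bit is preceded by `1`, the end is marked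
by `0`. -/
def delim : List Bool → List Bool
  | [] => [false]
  | b :: l => true :: b :: delim l

theorem length_delim (l : List Bool) : (delim l).length = 2 * l.length + 1 := by
  induction l with
  | nil => rfl
  | cons b l ih => simp [delim, ih]; omega

theorem delim_prefix : ∀ {l l' x y : List Bool}, delim l ++ x <+: delim l' ++ y → l = l' ∧ x <+: y
  | [], [], x, y, h => by simpa [delim] using h
  | [], b :: l', x, y, h => by simp [delim] at h
  | b :: l, [], x, y, h => by simp [delim] at h
  | b :: l, b' :: l', x, y, h => by
    simp only [delim, List.cons_append, List.cons_prefix_cons, true_and] at h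
    obtain ⟨rfl, h⟩ := h
    obtain ⟨rfl, h'⟩ := delim_prefix h
    exact ⟨rfl, h'⟩

theorem primrec_delim : Primrec delim := by
  have h : Primrec fun l : List Bool => l.foldr (fun b r => true :: b :: r) [false] :=
    Primrec.list_foldr (h := fun _ p => true :: p.1 :: p.2) Primrec.id (Primrec.const _)
      (Primrec₂.mk (Primrec.list_cons.comp (Primrec.const true) (Primrec.list_cons.comp
        (Primrec.fst.comp Primrec.snd) (Primrec.snd.comp Primrec.snd))))
  refine h.of_eq fun l => ?_
  induction l with
  | nil => rfl
  | cons b l ih => simp [delim, ih]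

section Header

variable {P : Type} [Primcodable P]

/-- The self-delimiting code of a parameter. -/
def header (p : P) : List Bool := delim (Encodable.encode p).bits

/-- The number of binary digits of the code of a parameter. -/
def psize (p : P) : ℕ := Nat.size (Encodable.encode p)

theorem length_header (p : P) : (header p).length = 2 * psize p + 1 := by
  rw [header, length_delim, psize, Nat.size_eq_bits_len]

theorem header_prefix {p p' : P} {x y : List Bool} (h : header p ++ x <+: header p' ++ y) :
    p = p' ∧ x <+: y := by
  obtain ⟨h1, h2⟩ := delim_prefix h
  exact ⟨Encodable.encode_injective (bits_injective h1), h2⟩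

theorem primrec_header : Primrec (header : P → List Bool) :=
  primrec_delim.comp (primrec_bits.comp Primrec.encode)

end Header

theorem psize_nat_le {n i : ℕ} (h : n < 2 ^ i) : psize n ≤ i := Nat.size_le.2 h

theorem psize_pair_le {P Q : Type} [Primcodable P] [Primcodable Q] {p : P} {q : Q} {i : ℕ}
    (hp : psize p ≤ i) (hq : psize q ≤ i) : psize (p, q) ≤ 2 * i := by
  unfold psize at *
  rw [Nat.size_le] at *
  calc Encodable.encode (p, q) < (max (Encodable.encode p) (Encodable.encode q) + 1) ^ 2 :=
        Nat.pair_lt_max_add_one_sq _ _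
    _ ≤ (2 ^ i) ^ 2 := Nat.pow_le_pow_left (max_lt hp hq) 2
    _ = 2 ^ (2 * i) := by rw [← pow_mul, mul_comm]

theorem ofBits_lt (l : List Bool) : ofBits l < 2 ^ l.length := by
  induction l with
  | nil => simp [ofBits]
  | cons b l ih =>
    change Nat.bit b (ofBits l) < _
    rw [List.length_cons, pow_succ]
    cases b <;> (simp [Nat.bit]; omega)

/-- Binary notation with leading zeros, in exactly `n` digits; the least significant digit is
first. -/
theorem exists_ofBits {n i : ℕ} (h : i < 2 ^ n) : ∃ v : List Bool, v.length = n ∧ ofBits v = i := by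
  have hz : ∀ k, ofBits (List.replicate k false) = 0 := by
    intro k
    induction k with
    | zero => rfl
    | succ k ih =>
      change Nat.bit false (ofBits (List.replicate k false)) = 0
      rw [ih]; rfl
  refine ⟨i.bits ++ List.replicate (n - i.size) false, ?_, ?_⟩
  · rw [List.length_append, List.length_replicate, Nat.size_eq_bits_len]
    exact Nat.add_sub_cancel' (Nat.size_le.2 h)
  · have : ∀ l k, ofBits (l ++ List.replicate k false) = ofBits l := by
      intro l k
      induction l with
      | nil => exact hz k
      | cons b l ih =>
        change Nat.bit b (ofBits (l ++ List.replicate k false)) = Nat.bit b (ofBits l)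
        rw [ih]
    rw [this, ofBits_bits]

/-- A final digit `1` makes leading zeros visible, so that bit strings are counted by numbers. -/
theorem ofBits_append_true_injective : Function.Injective fun l => ofBits (l ++ [true]) := by
  have hpos : ∀ l, 0 < ofBits (l ++ [true]) := by
    intro l
    induction l with
    | nil => simp [ofBits]
    | cons b l ih =>
      change 0 < Nat.bit b (ofBits (l ++ [true]))
      cases b <;> simp [Nat.bit]
      omega
  have hcons : ∀ b l, ofBits (b :: l ++ [true]) = Nat.bit b (ofBits (l ++ [true])) :=
    fun b l => rfl
  intro l
  induction l with
  | nil =>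
    intro l' h
    cases l' with
    | nil => rfl
    | cons b l' =>
      have := hpos l'
      simp only [hcons] at h
      have h1 : ofBits ([] ++ [true]) = 1 := rfl
      rw [h1] at h
      cases b <;> simp [Nat.bit] at h <;> omega
  | cons b l ih =>
    intro l' h
    cases l' with
    | nil =>
      have := hpos l
      simp only [hcons] at h
      have h1 : ofBits ([] ++ [true]) = 1 := rfl
      rw [h1] at h
      cases b <;> simp [Nat.bit] at h
      omega
    | cons b' l' =>
      simp only [hcons] at h
      have hb : b = b' := by simpa using congrArg Nat.bodd h
      have hl : ofBits (l ++ [true]) = ofBits (l' ++ [true]) := by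
        simpa using congrArg Nat.div2 h
      rw [hb, ih hl]

/-! ### Complexity of numbers -/

variable {U : OracleCode}

/-- The complexity of a number given a number, both in binary. For a universal machine the set is
nonempty by `exists_program`, so that this is `K` by `K_eq_kN`, and not the junk value `0`. -/
noncomputable def kN (U : OracleCode) (B : Set ℕ) (a b : ℕ) : ℕ :=
  sInf {n | ∃ π : List Bool, π.length = n ∧ a.bits ∈ U.run B π b.bits}

theorem kN_le {B : Set ℕ} {a b : ℕ} {π : List Bool} (h : a.bits ∈ U.run B π b.bits) :
    kN U B a b ≤ π.length := Nat.sInf_le ⟨π, rfl, h⟩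

/-- The form in which universality is used: a prefix-free, single-valued and enumerable way of
describing numbers bounds their complexity, up to a constant. -/
theorem exists_machine_bound (hU : U.IsUniversal) {R : Set ℕ → List Bool × ℕ × ℕ → Prop}
    (hR : CE R)
    (hpf : ∀ B π π' b a a', R B (π, b, a) → R B (π', b, a') → π <+: π' → π = π' ∧ a = a') :
    ∃ c : ℕ, ∀ B π b a, R B (π, b, a) → kN U B a b ≤ π.length + c := by
  obtain ⟨M, hM, hrun⟩ := OracleCode.exists_machine hR hpf
  obtain ⟨c, hc⟩ := hU.2 M hM
  refine ⟨c, fun B π b a h => ?_⟩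
  obtain ⟨π', hl, hπ⟩ := hc B π _ _ (hrun B π b a h)
  exact (kN_le hπ).trans hl

/-- Every number has a program with respect to a universal machine, since its self-delimiting code
is a description. -/
theorem exists_program (hU : U.IsUniversal) (B : Set ℕ) (a b : ℕ) :
    ∃ π : List Bool, π.length = kN U B a b ∧ a.bits ∈ U.run B π b.bits := by
  have hR : CE fun (_ : Set ℕ) (p : List Bool × ℕ × ℕ) => p.1 = header p.2.2 :=
    CE.of_primrecPred (Primrec.eq.comp Primrec.fst
      (primrec_header.comp (Primrec.snd.comp Primrec.snd)))
  have hpf : ∀ (_ : Set ℕ) (π π' : List Bool) (_ a a' : ℕ), π = header a → π' = header a' →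
      π <+: π' → π = π' ∧ a = a' := by
    rintro - π π' - a a' rfl rfl h
    obtain ⟨rfl, -⟩ := header_prefix (x := []) (y := []) (by simpa using h)
    exact ⟨rfl, rfl⟩
  obtain ⟨M, hM, hrun⟩ := OracleCode.exists_machine hR hpf
  obtain ⟨c, hc⟩ := hU.2 M hM
  obtain ⟨π', -, hπ⟩ := hc B _ _ _ (hrun B (header a) b a rfl)
  exact Nat.sInf_mem (s := {n | ∃ π : List Bool, π.length = n ∧ a.bits ∈ U.run B π b.bits})
    ⟨_, π', rfl, hπ⟩

theorem kN_le_iff (hU : U.IsUniversal) {B : Set ℕ} {a b n : ℕ} :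
    kN U B a b ≤ n ↔ ∃ π : List Bool, π.length ≤ n ∧ a.bits ∈ U.run B π b.bits := by
  constructor
  · intro h
    obtain ⟨π, hl, hπ⟩ := exists_program hU B a b
    exact ⟨π, hl.trans_le h, hπ⟩
  · rintro ⟨π, hl, hπ⟩
    exact (kN_le hπ).trans hl

theorem K_eq_kN (hU : U.IsUniversal) (B : Set ℕ) (a b : ℕ) :
    K U B a.bits b.bits = kN U B a b := by
  apply le_antisymm
  · obtain ⟨π, hl, hπ⟩ := exists_program hU B a b
    exact (iInf₂_le π hπ).trans (by rw [hl])
  · refine le_iInf₂ fun π hπ => ?_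
    exact_mod_cast kN_le hπ

theorem run_unique {c : OracleCode} {B : Set ℕ} {π : List Bool} {b a a' : ℕ}
    (h : a.bits ∈ c.run B π b.bits) (h' : a'.bits ∈ c.run B π b.bits) : a = a' :=
  bits_injective (Part.mem_unique h h')

theorem run_prefix_free (hU : U.IsUniversal) {B : Set ℕ} {π π' : List Bool} {b a a' : ℕ}
    (h : a.bits ∈ U.run B π b.bits) (h' : a'.bits ∈ U.run B π' b.bits) (hp : π <+: π') :
    π = π' :=
  hU.1 B _ π π' (Part.dom_iff_mem.2 ⟨_, h⟩) (Part.dom_iff_mem.2 ⟨_, h'⟩) hp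

theorem ce_kN_le (hU : U.IsUniversal) :
    CE fun B (p : ℕ × ℕ × ℕ) => kN U B p.2.2 p.2.1 ≤ p.1 := by
  have h1 : CE fun B (q : (ℕ × ℕ × ℕ) × List Bool) => q.2.length ≤ q.1.1 ∧
      q.1.2.2.bits ∈ U.run B q.2 q.1.2.1.bits := by
    refine CE.and (CE.of_primrecPred (Primrec.nat_le.comp (Primrec.list_length.comp Primrec.snd)
      (Primrec.fst.comp Primrec.fst))) ?_
    exact (U.ce_run).comp (f := fun q : (ℕ × ℕ × ℕ) × List Bool => (q.2, q.1.2.1, q.1.2.2))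
      (Primrec.snd.pair (Primrec.snd.comp Primrec.fst))
  exact h1.exists.of_eq fun B p =>
    (kN_le_iff hU (B := B) (a := p.2.2) (b := p.2.1) (n := p.1)).symm

/-- There are at most `2 ^ (n + 1)` numbers of complexity at most `n`. -/
theorem encard_kN_le (hU : U.IsUniversal) (B : Set ℕ) (b n : ℕ) :
    {a | kN U B a b ≤ n}.encard ≤ 2 ^ (n + 1) := by
  choose f hf using fun a => exists_program hU B a b
  have hinj : Set.InjOn (fun a => ofBits (f a ++ [true])) {a | kN U B a b ≤ n} := by
    intro a _ a' _ h
    have := ofBits_append_true_injective h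
    exact run_unique (hf a).2 (this ▸ (hf a').2)
  rw [← hinj.encard_image]
  have hsub : (fun a => ofBits (f a ++ [true])) '' {a | kN U B a b ≤ n} ⊆
      (Finset.range (2 ^ (n + 1)) : Set ℕ) := by
    rintro _ ⟨a, ha, rfl⟩
    have ha : kN U B a b ≤ n := ha
    simp only [Finset.coe_range, Set.mem_Iio]
    refine (ofBits_lt _).trans_le (Nat.pow_le_pow_right two_pos ?_)
    rw [List.length_append, (hf a).1]
    simpa using ha
  refine (Set.encard_le_encard hsub).trans ?_
  rw [Set.encard_coe_eq_coe_finsetCard, Finset.card_range]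
  push_cast
  exact le_rfl

/-- Outputs may be changed by a primitive recursive function and conditions by an enumerable
one; both may depend on a parameter `p` and the oracle may be replaced by a part of it. -/
theorem exists_transform_bound (hU : U.IsUniversal) {P : Type} [Primcodable P]
    {L : Set ℕ → Set ℕ}
    (hL : ∀ R : Set ℕ → List Bool × ℕ × ℕ → Prop, CE R → CE fun B => R (L B))
    {f : P × ℕ × ℕ → ℕ} (hf : Primrec f) {T : Set ℕ → P × ℕ × ℕ → Prop} (hT : CE T)
    (hTu : ∀ B p b b₁ b₂, T B (p, b, b₁) → T B (p, b, b₂) → b₁ = b₂) :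
    ∃ c : ℕ, ∀ B p a b b', T B (p, b, b') →
      kN U B (f (p, a, b)) b ≤ kN U (L B) a b' + 2 * psize p + c := by
  -- The program is the header of the parameter, followed by a program for `U`.
  let S : Set ℕ → (List Bool × ℕ × ℕ) × (P × List Bool × ℕ × ℕ) → Prop := fun B q =>
    (q.1.1 = header q.2.1 ++ q.2.2.1 ∧ q.1.2.2 = f (q.2.1, q.2.2.2.2, q.1.2.1)) ∧
      T B (q.2.1, q.1.2.1, q.2.2.2.1) ∧ q.2.2.2.2.bits ∈ U.run (L B) q.2.2.1 q.2.2.2.1.bits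
  have hS : CE S := by
    have x1 : Primrec fun q : (List Bool × ℕ × ℕ) × (P × List Bool × ℕ × ℕ) => q.2.1 :=
      Primrec.fst.comp Primrec.snd
    have x2 : Primrec fun q : (List Bool × ℕ × ℕ) × (P × List Bool × ℕ × ℕ) => q.2.2.1 :=
      Primrec.fst.comp (Primrec.snd.comp Primrec.snd)
    have x3 : Primrec fun q : (List Bool × ℕ × ℕ) × (P × List Bool × ℕ × ℕ) => q.2.2.2 :=
      Primrec.snd.comp (Primrec.snd.comp Primrec.snd)
    have y2 : Primrec fun q : (List Bool × ℕ × ℕ) × (P × List Bool × ℕ × ℕ) => q.1.2 :=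
      Primrec.snd.comp Primrec.fst
    refine CE.and (CE.of_primrecPred (PrimrecPred.and ?_ ?_)) (CE.and ?_ ?_)
    · exact Primrec.eq.comp (Primrec.fst.comp Primrec.fst)
        (Primrec.list_append.comp (primrec_header.comp x1) x2)
    · exact Primrec.eq.comp (Primrec.snd.comp y2)
        (hf.comp (x1.pair ((Primrec.snd.comp x3).pair (Primrec.fst.comp y2))))
    · exact hT.comp (f := fun q : (List Bool × ℕ × ℕ) × (P × List Bool × ℕ × ℕ) =>
        (q.2.1, q.1.2.1, q.2.2.2.1))
        (x1.pair ((Primrec.fst.comp y2).pair (Primrec.fst.comp x3)))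
    · exact (hL _ U.ce_run).comp (f := fun q : (List Bool × ℕ × ℕ) × (P × List Bool × ℕ × ℕ) =>
        (q.2.2.1, q.2.2.2)) (x2.pair x3)
  obtain ⟨c, hc⟩ := exists_machine_bound hU hS.exists (by
    rintro B π π' b w w' ⟨⟨p, ρ, b', a⟩, ⟨h1, h2⟩, h3, h4⟩
      ⟨⟨p', ρ', b'', a'⟩, ⟨g1, g2⟩, g3, g4⟩ hpre
    dsimp only at *
    subst h1 g1 h2 g2
    obtain ⟨rfl, hρ⟩ := header_prefix hpre
    obtain rfl := hTu _ _ _ _ _ h3 g3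
    obtain rfl := run_prefix_free hU h4 g4 hρ
    obtain rfl := run_unique h4 g4
    exact ⟨rfl, rfl⟩)
  refine ⟨c + 1, fun B p a b b' hb' => ?_⟩
  obtain ⟨π, hl, hπ⟩ := exists_program hU (L B) a b'
  have := hc B (header p ++ π) b (f (p, a, b)) ⟨(p, π, b', a), ⟨rfl, rfl⟩, hb', hπ⟩
  rw [List.length_append, length_header, hl] at this
  omega

/-- The easy half of the chain rule: a program for `a` given `b`, followed by a program for `w`
given `a`, is a description of both numbers. -/
theorem exists_chain_upper (hU : U.IsUniversal) {f : ℕ → ℕ → ℕ} (hf : Primrec₂ f) :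
    ∃ c : ℕ, ∀ B a w b, kN U B (f a w) b ≤ kN U B a b + kN U B w a + c := by
  let S : Set ℕ → (List Bool × ℕ × ℕ) × (List Bool × List Bool × ℕ × ℕ) → Prop := fun B q =>
    (q.1.1 = q.2.1 ++ q.2.2.1 ∧ q.1.2.2 = f q.2.2.2.1 q.2.2.2.2) ∧
      q.2.2.2.1.bits ∈ U.run B q.2.1 q.1.2.1.bits ∧
      q.2.2.2.2.bits ∈ U.run B q.2.2.1 q.2.2.2.1.bits
  have hS : CE S := by
    have x1 : Primrec fun q : (List Bool × ℕ × ℕ) × (List Bool × List Bool × ℕ × ℕ) => q.2.1 :=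
      Primrec.fst.comp Primrec.snd
    have x2 : Primrec fun q : (List Bool × ℕ × ℕ) × (List Bool × List Bool × ℕ × ℕ) => q.2.2.1 :=
      Primrec.fst.comp (Primrec.snd.comp Primrec.snd)
    have x3 : Primrec fun q : (List Bool × ℕ × ℕ) × (List Bool × List Bool × ℕ × ℕ) => q.2.2.2 :=
      Primrec.snd.comp (Primrec.snd.comp Primrec.snd)
    have y2 : Primrec fun q : (List Bool × ℕ × ℕ) × (List Bool × List Bool × ℕ × ℕ) => q.1.2 :=
      Primrec.snd.comp Primrec.fst
    refine CE.and (CE.of_primrecPred (PrimrecPred.and ?_ ?_)) (CE.and ?_ ?_)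
    · exact Primrec.eq.comp (Primrec.fst.comp Primrec.fst) (Primrec.list_append.comp x1 x2)
    · exact Primrec.eq.comp (Primrec.snd.comp y2)
        (hf.comp (Primrec.fst.comp x3) (Primrec.snd.comp x3))
    · exact (U.ce_run).comp
        (f := fun q : (List Bool × ℕ × ℕ) × (List Bool × List Bool × ℕ × ℕ) =>
          (q.2.1, q.1.2.1, q.2.2.2.1))
        (x1.pair ((Primrec.fst.comp y2).pair (Primrec.fst.comp x3)))
    · exact (U.ce_run).comp
        (f := fun q : (List Bool × ℕ × ℕ) × (List Bool × List Bool × ℕ × ℕ) =>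
          (q.2.2.1, q.2.2.2)) (x2.pair x3)
  obtain ⟨c, hc⟩ := exists_machine_bound hU hS.exists (by
    rintro B π π' b w w' ⟨⟨ρ₁, ρ₂, a, v⟩, ⟨h1, h2⟩, h3, h4⟩
      ⟨⟨ρ₁', ρ₂', a', v'⟩, ⟨g1, g2⟩, g3, g4⟩ hpre
    dsimp only at *
    subst h1 g1 h2 g2
    have : ρ₁ = ρ₁' := by
      rcases List.prefix_or_prefix_of_prefix ((List.prefix_append ρ₁ ρ₂).trans hpre)
        (List.prefix_append ρ₁' ρ₂') with h | h
      · exact run_prefix_free hU h3 g3 h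
      · exact (run_prefix_free hU g3 h3 h).symm
    subst this
    obtain rfl := run_unique h3 g3
    obtain rfl := run_prefix_free hU h4 g4 ((List.prefix_append_right_inj _).1 hpre)
    obtain rfl := run_unique h4 g4
    exact ⟨rfl, rfl⟩)
  refine ⟨c, fun B a w b => ?_⟩
  obtain ⟨π, hl, hπ⟩ := exists_program hU B a b
  obtain ⟨ρ, hl', hρ⟩ := exists_program hU B w a
  have := hc B (π ++ ρ) b (f a w) ⟨(π, ρ, a, w), ⟨rfl, rfl⟩, hπ, hρ⟩
  rw [List.length_append, hl, hl'] at this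
  exact this

/-! ### Counting -/

section Counting

variable {α : Type} [Primcodable α]

/-- The elements which an enumerable relation yields in `k` steps, in the order of their
appearance. -/
theorem CE.exists_enumeration {R : Set ℕ → α × ℕ → Prop} (hR : CE R) :
    ∃ E : Set ℕ → α → ℕ → List ℕ,
      (∀ B x k l, k ≤ l → E B x k <+: E B x l) ∧ (∀ B x k, (E B x k).Nodup) ∧
      (∀ B x a, R B (x, a) ↔ ∃ k, a ∈ E B x k) ∧
      CE fun B (q : α × ℕ × ℕ) => ∃ k, (E B q.1 k)[q.2.1]? = some q.2.2 := by
  classical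
  obtain ⟨F, h1, h2, h3⟩ := hR
  let step : List Bool → α → ℕ → List ℕ → List ℕ := fun σ x k l =>
    l ++ (List.range k).filter fun a => decide (F σ (x, a) ∧ a ∉ l)
  let E : Set ℕ → α → ℕ → List ℕ := fun B x k =>
    Nat.rec [] (fun k l => step (pre B k) x k l) k
  have hE : ∀ B x k, E B x (k + 1) = step (pre B k) x k (E B x k) := fun _ _ _ => rfl
  have hmono : ∀ B x k l, k ≤ l → E B x k <+: E B x l := by
    intro B x k l hkl
    induction hkl with
    | refl => exact List.prefix_rfl
    | step h ih => exact ih.trans (by rw [hE]; exact List.prefix_append _ _)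
  have hmem : ∀ B x k a, a ∈ E B x k → R B (x, a) := by
    intro B x k a
    induction k with
    | zero => simp [E]
    | succ k ih =>
      rw [hE]
      simp only [step, List.mem_append, List.mem_filter, decide_eq_true_eq]
      rintro (h | ⟨-, h, -⟩)
      · exact ih h
      · exact (h3 _ _).2 ⟨k, h⟩
  refine ⟨E, hmono, ?_, ?_, ?_⟩
  · intro B x k
    induction k with
    | zero => simp [E]
    | succ k ih =>
      rw [hE]
      refine List.Nodup.append ih (List.nodup_range.filter _) ?_
      intro a ha ha'
      simp only [List.mem_filter, decide_eq_true_eq] at ha'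
      exact ha'.2.2 ha
  · intro B x a
    constructor
    · intro h
      obtain ⟨k, hk⟩ := (h3 _ _).1 h
      refine ⟨max k (a + 1) + 1, ?_⟩
      rw [hE]
      simp only [step, List.mem_append, List.mem_filter, decide_eq_true_eq, List.mem_range]
      rcases Classical.em (a ∈ E B x (max k (a + 1))) with ha | ha
      · exact Or.inl ha
      · exact Or.inr ⟨lt_of_lt_of_le (Nat.lt_succ_self a) (le_max_right _ _),
          h2 _ _ _ (pre_prefix B (le_max_left _ _)) hk, ha⟩
    · rintro ⟨k, hk⟩
      exact hmem B x k a hk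
  · let D : List Bool → α → List ℕ := fun σ x =>
      Nat.rec [] (fun k l => step (σ.take k) x k l) σ.length
    have hD : ∀ B x k, D (pre B k) x = E B x k := by
      intro B x k
      have : ∀ m ≤ k, (Nat.rec [] (fun j l => step ((pre B k).take j) x j l) m : List ℕ) =
          E B x m := by
        intro m hm
        induction m with
        | zero => rfl
        | succ m ih =>
          rw [hE, ← ih (by omega), ← take_pre B (show m ≤ k by omega)]
      simpa [D] using this k le_rfl
    have hDp : Primrec₂ D := by
      refine Primrec.nat_rec' (f := fun p : List Bool × α => p.1.length) (g := fun _ => [])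
        (h := fun p q => step (p.1.take q.1) p.2 q.1 q.2)
        (Primrec.list_length.comp Primrec.fst) (Primrec.const _) (Primrec₂.mk ?_)
      have hr : PrimrecRel fun (a : ℕ) (q : (List Bool × α) × ℕ × List ℕ) =>
          F (q.1.1.take q.2.1) (q.1.2, a) ∧ a ∉ q.2.2 := by
        refine PrimrecPred.and (PrimrecRel.comp h1 ?_ ?_) (PrimrecPred.not ?_)
        · exact Primrec.list_take.comp (Primrec.fst.comp (Primrec.snd.comp Primrec.snd))
            (Primrec.fst.comp (Primrec.fst.comp Primrec.snd))
        · exact (Primrec.snd.comp (Primrec.fst.comp Primrec.snd)).pair Primrec.fst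
        · have hm := PrimrecRel.exists_mem_list (R := fun a b : ℕ => a = b) Primrec.eq
          refine (PrimrecRel.comp hm (Primrec.snd.comp (Primrec.snd.comp Primrec.snd))
            Primrec.fst).of_eq fun q => ?_
          simp
      exact Primrec.list_append.comp (Primrec.snd.comp Primrec.snd)
        (hr.listFilter.comp (Primrec.list_range.comp (Primrec.fst.comp Primrec.snd)) Primrec.id)
    refine CE.of_test (F := fun σ (q : α × ℕ × ℕ) => (D σ q.1)[q.2.1]? = some q.2.2) ?_
      fun B q => by simp only [hD]
    exact Primrec.eq.comp (Primrec.list_getElem?.comp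
      (hDp.comp Primrec.fst (Primrec.fst.comp Primrec.snd))
        (Primrec.fst.comp (Primrec.snd.comp Primrec.snd)))
      (Primrec.option_some.comp (Primrec.snd.comp (Primrec.snd.comp Primrec.snd)))

/-- An element of an enumerable set with at most `2 ^ n` elements is described by `n` bits, apart
from the parameters of the enumeration. -/
theorem exists_count_bound (hU : U.IsUniversal) {R : Set ℕ → (α × ℕ) × ℕ → Prop} (hR : CE R) :
    ∃ c : ℕ, ∀ B p b a n, R B ((p, b), a) → {a' | R B ((p, b), a')}.encard ≤ 2 ^ n →
      kN U B a b ≤ n + 2 * psize (p, n) + c := by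
  obtain ⟨E, hmono, hnd, hmem, hE⟩ := hR.exists_enumeration
  let S : Set ℕ → (List Bool × ℕ × ℕ) × ((α × ℕ) × List Bool) → Prop := fun B q =>
    (q.1.1 = header q.2.1 ++ q.2.2 ∧ q.2.2.length = q.2.1.2) ∧
      ∃ k, (E B (q.2.1.1, q.1.2.1) k)[ofBits q.2.2]? = some q.1.2.2
  have hS : CE S := by
    have x1 : Primrec fun q : (List Bool × ℕ × ℕ) × ((α × ℕ) × List Bool) => q.2.1 :=
      Primrec.fst.comp Primrec.snd
    have x2 : Primrec fun q : (List Bool × ℕ × ℕ) × ((α × ℕ) × List Bool) => q.2.2 :=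
      Primrec.snd.comp Primrec.snd
    have y2 : Primrec fun q : (List Bool × ℕ × ℕ) × ((α × ℕ) × List Bool) => q.1.2 :=
      Primrec.snd.comp Primrec.fst
    refine CE.and (CE.of_primrecPred (PrimrecPred.and ?_ ?_)) ?_
    · exact Primrec.eq.comp (Primrec.fst.comp Primrec.fst)
        (Primrec.list_append.comp (primrec_header.comp x1) x2)
    · exact Primrec.eq.comp (Primrec.list_length.comp x2) (Primrec.snd.comp x1)
    · exact hE.comp (f := fun q : (List Bool × ℕ × ℕ) × ((α × ℕ) × List Bool) =>
        ((q.2.1.1, q.1.2.1), ofBits q.2.2, q.1.2.2))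
        (((Primrec.fst.comp x1).pair (Primrec.fst.comp y2)).pair
          ((primrec_ofBits.comp x2).pair (Primrec.snd.comp y2)))
  obtain ⟨c, hc⟩ := exists_machine_bound hU hS.exists (by
    rintro B π π' b a a' ⟨⟨⟨p, n⟩, v⟩, ⟨h1, h2⟩, k, h3⟩ ⟨⟨⟨p', n'⟩, v'⟩, ⟨g1, g2⟩, l, g3⟩ hpre
    dsimp only at *
    subst h1 g1
    obtain ⟨hp, hv⟩ := header_prefix hpre
    obtain ⟨rfl, rfl⟩ := Prod.mk.inj hp
    obtain rfl := hv.eq_of_length (h2.trans g2.symm)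
    refine ⟨rfl, ?_⟩
    have i1 := getElem?_of_prefix (hmono B (p, b) _ _ (le_max_left k l)) h3
    have i2 := getElem?_of_prefix (hmono B (p, b) _ _ (le_max_right k l)) g3
    exact Option.some_injective _ (i1.symm.trans i2))
  refine ⟨c + 1, fun B p b a n ha hcard => ?_⟩
  obtain ⟨k, hk⟩ := (hmem B (p, b) a).1 ha
  obtain ⟨i, hi, hia⟩ := List.mem_iff_getElem.1 hk
  have hlen : (E B (p, b) k).length ≤ 2 ^ n := by
    classical
    have h1 : ((E B (p, b) k).toFinset : Set ℕ) ⊆ {a' | R B ((p, b), a')} := fun a' ha' =>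
      (hmem _ _ _).2 ⟨k, by simpa using ha'⟩
    have h2 := (Set.encard_le_encard h1).trans hcard
    rw [Set.encard_coe_eq_coe_finsetCard, List.toFinset_card_of_nodup (hnd _ _ _)] at h2
    exact_mod_cast h2
  obtain ⟨v, hv, rfl⟩ := exists_ofBits (hi.trans_le hlen)
  have := hc B (header (p, n) ++ v) b a ⟨((p, n), v), ⟨rfl, hv⟩, k, by
    rw [List.getElem?_eq_getElem hi, hia]⟩
  rw [List.length_append, length_header, hv] at this
  omega

end Counting

theorem exists_finset_of_le_encard {β : Type*} {s : Set β} {n : ℕ} (h : (n : ℕ∞) ≤ s.encard) :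
    ∃ t : Finset β, ↑t ⊆ s ∧ t.card = n := by
  obtain ⟨t, ht, hc⟩ := Set.exists_subset_encard_eq h
  have hfin : t.Finite := Set.finite_of_encard_eq_coe hc
  refine ⟨hfin.toFinset, by simpa using ht, ?_⟩
  rw [hfin.encard_eq_coe_toFinset_card] at hc
  exact_mod_cast hc

/-- If many `a` have many `b` such that the pair `(a, b)` is simple, then many pairs are. -/
theorem card_mul_le_of_kN_pair (hU : U.IsUniversal) (B : Set ℕ) {m M : ℕ} {s : Finset ℕ}
    (hs : ∀ a ∈ s, (M : ℕ∞) ≤ {b | kN U B (Nat.pair a b) 0 ≤ m}.encard) :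
    s.card * M ≤ 2 ^ (m + 1) := by
  have h1 : ∀ a, ∃ t : Finset ℕ, a ∈ s →
      ↑t ⊆ {b | kN U B (Nat.pair a b) 0 ≤ m} ∧ t.card = M := by
    intro a
    by_cases ha : a ∈ s
    · obtain ⟨t, ht⟩ := exists_finset_of_le_encard (hs a ha)
      exact ⟨t, fun _ => ht⟩
    · exact ⟨∅, fun h => absurd h ha⟩
  choose t ht using h1
  have h2 : (((s.sigma t).image fun x => Nat.pair x.1 x.2 : Finset ℕ) : Set ℕ) ⊆
      {a | kN U B a 0 ≤ m} := by
    intro w hw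
    simp only [Finset.coe_image, Set.mem_image, Finset.mem_coe, Finset.mem_sigma] at hw
    obtain ⟨⟨a, b⟩, ⟨ha, hb⟩, rfl⟩ := hw
    exact (ht a ha).1 hb
  have hinj : Function.Injective fun x : (_ : ℕ) × ℕ => Nat.pair x.1 x.2 := by
    rintro ⟨a, b⟩ ⟨a', b'⟩ h
    obtain ⟨rfl, rfl⟩ := Nat.pair_eq_pair.1 h
    rfl
  have h3 := (Set.encard_le_encard h2).trans (encard_kN_le hU B 0 m)
  rw [Set.encard_coe_eq_coe_finsetCard, Finset.card_image_of_injective _ hinj, Finset.card_sigma,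
    Finset.sum_congr rfl fun a ha => (ht a ha).2, Finset.sum_const, smul_eq_mul] at h3
  exact_mod_cast h3

theorem primrec_two_pow : Primrec fun n : ℕ => 2 ^ n :=
  (Primrec₂.unpaired'.1 Nat.Primrec.pow).comp (Primrec.const 2) Primrec.id

/-- The hard half of the chain rule, with a logarithmic error. -/
theorem exists_chain_lower (hU : U.IsUniversal) :
    ∃ c : ℕ, ∀ B a b i, kN U B (Nat.pair a b) 0 < 2 ^ i →
      kN U B a 0 + kN U B b a ≤ kN U B (Nat.pair a b) 0 + 12 * i + c := by
  -- `b` is among the numbers `b'` for which the pair `(a, b')` is simple; this set depends on `a`.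
  have hR : CE fun B (q : (ℕ × ℕ) × ℕ) => kN U B (Nat.pair q.1.2 q.2) 0 ≤ q.1.1 :=
    (ce_kN_le hU).comp (f := fun q : (ℕ × ℕ) × ℕ => (q.1.1, 0, Nat.pair q.1.2 q.2))
      ((Primrec.fst.comp Primrec.fst).pair ((Primrec.const 0).pair
        (Primrec₂.natPair.comp (Primrec.snd.comp Primrec.fst) Primrec.snd)))
  -- `a` is among the numbers for which there are many such `b'`.
  have hQ : CE fun B (q : ((ℕ × ℕ) × ℕ) × ℕ) =>
      ((2 ^ q.1.1.2 : ℕ) : ℕ∞) ≤ {b | kN U B (Nat.pair q.2 b) 0 ≤ q.1.1.1}.encard := by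
    have h1 : CE fun B (q : (((ℕ × ℕ) × ℕ) × ℕ) × ℕ) =>
        kN U B (Nat.pair q.1.2 q.2) 0 ≤ q.1.1.1.1 :=
      hR.comp (f := fun q : (((ℕ × ℕ) × ℕ) × ℕ) × ℕ => ((q.1.1.1.1, q.1.2), q.2))
        (((Primrec.fst.comp (Primrec.fst.comp (Primrec.fst.comp Primrec.fst))).pair
          (Primrec.snd.comp Primrec.fst)).pair Primrec.snd)
    exact h1.le_encard (th := fun q : ((ℕ × ℕ) × ℕ) × ℕ => 2 ^ q.1.1.2)
      (primrec_two_pow.comp (Primrec.snd.comp (Primrec.fst.comp Primrec.fst)))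
  obtain ⟨c₁, hc₁⟩ := exists_count_bound hU hR
  obtain ⟨c₂, hc₂⟩ := exists_count_bound hU hQ
  refine ⟨c₁ + c₂ + 26, fun B a b i hi => ?_⟩
  generalize hm : kN U B (Nat.pair a b) 0 = m at hi ⊢
  set X : Set ℕ := {b | kN U B (Nat.pair a b) 0 ≤ m} with hX
  have hXle : X.encard ≤ (2 ^ (m + 1) : ℕ) := by
    by_contra hlt
    have h1 : ((2 ^ (m + 1) + 1 : ℕ) : ℕ∞) ≤ X.encard := by
      rw [not_le] at hlt
      exact_mod_cast Order.add_one_le_of_lt hlt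
    have h2 := card_mul_le_of_kN_pair hU B (s := {a}) (m := m)
      (fun a' ha' => by rwa [Finset.mem_singleton.1 ha'])
    simp at h2
  have hfin : X.Finite := Set.finite_of_encard_le_coe hXle
  have hcard : X.encard = (X.ncard : ℕ∞) := hfin.cast_ncard_eq.symm
  have hbX : b ∈ X := hm.le
  have hpos : X.ncard ≠ 0 := ((Set.ncard_pos hfin).2 ⟨b, hbX⟩).ne'
  obtain ⟨l, hl1, hl2⟩ : ∃ l, 2 ^ l ≤ X.ncard ∧ X.ncard < 2 ^ (l + 1) :=
    ⟨Nat.log 2 X.ncard, Nat.pow_log_le_self 2 hpos, Nat.lt_pow_succ_log_self one_lt_two _⟩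
  have hlm : l ≤ m + 1 := by
    rw [hcard] at hXle
    exact (Nat.pow_le_pow_iff_right one_lt_two).1 (hl1.trans (by exact_mod_cast hXle))
  have e1 : kN U B b a ≤ (l + 1) + 2 * psize (m, l + 1) + c₁ := by
    refine hc₁ B m a b (l + 1) hbX ?_
    change X.encard ≤ _
    rw [hcard]
    exact_mod_cast hl2.le
  have e2 : kN U B a 0 ≤ (m + 1 - l) + 2 * psize ((m, l), m + 1 - l) + c₂ := by
    refine hc₂ B (m, l) 0 a (m + 1 - l) ?_ ?_
    · change ((2 ^ l : ℕ) : ℕ∞) ≤ X.encard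
      rw [hcard]
      exact_mod_cast hl1
    · by_contra hlt
      rw [not_le] at hlt
      have h1 := Order.add_one_le_of_lt hlt
      obtain ⟨s, hs, hsc⟩ := exists_finset_of_le_encard (n := 2 ^ (m + 1 - l) + 1)
        (by exact_mod_cast h1)
      have h2 := card_mul_le_of_kN_pair hU B (s := s) (m := m) (M := 2 ^ l) fun a' ha' => hs ha'
      rw [hsc, add_mul, ← pow_add, Nat.sub_add_cancel hlm] at h2
      have := Nat.one_le_two_pow (n := l)
      omega
  have hi2 : 2 ^ (i + 2) = 2 ^ i * 4 := by rw [pow_add]; norm_num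
  have p0 : psize m ≤ i + 2 := psize_nat_le (by omega)
  have p1 : psize (m, l + 1) ≤ 2 * (i + 2) := psize_pair_le p0 (psize_nat_le (by omega))
  have p2 : psize (m, l) ≤ 2 * (i + 2) := psize_pair_le p0 (psize_nat_le (by omega))
  have p3 : psize ((m, l), m + 1 - l) ≤ 2 * (2 * (i + 2)) :=
    psize_pair_le p2 (psize_nat_le (lt_of_lt_of_le (b := 2 ^ (i + 2)) (by omega)
      (Nat.pow_le_pow_right two_pos (by omega))))
  omega

/-! ### Computations with integers and rational numbers -/

section PrimInt

variable {α β : Type*} [Primcodable α] [Primcodable β]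

/-- A primitive recursive integer-valued function, given as a difference of natural numbers. -/
def PrimInt (f : α → ℤ) : Prop :=
  ∃ g h : α → ℕ, Primrec g ∧ Primrec h ∧ ∀ a, f a = (g a : ℤ) - h a

theorem PrimInt.of_primrec {f : α → ℕ} (hf : Primrec f) : PrimInt fun a => (f a : ℤ) :=
  ⟨f, fun _ => 0, hf, Primrec.const 0, fun _ => by simp⟩

theorem PrimInt.comp {f : β → ℤ} (hf : PrimInt f) {g : α → β} (hg : Primrec g) :
    PrimInt fun a => f (g a) := by
  obtain ⟨x, y, hx, hy, h⟩ := hf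
  exact ⟨_, _, hx.comp hg, hy.comp hg, fun a => h _⟩

theorem PrimInt.add {f g : α → ℤ} (hf : PrimInt f) (hg : PrimInt g) :
    PrimInt fun a => f a + g a := by
  obtain ⟨x, y, hx, hy, h⟩ := hf
  obtain ⟨x', y', hx', hy', h'⟩ := hg
  refine ⟨_, _, Primrec.nat_add.comp hx hx', Primrec.nat_add.comp hy hy', fun a => ?_⟩
  simp only [h, h']; push_cast; ring

theorem PrimInt.sub {f g : α → ℤ} (hf : PrimInt f) (hg : PrimInt g) :
    PrimInt fun a => f a - g a := by
  obtain ⟨x, y, hx, hy, h⟩ := hf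
  obtain ⟨x', y', hx', hy', h'⟩ := hg
  refine ⟨_, _, Primrec.nat_add.comp hx hy', Primrec.nat_add.comp hy hx', fun a => ?_⟩
  simp only [h, h']; push_cast; ring

theorem PrimInt.mul {f g : α → ℤ} (hf : PrimInt f) (hg : PrimInt g) :
    PrimInt fun a => f a * g a := by
  obtain ⟨x, y, hx, hy, h⟩ := hf
  obtain ⟨x', y', hx', hy', h'⟩ := hg
  refine ⟨_, _, Primrec.nat_add.comp (Primrec.nat_mul.comp hx hx') (Primrec.nat_mul.comp hy hy'),
    Primrec.nat_add.comp (Primrec.nat_mul.comp hx hy') (Primrec.nat_mul.comp hy hx'), fun a => ?_⟩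
  simp only [h, h']; push_cast; ring

theorem PrimInt.natAbs {f : α → ℤ} (hf : PrimInt f) : Primrec fun a => (f a).natAbs := by
  obtain ⟨x, y, hx, hy, h⟩ := hf
  refine (Primrec.nat_add.comp (Primrec.nat_sub.comp hx hy) (Primrec.nat_sub.comp hy hx)).of_eq
    fun a => ?_
  have := h a
  omega

theorem PrimInt.toNat {f : α → ℤ} (hf : PrimInt f) : Primrec fun a => (f a).toNat := by
  obtain ⟨x, y, hx, hy, h⟩ := hf
  refine (Primrec.nat_sub.comp hx hy).of_eq fun a => ?_
  have := h a
  omega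

theorem PrimInt.ediv_of_dvd {f : α → ℤ} (hf : PrimInt f) {d : α → ℕ} (hd : Primrec d)
    (hdvd : ∀ a, (d a : ℤ) ∣ f a) : PrimInt fun a => f a / d a := by
  obtain ⟨x, y, hx, hy, h⟩ := hf
  refine ⟨_, _, Primrec.nat_div.comp (Primrec.nat_sub.comp hx hy) hd,
    Primrec.nat_div.comp (Primrec.nat_sub.comp hy hx) hd, fun a => ?_⟩
  rcases le_total (y a) (x a) with hle | hle
  · have h1 : f a = ((x a - y a : ℕ) : ℤ) := by rw [h]; omega
    simp [h1, Nat.sub_eq_zero_of_le hle]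
  · have h1 : f a = -((y a - x a : ℕ) : ℤ) := by rw [h]; omega
    have h2 : (d a : ℤ) ∣ ((y a - x a : ℕ) : ℤ) := by
      have := hdvd a
      rwa [h1, dvd_neg] at this
    simp only [h1, Int.neg_ediv_of_dvd h2, Nat.sub_eq_zero_of_le hle]
    simp

theorem encode_int_natCast (n : ℕ) : Encodable.encode (n : ℤ) = 2 * n := rfl

theorem encode_int_negSucc (n : ℕ) : Encodable.encode (Int.negSucc n) = 2 * n + 1 := rfl

theorem PrimInt.encode {f : α → ℤ} (hf : PrimInt f) :
    Primrec fun a => Encodable.encode (f a) := by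
  obtain ⟨x, y, hx, hy, h⟩ := hf
  refine (Primrec.ite (Primrec.nat_le.comp hy hx)
    (Primrec.nat_mul.comp (Primrec.const 2) (Primrec.nat_sub.comp hx hy))
    (Primrec.nat_sub.comp (Primrec.nat_mul.comp (Primrec.const 2) (Primrec.nat_sub.comp hy hx))
      (Primrec.const 1))).of_eq fun a => ?_
  split_ifs with hle
  · have h1 : f a = ((x a - y a : ℕ) : ℤ) := by rw [h]; omega
    rw [h1, encode_int_natCast]
  · have h1 : f a = Int.negSucc (y a - x a - 1) := by rw [h, Int.negSucc_eq]; omega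
    rw [h1, encode_int_negSucc]
    omega

/-- The integer with a given code. -/
def intOf (n : ℕ) : ℤ := if n % 2 = 0 then (n / 2 : ℕ) else -((n / 2 : ℕ) : ℤ) - 1

theorem intOf_encode (z : ℤ) : intOf (Encodable.encode z) = z := by
  cases z with
  | ofNat n =>
    have : Encodable.encode (Int.ofNat n) = 2 * n := rfl
    rw [this, intOf]; simp
  | negSucc n =>
    rw [encode_int_negSucc, intOf, Int.negSucc_eq]
    have : (2 * n + 1) % 2 = 1 := by omega
    have h2 : (2 * n + 1) / 2 = n := by omega
    rw [this, h2]
    simp; ring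

theorem primInt_intOf : PrimInt intOf := by
  have hm : PrimrecPred fun n : ℕ => n % 2 = 0 :=
    Primrec.eq.comp (Primrec.nat_mod.comp Primrec.id (Primrec.const 2)) (Primrec.const 0)
  have hd : Primrec fun n : ℕ => n / 2 := Primrec.nat_div.comp Primrec.id (Primrec.const 2)
  refine ⟨_, _, Primrec.ite hm hd (Primrec.const 0),
    Primrec.ite hm (Primrec.const 0) (Primrec.succ.comp hd), fun n => ?_⟩
  simp only [intOf]
  split_ifs <;> push_cast <;> ring

end PrimInt

theorem primrec_gcd : Primrec₂ Nat.gcd := by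
  have hr : PrimrecRel fun (p : ℕ × ℕ) (n : ℕ) => p.1 % n = 0 ∧ p.2 % n = 0 :=
    PrimrecPred.and
      (Primrec.eq.comp (Primrec.nat_mod.comp (Primrec.fst.comp Primrec.fst) Primrec.snd)
        (Primrec.const 0))
      (Primrec.eq.comp (Primrec.nat_mod.comp (Primrec.snd.comp Primrec.fst) Primrec.snd)
        (Primrec.const 0))
  refine (Primrec.nat_findGreatest (f := fun p : ℕ × ℕ => p.1 + p.2)
    (Primrec.nat_add.comp Primrec.fst Primrec.snd) hr).of_eq fun p => ?_
  obtain ⟨m, n⟩ := p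
  change Nat.findGreatest (fun k => m % k = 0 ∧ n % k = 0) (m + n) = Nat.gcd m n
  rcases Nat.eq_zero_or_pos (m + n) with h | h
  · obtain ⟨rfl, rfl⟩ : m = 0 ∧ n = 0 := by omega
    simp
  · have hle : Nat.gcd m n ≤ m + n := by
      rcases Nat.eq_zero_or_pos m with rfl | hm
      · simp
      · exact (Nat.gcd_le_left n hm).trans (Nat.le_add_right _ _)
    apply le_antisymm
    · have hs := Nat.findGreatest_spec (P := fun k => m % k = 0 ∧ n % k = 0) hle
        ⟨Nat.mod_eq_zero_of_dvd (Nat.gcd_dvd_left m n),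
          Nat.mod_eq_zero_of_dvd (Nat.gcd_dvd_right m n)⟩
      exact Nat.le_of_dvd (Nat.pos_of_ne_zero fun h0 => by
        obtain ⟨rfl, rfl⟩ := Nat.gcd_eq_zero_iff.1 h0
        omega) (Nat.dvd_gcd
        (Nat.dvd_of_mod_eq_zero hs.1) (Nat.dvd_of_mod_eq_zero hs.2))
    · exact Nat.le_findGreatest hle ⟨Nat.mod_eq_zero_of_dvd (Nat.gcd_dvd_left m n),
        Nat.mod_eq_zero_of_dvd (Nat.gcd_dvd_right m n)⟩

/-- The code of a rational number. -/
def rcode (y : ℚ) : ℕ := Nat.pair (Encodable.encode y.num) y.den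

theorem primrec_rcode {α : Type*} [Primcodable α] {X : α → ℤ} {D : α → ℕ} (hX : PrimInt X)
    (hD : Primrec D) (hpos : ∀ a, D a ≠ 0) : Primrec fun a => rcode ((X a : ℚ) / D a) := by
  have hg : Primrec fun a => Nat.gcd (X a).natAbs (D a) := primrec_gcd.comp hX.natAbs hD
  have hnum : PrimInt fun a => X a / (Nat.gcd (X a).natAbs (D a) : ℕ) :=
    hX.ediv_of_dvd hg fun a => Int.natCast_dvd.2 (Nat.gcd_dvd_left _ _)
  refine (Primrec₂.natPair.comp hnum.encode (Primrec.nat_div.comp hD hg)).of_eq fun a => ?_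
  have h : (X a : ℚ) / D a = mkRat (X a) (D a) := by rw [Rat.mkRat_eq_div]
  rw [rcode, h, Rat.num_mkRat, Rat.den_mkRat, if_neg (hpos a)]
  simp [Nat.gcd_comm, hpos a]

/-- The numerator of the rational number with a given code. -/
def rnum (m : ℕ) : ℤ := intOf m.unpair.1

/-- The denominator of the rational number with a given code. -/
def rden (m : ℕ) : ℕ := m.unpair.2

@[simp] theorem rnum_rcode (y : ℚ) : rnum (rcode y) = y.num := by
  simp [rnum, rcode, intOf_encode]

@[simp] theorem rden_rcode (y : ℚ) : rden (rcode y) = y.den := by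
  simp [rden, rcode]

theorem primInt_rnum : PrimInt rnum := primInt_intOf.comp (Primrec.fst.comp Primrec.unpair)

theorem primrec_rden : Primrec rden := Primrec.snd.comp Primrec.unpair

/-- The `i`-th entry of the list with a given code. -/
def entry (i n : ℕ) : ℕ := (((Encodable.decode n : Option (List ℕ)).getD [])[i]?).getD 0

theorem primrec_entry (i : ℕ) : Primrec (entry i) :=
  Primrec.option_getD.comp (Primrec.list_getElem?.comp
    (Primrec.option_getD.comp Primrec.decode (Primrec.const [])) (Primrec.const i))
    (Primrec.const 0)

theorem entry_encode (i : ℕ) (l : List ℕ) : entry i (Encodable.encode l) = (l[i]?).getD 0 := by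
  simp [entry]

theorem ratCode_one (q : Fin 1 → ℚ) :
    ratCode q = Nat.bits (Encodable.encode [rcode (q 0)]) := by
  simp [ratCode, rcode]

theorem ratCode_two (q : Fin 2 → ℚ) :
    ratCode q = Nat.bits (Encodable.encode [rcode (q 0), rcode (q 1)]) := by
  simp [ratCode, rcode]

theorem primrec_encode_list_one : Primrec fun m : ℕ => Encodable.encode [m] :=
  Primrec.encode.comp (Primrec.list_cons.comp Primrec.id (Primrec.const []))

theorem primrec_encode_list_two : Primrec fun m : ℕ × ℕ => Encodable.encode [m.1, m.2] :=
  Primrec.encode.comp (Primrec.list_cons.comp Primrec.fst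
    (Primrec.list_cons.comp Primrec.snd (Primrec.const [])))

/-! ### Approximations to directions -/

/-- The numerator of Wallis' product for `π / 2` with `k` factors. -/
def wallisNum (k : ℕ) : ℕ := Nat.rec 1 (fun i w => w * ((2 * i + 2) * (2 * i + 2))) k

/-- The denominator of Wallis' product for `π / 2` with `k` factors. -/
def wallisDen (k : ℕ) : ℕ := Nat.rec 1 (fun i w => w * ((2 * i + 1) * (2 * i + 3))) k

theorem primrec_affine (a b : ℕ) : Primrec fun n : ℕ => a * n + b :=
  Primrec.nat_add.comp (Primrec.nat_mul.comp (Primrec.const a) Primrec.id) (Primrec.const b)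

theorem primrec_wallisNum : Primrec wallisNum :=
  Primrec.nat_rec₁ 1 (Primrec₂.mk (Primrec.nat_mul.comp Primrec.snd (Primrec.nat_mul.comp
    ((primrec_affine 2 2).comp Primrec.fst) ((primrec_affine 2 2).comp Primrec.fst))))

theorem primrec_wallisDen : Primrec wallisDen :=
  Primrec.nat_rec₁ 1 (Primrec₂.mk (Primrec.nat_mul.comp Primrec.snd (Primrec.nat_mul.comp
    ((primrec_affine 2 1).comp Primrec.fst) ((primrec_affine 2 3).comp Primrec.fst))))

theorem wallisDen_pos (k : ℕ) : 0 < wallisDen k := by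
  induction k with
  | zero => exact one_pos
  | succ k ih =>
    change 0 < wallisDen k * ((2 * k + 1) * (2 * k + 3))
    positivity

theorem wallis_eq (k : ℕ) : Real.Wallis.W k = (wallisNum k : ℝ) / wallisDen k := by
  induction k with
  | zero => simp [Real.Wallis.W, wallisNum, wallisDen]
  | succ k ih =>
    have h1 : wallisNum (k + 1) = wallisNum k * ((2 * k + 2) * (2 * k + 2)) := rfl
    have h2 : wallisDen (k + 1) = wallisDen k * ((2 * k + 1) * (2 * k + 3)) := rfl
    have h3 : (wallisDen k : ℝ) ≠ 0 := by exact_mod_cast (wallisDen_pos k).ne'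
    rw [Real.Wallis.W_succ, ih, h1, h2]
    push_cast
    field_simp

/-- The `n`-th power of the complex number `a + b i`, for natural numbers `a` and `b`; the real
and the imaginary part are given as differences of natural numbers. -/
def gaussPow (a b n : ℕ) : (ℕ × ℕ) × ℕ × ℕ :=
  Nat.rec ((1, 0), (0, 0)) (fun _ z =>
    ((a * z.1.1 + b * z.2.2, a * z.1.2 + b * z.2.1),
      (a * z.2.1 + b * z.1.1, a * z.2.2 + b * z.1.2))) n

theorem primrec_gaussPow : Primrec fun p : ℕ × ℕ × ℕ => gaussPow p.1 p.2.1 p.2.2 := by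
  refine Primrec.nat_rec' (f := fun p : ℕ × ℕ × ℕ => p.2.2) (g := fun _ => ((1, 0), (0, 0)))
    (h := fun p q => ((p.1 * q.2.1.1 + p.2.1 * q.2.2.2, p.1 * q.2.1.2 + p.2.1 * q.2.2.1),
      (p.1 * q.2.2.1 + p.2.1 * q.2.1.1, p.1 * q.2.2.2 + p.2.1 * q.2.1.2)))
    (Primrec.snd.comp Primrec.snd) (Primrec.const _) (Primrec₂.mk ?_)
  have ha : Primrec fun r : (ℕ × ℕ × ℕ) × ℕ × (ℕ × ℕ) × ℕ × ℕ => r.1.1 :=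
    Primrec.fst.comp Primrec.fst
  have hb : Primrec fun r : (ℕ × ℕ × ℕ) × ℕ × (ℕ × ℕ) × ℕ × ℕ => r.1.2.1 :=
    Primrec.fst.comp (Primrec.snd.comp Primrec.fst)
  have h1 : Primrec fun r : (ℕ × ℕ × ℕ) × ℕ × (ℕ × ℕ) × ℕ × ℕ => r.2.2.1 :=
    Primrec.fst.comp (Primrec.snd.comp Primrec.snd)
  have h2 : Primrec fun r : (ℕ × ℕ × ℕ) × ℕ × (ℕ × ℕ) × ℕ × ℕ => r.2.2.2 :=
    Primrec.snd.comp (Primrec.snd.comp Primrec.snd)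
  have h11 := Primrec.fst.comp h1
  have h12 := Primrec.snd.comp h1
  have h21 := Primrec.fst.comp h2
  have h22 := Primrec.snd.comp h2
  have key : ∀ {f g : (ℕ × ℕ × ℕ) × ℕ × (ℕ × ℕ) × ℕ × ℕ → ℕ}, Primrec f → Primrec g →
      Primrec fun r => r.1.1 * f r + r.1.2.1 * g r := fun hf hg =>
    Primrec.nat_add.comp (Primrec.nat_mul.comp ha hf) (Primrec.nat_mul.comp hb hg)
  exact ((key h11 h22).pair (key h12 h21)).pair ((key h21 h11).pair (key h22 h12))

theorem gaussPow_spec (a b n : ℕ) :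
    ((((gaussPow a b n).1.1 : ℝ) - (gaussPow a b n).1.2 : ℝ) : ℂ) +
      (((gaussPow a b n).2.1 : ℝ) - (gaussPow a b n).2.2 : ℝ) * Complex.I =
      ((a : ℂ) + b * Complex.I) ^ n := by
  induction n with
  | zero => simp [gaussPow]
  | succ n ih =>
    have h : gaussPow a b (n + 1) = ((a * (gaussPow a b n).1.1 + b * (gaussPow a b n).2.2,
        a * (gaussPow a b n).1.2 + b * (gaussPow a b n).2.1),
      (a * (gaussPow a b n).2.1 + b * (gaussPow a b n).1.1,
        a * (gaussPow a b n).2.2 + b * (gaussPow a b n).1.2)) := rfl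
    rw [pow_succ, ← ih, h]
    push_cast
    linear_combination ((-((gaussPow a b n).2.1 : ℂ) + (gaussPow a b n).2.2) * b) * Complex.I_sq

theorem norm_pow_sub_pow_le' {a b : ℂ} {M : ℝ} (hM : 1 ≤ M) (ha : ‖a‖ ≤ M) (hb : ‖b‖ ≤ M) (n : ℕ) :
    ‖a ^ n - b ^ n‖ ≤ n * M ^ n * ‖a - b‖ := by
  have hM0 : 0 ≤ M := zero_le_one.trans hM
  induction n with
  | zero => simp
  | succ n ih =>
    have h1 : a ^ (n + 1) - b ^ (n + 1) = (a ^ n - b ^ n) * a + b ^ n * (a - b) := by ring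
    rw [h1]
    calc ‖(a ^ n - b ^ n) * a + b ^ n * (a - b)‖
        ≤ ‖a ^ n - b ^ n‖ * ‖a‖ + ‖b‖ ^ n * ‖a - b‖ := by
          refine (norm_add_le _ _).trans ?_
          rw [norm_mul, norm_mul, norm_pow]
      _ ≤ (n * M ^ n * ‖a - b‖) * M + M ^ (n + 1) * ‖a - b‖ := by
          gcongr
          calc ‖b‖ ^ n ≤ M ^ n := by gcongr
            _ ≤ M ^ (n + 1) := pow_le_pow_right₀ hM (Nat.le_succ n)
      _ = ((n + 1 : ℕ) : ℝ) * M ^ (n + 1) * ‖a - b‖ := by push_cast; ring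

/-- The approximation `(1 + i y / k) ^ k` to `exp (i y)`. -/
theorem norm_one_add_pow_sub_exp_le {y : ℝ} (hy0 : 0 ≤ y) (hy : y ≤ 7) {k : ℕ} (hk : 7 ≤ k) :
    ‖(1 + (y / k : ℝ) * Complex.I) ^ k - Complex.exp (y * Complex.I)‖ ≤ 2 ^ 17 / k - 4 / k := by
  have hk0 : (0 : ℝ) < k := by exact_mod_cast (by omega : 0 < k)
  have hk7 : (7 : ℝ) ≤ k := by exact_mod_cast hk
  set x : ℝ := y / k with hx
  have hx0 : 0 ≤ x := by positivity
  have hx1 : x ≤ 1 := by rw [hx, div_le_one hk0]; linarith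
  have hxk : (k : ℝ) * x = y := by rw [hx]; field_simp
  have hnx : ‖(x : ℂ) * Complex.I‖ = x := by
    rw [norm_mul, Complex.norm_I, mul_one, Complex.norm_real, Real.norm_of_nonneg hx0]
  have hexp : Complex.exp (y * Complex.I) = Complex.exp (x * Complex.I) ^ k := by
    have hyC : (y : ℂ) = k * x := by exact_mod_cast hxk.symm
    rw [← Complex.exp_nat_mul, hyC, mul_assoc]
  have h1 : ‖1 + (x : ℂ) * Complex.I‖ ≤ Real.exp x := by
    refine (norm_add_le _ _).trans ?_
    rw [hnx, norm_one]
    linarith [Real.add_one_le_exp x]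
  have h2 : ‖Complex.exp (x * Complex.I)‖ ≤ Real.exp x := by
    rw [Complex.norm_exp_ofReal_mul_I]
    exact Real.one_le_exp hx0
  have h3 : ‖1 + (x : ℂ) * Complex.I - Complex.exp (x * Complex.I)‖ ≤ x ^ 2 := by
    have := Complex.norm_exp_sub_one_sub_id_le (x := x * Complex.I) (by rw [hnx]; exact hx1)
    rw [hnx] at this
    rw [← norm_neg, show -(1 + (x : ℂ) * Complex.I - Complex.exp (x * Complex.I)) =
      Complex.exp (x * Complex.I) - 1 - x * Complex.I by ring]
    exact this
  have h4 : Real.exp x ^ k ≤ 2187 := by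
    rw [← Real.exp_nat_mul, hxk]
    calc Real.exp y ≤ Real.exp 7 := Real.exp_le_exp.2 hy
      _ = Real.exp 1 ^ 7 := by rw [← Real.exp_nat_mul]; norm_num
      _ ≤ 3 ^ 7 := by
        gcongr
        exact Real.exp_one_lt_d9.le.trans (by norm_num)
      _ = 2187 := by norm_num
  rw [hexp]
  calc _ ≤ k * Real.exp x ^ k * ‖1 + (x : ℂ) * Complex.I - Complex.exp (x * Complex.I)‖ :=
        norm_pow_sub_pow_le' (Real.one_le_exp hx0) h1 h2 k
    _ ≤ k * 2187 * x ^ 2 := by gcongr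
    _ = 2187 * y ^ 2 / k := by rw [hx]; field_simp
    _ ≤ 2187 * 7 ^ 2 / k := by gcongr
    _ ≤ _ := by
      rw [← sub_div]
      gcongr
      norm_num

/-- The parts of the Gaussian integer that approximates the direction `v / 2 ^ u`. -/
def dirPow (k u v : ℕ) : (ℕ × ℕ) × ℕ × ℕ :=
  gaussPow (wallisDen k * 2 ^ u * k) (4 * wallisNum k * v) k

/-- The numerator of the first coordinate of the approximate direction. -/
def dirX (k u v : ℕ) : ℤ := (dirPow k u v).1.1 - (dirPow k u v).1.2

/-- The numerator of the second coordinate of the approximate direction. -/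
def dirY (k u v : ℕ) : ℤ := (dirPow k u v).2.1 - (dirPow k u v).2.2

/-- The common denominator of the coordinates of the approximate direction. -/
def dirDen (k u : ℕ) : ℕ := (wallisDen k * 2 ^ u * k) ^ k

theorem dirDen_pos {k : ℕ} (hk : 0 < k) (u : ℕ) : 0 < dirDen k u := by
  have := wallisDen_pos k
  unfold dirDen
  positivity

/-- The approximate direction is within `2 ^ 17 / k` of the direction with angle
`2 * π * (v / 2 ^ u)`. -/
theorem dir_approx {k : ℕ} (hk : 7 ≤ k) {u v : ℕ} (hv : v < 2 ^ u) :
    |(dirX k u v : ℝ) / dirDen k u - Real.cos (2 * Real.pi * (v / 2 ^ u))| ≤ 2 ^ 17 / k ∧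
    |(dirY k u v : ℝ) / dirDen k u - Real.sin (2 * Real.pi * (v / 2 ^ u))| ≤ 2 ^ 17 / k := by
  have hk0 : (0 : ℝ) < k := by exact_mod_cast (by omega : 0 < k)
  set α : ℝ := v / 2 ^ u with hα
  have hα0 : 0 ≤ α := by positivity
  have hα1 : α ≤ 1 := by
    rw [hα, div_le_one (by positivity)]
    exact_mod_cast hv.le
  set W := Real.Wallis.W k with hW
  have hWpos : 0 < W := Real.Wallis.W_pos k
  have hWle : W ≤ Real.pi / 2 := Real.Wallis.W_le k
  have hWge : Real.pi / 2 - W ≤ 1 / k := by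
    have h1 := Real.Wallis.le_W k
    have h2 : ((2 : ℝ) * k + 1) / (2 * k + 2) * (Real.pi / 2) =
        Real.pi / 2 - Real.pi / 2 / (2 * k + 2) := by field_simp; ring
    have h3 : Real.pi / 2 / (2 * k + 2) ≤ 1 / k := by
      rw [div_le_div_iff₀ (by positivity) hk0]
      nlinarith [Real.pi_le_four]
    rw [h2] at h1
    linarith
  set y : ℝ := 4 * W * α with hy
  have hy0 : 0 ≤ y := by positivity
  have hy7 : y ≤ 7 := by
    have h1 : y ≤ 4 * W * 1 := by rw [hy]; gcongr
    linarith [Real.pi_lt_d2]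
  have hD : (0 : ℝ) < dirDen k u := by exact_mod_cast dirDen_pos (by omega) u
  have hwd : (0 : ℝ) < wallisDen k := by exact_mod_cast wallisDen_pos k
  set z : ℂ := (((dirX k u v : ℝ) / dirDen k u : ℝ) : ℂ) +
    (((dirY k u v : ℝ) / dirDen k u : ℝ) : ℂ) * Complex.I with hz
  have hzpow : z = (1 + (y / k : ℝ) * Complex.I) ^ k := by
    have hs := gaussPow_spec (wallisDen k * 2 ^ u * k) (4 * wallisNum k * v) k
    have hDC : (dirDen k u : ℂ) ≠ 0 := by exact_mod_cast hD.ne'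
    have hbase : (1 + (y / k : ℝ) * Complex.I) = (((wallisDen k * 2 ^ u * k : ℕ) : ℂ) +
        ((4 * wallisNum k * v : ℕ) : ℂ) * Complex.I) / ((wallisDen k * 2 ^ u * k : ℕ) : ℂ) := by
      have hwdC : (wallisDen k : ℂ) ≠ 0 := by exact_mod_cast hwd.ne'
      have hkC : (k : ℂ) ≠ 0 := by exact_mod_cast hk0.ne'
      rw [hy, hW, wallis_eq, hα]
      push_cast
      field_simp
    rw [hbase, div_pow, ← hs]
    have hden : (((wallisDen k * 2 ^ u * k : ℕ) : ℂ)) ^ k = (dirDen k u : ℂ) := by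
      rw [dirDen]; push_cast; ring
    rw [hden, hz, eq_div_iff hDC]
    simp only [dirX, dirY, dirPow]
    push_cast
    field_simp
  have h1 := norm_one_add_pow_sub_exp_le hy0 hy7 hk
  rw [← hzpow] at h1
  have h2 : ‖Complex.exp (y * Complex.I) - Complex.exp ((2 * Real.pi * α : ℝ) * Complex.I)‖ ≤
      4 / k := by
    have e1 : Complex.exp (y * Complex.I) - Complex.exp ((2 * Real.pi * α : ℝ) * Complex.I) =
        Complex.exp ((2 * Real.pi * α : ℝ) * Complex.I) *
          (Complex.exp (Complex.I * ((y - 2 * Real.pi * α : ℝ) : ℂ)) - 1) := by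
      rw [mul_sub, ← Complex.exp_add, mul_one]
      congr 2
      push_cast
      ring
    rw [e1, norm_mul, Complex.norm_exp_ofReal_mul_I, one_mul]
    refine (Real.norm_exp_I_mul_ofReal_sub_one_le).trans ?_
    have e2 : y - 2 * Real.pi * α = -(4 * α * (Real.pi / 2 - W)) := by rw [hy]; ring
    rw [e2, norm_neg, Real.norm_of_nonneg (mul_nonneg (by positivity) (by linarith))]
    calc 4 * α * (Real.pi / 2 - W) ≤ 4 * 1 * (1 / k) := by
          gcongr
      _ = 4 / k := by ring
  have h3 : ‖z - Complex.exp ((2 * Real.pi * α : ℝ) * Complex.I)‖ ≤ 2 ^ 17 / k := by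
    have := norm_sub_le_norm_sub_add_norm_sub z (Complex.exp (y * Complex.I))
      (Complex.exp ((2 * Real.pi * α : ℝ) * Complex.I))
    linarith
  have hre : (z - Complex.exp ((2 * Real.pi * α : ℝ) * Complex.I)).re =
      (dirX k u v : ℝ) / dirDen k u - Real.cos (2 * Real.pi * α) := by
    rw [Complex.sub_re, Complex.exp_ofReal_mul_I_re, hz]
    simp [-Complex.ofReal_div]
  have him : (z - Complex.exp ((2 * Real.pi * α : ℝ) * Complex.I)).im =
      (dirY k u v : ℝ) / dirDen k u - Real.sin (2 * Real.pi * α) := by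
    rw [Complex.sub_im, Complex.exp_ofReal_mul_I_im, hz]
    simp [-Complex.ofReal_div]
  rw [← hre, ← him]
  exact ⟨(Complex.abs_re_le_norm _).trans h3, (Complex.abs_im_le_norm _).trans h3⟩

section

variable {α : Type*} [Primcodable α]

theorem primrec_nat_pow {f g : α → ℕ} (hf : Primrec f) (hg : Primrec g) :
    Primrec fun a => f a ^ g a :=
  (Primrec₂.unpaired'.1 Nat.Primrec.pow).comp hf hg

theorem primrec_dirBase {k u : α → ℕ} (hk : Primrec k) (hu : Primrec u) :
    Primrec fun a => wallisDen (k a) * 2 ^ u a * k a :=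
  Primrec.nat_mul.comp (Primrec.nat_mul.comp (primrec_wallisDen.comp hk)
    (primrec_nat_pow (Primrec.const 2) hu)) hk

theorem primrec_dirPow {k u v : α → ℕ} (hk : Primrec k) (hu : Primrec u) (hv : Primrec v) :
    Primrec fun a => dirPow (k a) (u a) (v a) :=
  primrec_gaussPow.comp ((primrec_dirBase hk hu).pair ((Primrec.nat_mul.comp
    (Primrec.nat_mul.comp (Primrec.const 4) (primrec_wallisNum.comp hk)) hv).pair hk))

theorem primInt_dirX {k u v : α → ℕ} (hk : Primrec k) (hu : Primrec u) (hv : Primrec v) :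
    PrimInt fun a => dirX (k a) (u a) (v a) :=
  ⟨_, _, Primrec.fst.comp (Primrec.fst.comp (primrec_dirPow hk hu hv)),
    Primrec.snd.comp (Primrec.fst.comp (primrec_dirPow hk hu hv)), fun _ => rfl⟩

theorem primInt_dirY {k u v : α → ℕ} (hk : Primrec k) (hu : Primrec u) (hv : Primrec v) :
    PrimInt fun a => dirY (k a) (u a) (v a) :=
  ⟨_, _, Primrec.fst.comp (Primrec.snd.comp (primrec_dirPow hk hu hv)),
    Primrec.snd.comp (Primrec.snd.comp (primrec_dirPow hk hu hv)), fun _ => rfl⟩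

theorem primrec_dirDen {k u : α → ℕ} (hk : Primrec k) (hu : Primrec u) :
    Primrec fun a => dirDen (k a) (u a) :=
  primrec_nat_pow (primrec_dirBase hk hu) hk

end

/-! ### Finite parts of the oracle of a direction -/

/-- The first `u` bits of the join of an oracle that begins with `σ` and of the oracle of a
real number `a ∈ [0, 1)` with `⌊2 ^ u * a⌋ = v`. -/
def finJoin (σ : List Bool) (u v : ℕ) : List Bool :=
  (List.range u).map fun m =>
    if m % 2 = 0 then (σ[m / 2]?).getD false
    else decide ((m / 2).unpair.2 = 2 * (v / 2 ^ (u - (m / 2).unpair.1)))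

theorem floor_two_pow_mul_div (a : ℝ) {r u : ℕ} (h : r ≤ u) :
    ⌊2 ^ u * a⌋₊ / 2 ^ (u - r) = ⌊2 ^ r * a⌋₊ := by
  have h1 : (2 : ℝ) ^ r * a = 2 ^ u * a / (2 ^ (u - r) : ℕ) := by
    rw [← Nat.add_sub_cancel' h, pow_add]
    push_cast
    rw [Nat.add_sub_cancel_left]
    field_simp
  rw [h1, Nat.floor_div_natCast]

theorem mem_realOracle {a : ℝ} (ha : 0 ≤ a) (n : ℕ) :
    n ∈ realOracle a ↔ n.unpair.2 = 2 * ⌊2 ^ n.unpair.1 * a⌋₊ := by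
  have h : ∀ r : ℕ, Encodable.encode ⌊(2 : ℝ) ^ r * a⌋ = 2 * ⌊2 ^ r * a⌋₊ := fun r => by
    rw [← Int.natCast_floor_eq_floor (by positivity : 0 ≤ (2 : ℝ) ^ r * a)]
    exact encode_int_natCast _
  constructor
  · rintro ⟨r, rfl⟩
    rw [Nat.unpair_pair, h]
  · intro hn
    exact ⟨n.unpair.1, by rw [h, ← hn, Nat.pair_unpair]⟩

theorem even_mem_join (A B : Set ℕ) (n : ℕ) : 2 * n ∈ join A B ↔ n ∈ A := by
  constructor
  · rintro (⟨m, hm, h⟩ | ⟨m, hm, h⟩)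
    · obtain rfl : n = m := by omega
      exact hm
    · omega
  · exact fun h => Or.inl ⟨n, h, rfl⟩

theorem odd_mem_join (A B : Set ℕ) (n : ℕ) : 2 * n + 1 ∈ join A B ↔ n ∈ B := by
  constructor
  · rintro (⟨m, hm, h⟩ | ⟨m, hm, h⟩)
    · omega
    · obtain rfl : n = m := by omega
      exact hm
  · exact fun h => Or.inr ⟨n, h, rfl⟩

/-- A finite part of the oracle of a direction depends only on a truncation of the direction. This
allows other directions to be put in its place. -/
theorem pre_join_realOracle (A : Set ℕ) {a : ℝ} (ha : 0 ≤ a) (u : ℕ) :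
    pre (join A (realOracle a)) u = finJoin (pre A u) u ⌊2 ^ u * a⌋₊ := by
  classical
  refine List.map_congr_left fun m hm => ?_
  have hmu : m < u := List.mem_range.1 hm
  split_ifs with h
  · rw [getElem?_pre, if_pos (by omega)]
    obtain ⟨n, rfl⟩ : ∃ n, m = 2 * n := ⟨m / 2, by omega⟩
    simp [even_mem_join]
  · obtain ⟨n, rfl⟩ : ∃ n, m = 2 * n + 1 := ⟨m / 2, by omega⟩
    have hn : (2 * n + 1) / 2 = n := by omega
    rw [hn, floor_two_pow_mul_div a ((Nat.unpair_left_le n).trans (by omega))]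
    simp only [odd_mem_join, mem_realOracle ha]

theorem finJoin_take (σ : List Bool) (u v : ℕ) : finJoin (σ.take u) u v = finJoin σ u v := by
  refine List.map_congr_left fun m hm => ?_
  have hmu : m < u := List.mem_range.1 hm
  have : m / 2 < u := (Nat.div_le_self m 2).trans_lt hmu
  rw [List.getElem?_take, if_pos this]

theorem primrec_finJoin :
    Primrec fun p : List Bool × ℕ × ℕ => finJoin p.1 p.2.1 p.2.2 := by
  have hm : Primrec fun q : (List Bool × ℕ × ℕ) × ℕ => q.2 / 2 :=
    Primrec.nat_div.comp Primrec.snd (Primrec.const 2)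
  have hu : Primrec fun q : (List Bool × ℕ × ℕ) × ℕ => (q.2 / 2).unpair :=
    Primrec.unpair.comp hm
  refine Primrec.list_map (Primrec.list_range.comp (Primrec.fst.comp Primrec.snd))
    (Primrec₂.mk (Primrec.ite ?_ ?_ ?_))
  · exact Primrec.eq.comp (Primrec.nat_mod.comp Primrec.snd (Primrec.const 2)) (Primrec.const 0)
  · exact Primrec.option_getD.comp
      (Primrec.list_getElem?.comp (Primrec.fst.comp Primrec.fst) hm) (Primrec.const false)
  · refine PrimrecPred.decide (p := fun q : (List Bool × ℕ × ℕ) × ℕ =>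
      (q.2 / 2).unpair.2 = 2 * (q.1.2.2 / 2 ^ (q.1.2.1 - (q.2 / 2).unpair.1))) ?_
    exact Primrec.eq.comp (Primrec.snd.comp hu) (Primrec.nat_mul.comp (Primrec.const 2)
      (Primrec.nat_div.comp (Primrec.snd.comp (Primrec.snd.comp Primrec.fst))
        (primrec_nat_pow (Primrec.const 2) (Primrec.nat_sub.comp
          (Primrec.fst.comp (Primrec.snd.comp Primrec.fst)) (Primrec.fst.comp hu)))))

theorem ce_runs_finJoin (U : OracleCode) :
    CE fun B (p : (ℕ × ℕ) × List Bool × ℕ × ℕ) =>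
      U.runs (finJoin (pre B p.1.1) p.1.1 p.1.2) p.2.1 p.2.2.1 p.2.2.2 := by
  refine CE.of_test (F := fun σ p => p.1.1 ≤ σ.length ∧
    U.runs (finJoin σ p.1.1 p.1.2) p.2.1 p.2.2.1 p.2.2.2) ?_ fun B p => ?_
  · refine PrimrecPred.and (Primrec.nat_le.comp (Primrec.fst.comp (Primrec.fst.comp Primrec.snd))
      (Primrec.list_length.comp Primrec.fst)) ?_
    have h := PrimrecRel.comp (OracleCode.primrec_runs U)
      (primrec_finJoin.comp ((Primrec.fst (α := List Bool)
        (β := (ℕ × ℕ) × List Bool × ℕ × ℕ)).pair (Primrec.fst.comp Primrec.snd)))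
      (Primrec.snd.comp Primrec.snd)
    exact h
  · constructor
    · exact fun h => ⟨p.1.1, by simp, h⟩
    · rintro ⟨k, hk, h⟩
      rw [length_pre] at hk
      rwa [← finJoin_take, take_pre B hk] at h

theorem ce_not_mem : CE fun B (n : ℕ) => n ∉ B := by
  refine CE.of_test (F := fun σ n => σ[n]? = some false)
    (Primrec.eq.comp Primrec.list_getElem? (Primrec.const _)) fun B n => ?_
  classical
  simp only [getElem?_pre]
  constructor
  · intro h
    exact ⟨n + 1, by simp [h]⟩
  · rintro ⟨k, hk⟩
    split_ifs at hk
    simpa using hk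

/-- `v` is `⌊2 ^ u * a⌋`, if `B` is the join of some oracle with that of `a`. The minimality
makes `v` unique for every `B`. -/
def IsTrunc (B : Set ℕ) (u v : ℕ) : Prop :=
  2 * Nat.pair u (2 * v) + 1 ∈ B ∧ ∀ i ∈ List.range v, 2 * Nat.pair u (2 * i) + 1 ∉ B

theorem isTrunc_withDir {a : ℝ} (ha : 0 ≤ a) (A : Set ℕ) (u v : ℕ) :
    IsTrunc (join A (realOracle a)) u v ↔ v = ⌊2 ^ u * a⌋₊ := by
  simp only [IsTrunc, odd_mem_join, mem_realOracle ha, Nat.unpair_pair, List.mem_range]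
  constructor
  · rintro ⟨h, -⟩
    omega
  · rintro rfl
    exact ⟨rfl, fun i hi => by omega⟩

theorem IsTrunc.unique {B : Set ℕ} {u v v' : ℕ} (h : IsTrunc B u v) (h' : IsTrunc B u v') :
    v = v' := by
  by_contra hne
  rcases Nat.lt_or_gt_of_ne hne with hlt | hlt
  · exact h'.2 v (List.mem_range.2 hlt) h.1
  · exact h.2 v' (List.mem_range.2 hlt) h'.1

theorem ce_isTrunc : CE fun B (p : ℕ × ℕ) => IsTrunc B p.1 p.2 := by
  have h : Primrec fun p : ℕ × ℕ => 2 * Nat.pair p.1 (2 * p.2) + 1 :=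
    (primrec_affine 2 1).comp (Primrec₂.natPair.comp Primrec.fst
      (Primrec.nat_mul.comp (Primrec.const 2) Primrec.snd))
  refine CE.and (ce_mem.comp h) ?_
  exact CE.forall_mem_list (R := fun B (q : (ℕ × ℕ) × ℕ) => 2 * Nat.pair q.1.1 (2 * q.2) + 1 ∉ B)
    (ce_not_mem.comp (h.comp ((Primrec.fst.comp Primrec.fst).pair Primrec.snd)))
    (Primrec.list_range.comp Primrec.snd)

/-! ### Projections of grid points -/

/-- The precision, in binary digits, to which directions are approximated in the comparison of
projections at scale `2 ^ (-r)`; the number `n₀` bounds the points that matter. -/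
def dirPrec (r n₀ : ℕ) : ℕ := r + n₀ + 22

/-- The numerator of the projection of the grid point `q / 2 ^ ρ - (n₀, n₀)` in the approximate
direction with angle `2π w / 2 ^ g`. A pair of natural numbers `q` is given by its code. -/
def projNum (g w n₀ ρ q : ℕ) : ℤ :=
  dirX (2 ^ g) g w * ((q.unpair.1 : ℤ) - (n₀ * 2 ^ ρ : ℕ)) +
    dirY (2 ^ g) g w * ((q.unpair.2 : ℤ) - (n₀ * 2 ^ ρ : ℕ))

/-- The denominator of the projection of a grid point. -/
def projDen (g ρ : ℕ) : ℕ := dirDen (2 ^ g) g * 2 ^ ρ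

theorem projDen_pos (g ρ : ℕ) : 0 < projDen g ρ := by
  have := dirDen_pos (k := 2 ^ g) (by positivity) g
  unfold projDen
  positivity

section

variable {α : Type*} [Primcodable α]

theorem primInt_projNum {g w n₀ ρ q : α → ℕ} (hg : Primrec g) (hw : Primrec w) (hn : Primrec n₀)
    (hρ : Primrec ρ) (hq : Primrec q) :
    PrimInt fun a => projNum (g a) (w a) (n₀ a) (ρ a) (q a) := by
  have hk : Primrec fun a => 2 ^ g a := primrec_nat_pow (Primrec.const 2) hg
  have hc : PrimInt fun a => ((n₀ a * 2 ^ ρ a : ℕ) : ℤ) :=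
    PrimInt.of_primrec (Primrec.nat_mul.comp hn (primrec_nat_pow (Primrec.const 2) hρ))
  exact ((primInt_dirX hk hg hw).mul ((PrimInt.of_primrec
    (Primrec.fst.comp (Primrec.unpair.comp hq))).sub hc)).add
    ((primInt_dirY hk hg hw).mul ((PrimInt.of_primrec
    (Primrec.snd.comp (Primrec.unpair.comp hq))).sub hc))

theorem primrec_projDen {g ρ : α → ℕ} (hg : Primrec g) (hρ : Primrec ρ) :
    Primrec fun a => projDen (g a) (ρ a) :=
  Primrec.nat_mul.comp (primrec_dirDen (primrec_nat_pow (Primrec.const 2) hg) hg)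
    (primrec_nat_pow (Primrec.const 2) hρ)

end

/-- The code of the projection of a grid point, as a rational vector with one coordinate. -/
def projCode (g w n₀ ρ q : ℕ) : ℕ :=
  Encodable.encode [rcode ((projNum g w n₀ ρ q : ℚ) / projDen g ρ)]

/-- The rational number with code `m` is within `2 ^ (1 - r)` of the projection of a grid point;
here `d` and `n` are the denominator and the numerator of the projection. -/
def IsClose (r m d : ℕ) (n : ℤ) : Prop :=
  0 < rden m ∧ ((rnum m * d - n * rden m).natAbs * 2 ^ r ≤ 2 * (d * rden m))

/-- Some program of length at most `H` produces, with the oracle `A` and a direction with binary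
expansion `v / 2 ^ u`, from the projection of the grid point `z` of mesh `2 ^ (-(s + 2))` a number
close to the projection of the grid point `q` of mesh `2 ^ (-(r + 2))`. Only the first `u` bits of
the oracle may be used. The parameters are `p = (r, s, n₀, H)`. -/
def Reaches (U : OracleCode) (A : Set ℕ) (p : ℕ × ℕ × ℕ × ℕ) (d : ℕ × ℕ) (z q : ℕ) : Prop :=
  dirPrec p.1 p.2.2.1 ≤ d.1 ∧ ∃ y : List Bool × ℕ, y.1.length ≤ p.2.2.2 ∧
    U.runs (finJoin (pre A d.1) d.1 d.2) y.1
      (projCode (dirPrec p.1 p.2.2.1) (d.2 / 2 ^ (d.1 - dirPrec p.1 p.2.2.1)) p.2.2.1 (p.2.1 + 2) z)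
      (Encodable.encode [y.2]) ∧
    IsClose p.1 y.2 (projDen (dirPrec p.1 p.2.2.1) (p.1 + 2))
      (projNum (dirPrec p.1 p.2.2.1) (d.2 / 2 ^ (d.1 - dirPrec p.1 p.2.2.1)) p.2.2.1 (p.1 + 2) q)

theorem ce_reaches (U : OracleCode) :
    CE fun B (y : (ℕ × ℕ × ℕ × ℕ) × (ℕ × ℕ) × ℕ × ℕ) =>
      Reaches U B y.1 y.2.1 y.2.2.1 y.2.2.2 := by
  have hg : Primrec fun y : (ℕ × ℕ × ℕ × ℕ) × (ℕ × ℕ) × ℕ × ℕ => dirPrec y.1.1 y.1.2.2.1 :=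
    Primrec.nat_add.comp (Primrec.nat_add.comp (Primrec.fst.comp Primrec.fst)
      (Primrec.fst.comp (Primrec.snd.comp (Primrec.snd.comp Primrec.fst)))) (Primrec.const 22)
  have hn : Primrec fun y : (ℕ × ℕ × ℕ × ℕ) × (ℕ × ℕ) × ℕ × ℕ => y.1.2.2.1 :=
    Primrec.fst.comp (Primrec.snd.comp (Primrec.snd.comp Primrec.fst))
  have hu : Primrec fun y : (ℕ × ℕ × ℕ × ℕ) × (ℕ × ℕ) × ℕ × ℕ => y.2.1.1 :=
    Primrec.fst.comp (Primrec.fst.comp Primrec.snd)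
  have hv : Primrec fun y : (ℕ × ℕ × ℕ × ℕ) × (ℕ × ℕ) × ℕ × ℕ => y.2.1.2 :=
    Primrec.snd.comp (Primrec.fst.comp Primrec.snd)
  have hw : Primrec fun y : (ℕ × ℕ × ℕ × ℕ) × (ℕ × ℕ) × ℕ × ℕ =>
      y.2.1.2 / 2 ^ (y.2.1.1 - dirPrec y.1.1 y.1.2.2.1) :=
    Primrec.nat_div.comp hv (primrec_nat_pow (Primrec.const 2) (Primrec.nat_sub.comp hu hg))
  have hz : Primrec fun y : (ℕ × ℕ × ℕ × ℕ) × (ℕ × ℕ) × ℕ × ℕ => y.2.2.1 :=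
    Primrec.fst.comp (Primrec.snd.comp Primrec.snd)
  have hq : Primrec fun y : (ℕ × ℕ × ℕ × ℕ) × (ℕ × ℕ) × ℕ × ℕ => y.2.2.2 :=
    Primrec.snd.comp (Primrec.snd.comp Primrec.snd)
  have hr2 : Primrec fun y : (ℕ × ℕ × ℕ × ℕ) × (ℕ × ℕ) × ℕ × ℕ => y.1.1 + 2 :=
    Primrec.nat_add.comp (Primrec.fst.comp Primrec.fst) (Primrec.const 2)
  have hs2 : Primrec fun y : (ℕ × ℕ × ℕ × ℕ) × (ℕ × ℕ) × ℕ × ℕ => y.1.2.1 + 2 :=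
    Primrec.nat_add.comp (Primrec.fst.comp (Primrec.snd.comp Primrec.fst)) (Primrec.const 2)
  have hY : Primrec fun y : (ℕ × ℕ × ℕ × ℕ) × (ℕ × ℕ) × ℕ × ℕ =>
      projCode (dirPrec y.1.1 y.1.2.2.1) (y.2.1.2 / 2 ^ (y.2.1.1 - dirPrec y.1.1 y.1.2.2.1))
        y.1.2.2.1 (y.1.2.1 + 2) y.2.2.1 :=
    primrec_encode_list_one.comp (primrec_rcode (primInt_projNum hg hw hn hs2 hz)
      (primrec_projDen hg hs2) fun _ => (projDen_pos _ _).ne')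
  have hN := primInt_projNum hg hw hn hr2 hq
  have hD := primrec_projDen hg hr2
  have hm : Primrec fun x : ((ℕ × ℕ × ℕ × ℕ) × (ℕ × ℕ) × ℕ × ℕ) × List Bool × ℕ => x.2.2 :=
    Primrec.snd.comp Primrec.snd
  refine CE.and (CE.of_primrecPred (Primrec.nat_le.comp hg hu))
    (CE.exists (R := fun B (x : ((ℕ × ℕ × ℕ × ℕ) × (ℕ × ℕ) × ℕ × ℕ) × List Bool × ℕ) =>
      x.2.1.length ≤ x.1.1.2.2.2 ∧
      U.runs (finJoin (pre B x.1.2.1.1) x.1.2.1.1 x.1.2.1.2) x.2.1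
        (projCode (dirPrec x.1.1.1 x.1.1.2.2.1)
          (x.1.2.1.2 / 2 ^ (x.1.2.1.1 - dirPrec x.1.1.1 x.1.1.2.2.1))
          x.1.1.2.2.1 (x.1.1.2.1 + 2) x.1.2.2.1) (Encodable.encode [x.2.2]) ∧
      IsClose x.1.1.1 x.2.2 (projDen (dirPrec x.1.1.1 x.1.1.2.2.1) (x.1.1.1 + 2))
        (projNum (dirPrec x.1.1.1 x.1.1.2.2.1)
          (x.1.2.1.2 / 2 ^ (x.1.2.1.1 - dirPrec x.1.1.1 x.1.1.2.2.1))
          x.1.1.2.2.1 (x.1.1.1 + 2) x.1.2.2.2)) ?_)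
  refine CE.and (CE.of_primrecPred (Primrec.nat_le.comp
    (Primrec.list_length.comp (Primrec.fst.comp Primrec.snd))
    (Primrec.snd.comp (Primrec.snd.comp (Primrec.snd.comp (Primrec.fst.comp Primrec.fst))))))
    (CE.and ?_ (CE.of_primrecPred (PrimrecPred.and ?_ ?_)))
  · exact (ce_runs_finJoin U).comp
      (f := fun x : ((ℕ × ℕ × ℕ × ℕ) × (ℕ × ℕ) × ℕ × ℕ) × List Bool × ℕ => (x.1.2.1, x.2.1,
        projCode (dirPrec x.1.1.1 x.1.1.2.2.1)
          (x.1.2.1.2 / 2 ^ (x.1.2.1.1 - dirPrec x.1.1.1 x.1.1.2.2.1))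
          x.1.1.2.2.1 (x.1.1.2.1 + 2) x.1.2.2.1, Encodable.encode [x.2.2]))
      ((Primrec.fst.comp (Primrec.snd.comp Primrec.fst)).pair ((Primrec.fst.comp Primrec.snd).pair
        ((hY.comp Primrec.fst).pair (primrec_encode_list_one.comp hm))))
  · exact Primrec.nat_lt.comp (Primrec.const 0) (primrec_rden.comp hm)
  · refine Primrec.nat_le.comp (Primrec.nat_mul.comp (PrimInt.natAbs ?_) (primrec_nat_pow
      (Primrec.const 2) (Primrec.fst.comp (Primrec.fst.comp Primrec.fst))))
      (Primrec.nat_mul.comp (Primrec.const 2) (Primrec.nat_mul.comp (hD.comp Primrec.fst)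
        (primrec_rden.comp hm)))
    exact ((primInt_rnum.comp hm).mul (PrimInt.of_primrec (hD.comp Primrec.fst))).sub
      ((hN.comp Primrec.fst).mul (PrimInt.of_primrec (primrec_rden.comp hm)))

/-- A direction with a longer binary expansion reaches more points. -/
theorem Reaches.mono {U : OracleCode} {A : Set ℕ} {p : ℕ × ℕ × ℕ × ℕ} {a : ℝ} (ha : 0 ≤ a)
    {u u' z q : ℕ} (hu : u ≤ u') (h : Reaches U A p (u, ⌊2 ^ u * a⌋₊) z q) :
    Reaches U A p (u', ⌊2 ^ u' * a⌋₊) z q := by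
  obtain ⟨h1, y, h2, h3, h4⟩ := h
  dsimp only at h1 h2 h3 h4
  rw [floor_two_pow_mul_div a h1] at h3 h4
  refine ⟨h1.trans hu, y, h2, ?_, ?_⟩
  · dsimp only
    rw [floor_two_pow_mul_div a (h1.trans hu), ← pre_join_realOracle A ha]
    rw [← pre_join_realOracle A ha] at h3
    exact U.runs_mono (pre_prefix _ hu) h3
  · dsimp only
    rwa [floor_two_pow_mul_div a (h1.trans hu)]

/-! ### Two projections determine a point -/

theorem le_sin_two_pi_mul {θ η : ℝ} (hη : 0 ≤ η) (h1 : η ≤ θ) (h2 : θ ≤ 1 / 2 - η) :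
    4 * η ≤ Real.sin (2 * Real.pi * θ) := by
  have hpi := Real.pi_pos
  have key : ∀ θ : ℝ, 0 ≤ θ → θ ≤ 1 / 4 → 4 * θ ≤ Real.sin (2 * Real.pi * θ) := by
    intro θ h0 h4
    have h := Real.mul_le_sin (x := 2 * Real.pi * θ) (by positivity) (by nlinarith)
    have e : 2 / Real.pi * (2 * Real.pi * θ) = 4 * θ := by
      field_simp
      ring
    rwa [e] at h
  rcases le_total θ (1 / 4) with h | h
  · have := key θ (hη.trans h1) h
    linarith
  · have := key (1 / 2 - θ) (by linarith) (by linarith)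
    rw [show 2 * Real.pi * (1 / 2 - θ) = Real.pi - 2 * Real.pi * θ by ring, Real.sin_pi_sub] at this
    linarith

/-- The angles with two given truncations to `t` digits are well separated modulo `1 / 2`, if the
truncations agree in the first and in the last digit. -/
theorem le_sin_of_truncations {t w w' : ℕ} (hlt : w < w') (hmod : w % 2 = w' % 2)
    (hdiv : w / 2 ^ (t - 1) = w' / 2 ^ (t - 1)) (ht : 2 ≤ t) {α α' : ℝ}
    (h1 : (w : ℝ) ≤ 2 ^ t * α) (h2 : 2 ^ t * α < w + 1)
    (h1' : (w' : ℝ) ≤ 2 ^ t * α') (h2' : 2 ^ t * α' < w' + 1) :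
    4 * (2 ^ t)⁻¹ ≤ Real.sin (2 * Real.pi * (α' - α)) := by
  obtain ⟨j, rfl⟩ : ∃ j, t = j + 2 := ⟨t - 2, by omega⟩
  have e1 : w + 2 ≤ w' := by omega
  have e2 : w' + 2 ≤ w + 2 ^ (j + 1) := by
    have hp : 0 < 2 ^ (j + 1) := by positivity
    rw [show j + 2 - 1 = j + 1 by omega] at hdiv
    have d1 := Nat.div_add_mod w (2 ^ (j + 1))
    have d2 := Nat.div_add_mod w' (2 ^ (j + 1))
    rw [hdiv] at d1
    have m1 := Nat.mod_lt w hp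
    have m2 := Nat.mod_lt w' hp
    have he : 2 ^ (j + 1) = 2 * 2 ^ j := by ring
    omega
  have e1' : (w : ℝ) + 2 ≤ w' := by exact_mod_cast e1
  have e2' : (w' : ℝ) + 2 ≤ w + 2 ^ (j + 1) := by exact_mod_cast e2
  have hT : (0 : ℝ) < 2 ^ (j + 2) := by positivity
  have hT2 : (2 : ℝ) ^ (j + 2) = 2 * 2 ^ (j + 1) := by ring
  refine le_sin_two_pi_mul (by positivity) ?_ ?_
  · rw [inv_le_iff_one_le_mul₀' hT]
    linarith
  · rw [le_sub_iff_add_le, ← mul_le_mul_iff_right₀ hT, mul_add, mul_inv_cancel₀ hT.ne']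
    linarith

/-- Cramer's rule: two linear forms with bounded coefficients and a large determinant control both
coordinates. -/
theorem abs_le_of_det {a b a' b' D M x y : ℝ} (hD : 0 < D) (hdet : D ≤ |a * b' - b * a'|)
    (ha : |a| ≤ 2) (hb : |b| ≤ 2) (ha' : |a'| ≤ 2) (hb' : |b'| ≤ 2)
    (h : |a * x + b * y| ≤ M) (h' : |a' * x + b' * y| ≤ M) :
    |x| ≤ 4 * M / D ∧ |y| ≤ 4 * M / D := by
  have hM : 0 ≤ M := (abs_nonneg _).trans h
  have key : ∀ c c' z : ℝ, |c| ≤ 2 → |c'| ≤ 2 →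
      (a * b' - b * a') * z = c' * (a * x + b * y) - c * (a' * x + b' * y) → |z| ≤ 4 * M / D := by
    intro c c' z hc hc' hz
    rw [le_div_iff₀ hD]
    calc |z| * D ≤ |z| * |a * b' - b * a'| := by gcongr
      _ = |c' * (a * x + b * y) - c * (a' * x + b' * y)| := by rw [← hz, abs_mul, mul_comm]
      _ ≤ |c' * (a * x + b * y)| + |c * (a' * x + b' * y)| := abs_sub _ _
      _ ≤ 2 * M + 2 * M := by
        rw [abs_mul, abs_mul]
        gcongr
      _ = 4 * M := by ring
  exact ⟨key b b' x hb hb' (by ring),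
    key (-a) (-a') y (by rwa [abs_neg]) (by rwa [abs_neg]) (by ring)⟩

/-- The cross product of two approximate unit vectors. -/
theorem le_abs_det_of_approx {a b a' b' θ θ' η D : ℝ} (hη1 : η ≤ 1)
    (ha : |a - Real.cos θ| ≤ η) (hb : |b - Real.sin θ| ≤ η) (ha' : |a' - Real.cos θ'| ≤ η)
    (hb' : |b' - Real.sin θ'| ≤ η) (hD : D + 6 * η ≤ |Real.sin (θ' - θ)|) :
    D ≤ |a * b' - b * a'| := by
  have hη : 0 ≤ η := (abs_nonneg _).trans ha
  have key : ∀ p c q s : ℝ, |p - c| ≤ η → |q - s| ≤ η → |c| ≤ 1 → |s| ≤ 1 →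
      |p * q - c * s| ≤ 3 * η := by
    intro p c q s hp hq hc hs
    have e : p * q - c * s = (p - c) * (q - s) + (p - c) * s + c * (q - s) := by ring
    rw [e]
    calc _ ≤ |(p - c) * (q - s)| + |(p - c) * s| + |c * (q - s)| := abs_add_three _ _ _
      _ ≤ η * 1 + η * 1 + 1 * η := by
        rw [abs_mul, abs_mul, abs_mul]
        gcongr
        exact hq.trans hη1
      _ = 3 * η := by ring
  have h1 := key a _ b' _ ha hb' (Real.abs_cos_le_one _) (Real.abs_sin_le_one _)
  have h2 := key b _ a' _ hb ha' (Real.abs_sin_le_one _) (Real.abs_cos_le_one _)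
  have e : Real.sin (θ' - θ) = (a * b' - b * a') - ((a * b' - Real.cos θ * Real.sin θ') -
      (b * a' - Real.sin θ * Real.cos θ')) := by
    rw [Real.sin_sub]
    ring
  have h3 : |Real.sin (θ' - θ)| ≤ |a * b' - b * a'| + (3 * η + 3 * η) := by
    rw [e]
    refine (abs_sub _ _).trans ?_
    gcongr
    exact (abs_sub _ _).trans (add_le_add h1 h2)
  linarith

theorem IsClose.abs_sub_le {r m d : ℕ} {n : ℤ} (hd : 0 < d) (h : IsClose r m d n) :
    |(rnum m : ℝ) / rden m - n / d| ≤ 2 / 2 ^ r := by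
  obtain ⟨h0, h1⟩ := h
  have h0' : (0 : ℝ) < rden m := by exact_mod_cast h0
  have hd' : (0 : ℝ) < d := by exact_mod_cast hd
  have h2 : |((rnum m : ℝ) * d - n * rden m)| * 2 ^ r ≤ 2 * (d * rden m) := by
    have h3 : (((rnum m * d - n * rden m).natAbs * 2 ^ r : ℕ) : ℝ) ≤ (2 * (d * rden m) : ℕ) := by
      exact_mod_cast h1
    rw [Nat.cast_mul, Nat.cast_natAbs] at h3
    push_cast at h3
    exact h3
  have e : (rnum m : ℝ) / rden m - n / d = (rnum m * d - n * rden m) / (d * rden m) := by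
    field_simp
  rw [e, abs_div, abs_of_pos (mul_pos hd' h0'), div_le_div_iff₀ (by positivity) (by positivity)]
  exact h2

theorem isClose_of_abs_sub_le {r m d : ℕ} {n : ℤ} (hd : 0 < d) (h0 : 0 < rden m)
    (h : |(rnum m : ℝ) / rden m - n / d| ≤ 2 / 2 ^ r) : IsClose r m d n := by
  have h0' : (0 : ℝ) < rden m := by exact_mod_cast h0
  have hd' : (0 : ℝ) < d := by exact_mod_cast hd
  have e : (rnum m : ℝ) / rden m - n / d = (rnum m * d - n * rden m) / (d * rden m) := by
    field_simp
  rw [e, abs_div, abs_of_pos (mul_pos hd' h0'),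
    div_le_div_iff₀ (by positivity) (by positivity)] at h
  refine ⟨h0, ?_⟩
  have h3 : (((rnum m * d - n * rden m).natAbs * 2 ^ r : ℕ) : ℝ) ≤ (2 * (d * rden m) : ℕ) := by
    rw [Nat.cast_mul, Nat.cast_natAbs]
    push_cast
    exact h
  exact_mod_cast h3

theorem projNum_div (g w n₀ ρ q : ℕ) : (projNum g w n₀ ρ q : ℝ) / projDen g ρ =
    (dirX (2 ^ g) g w : ℝ) / dirDen (2 ^ g) g * (q.unpair.1 / 2 ^ ρ - n₀) +
      (dirY (2 ^ g) g w : ℝ) / dirDen (2 ^ g) g * (q.unpair.2 / 2 ^ ρ - n₀) := by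
  have h : (0 : ℝ) < dirDen (2 ^ g) g := by
    exact_mod_cast dirDen_pos (k := 2 ^ g) (by positivity) g
  unfold projNum projDen
  push_cast
  field_simp

theorem seven_le_two_pow {g : ℕ} (hg : 22 ≤ g) : 7 ≤ 2 ^ g :=
  le_trans (by norm_num : 7 ≤ 2 ^ 22) (Nat.pow_le_pow_right two_pos hg)

theorem encard_le_of_unpair_near {S : Set ℕ} {M : ℕ}
    (h : ∀ q ∈ S, ∀ q' ∈ S, q.unpair.1 ≤ q'.unpair.1 + M ∧ q.unpair.2 ≤ q'.unpair.2 + M) :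
    S.encard ≤ ((2 * M + 1) ^ 2 : ℕ) := by
  rcases S.eq_empty_or_nonempty with rfl | ⟨q₀, hq₀⟩
  · simp
  let B : Finset ℕ := ((Finset.Icc (q₀.unpair.1 - M) (q₀.unpair.1 + M)) ×ˢ
    (Finset.Icc (q₀.unpair.2 - M) (q₀.unpair.2 + M))).image fun p => Nat.pair p.1 p.2
  have hS : S ⊆ B := by
    intro q hq
    have h1 := h q hq q₀ hq₀
    have h2 := h q₀ hq₀ q hq
    simp only [B, Finset.coe_image, Set.mem_image, Finset.mem_coe, Finset.mem_product,
      Finset.mem_Icc]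
    exact ⟨q.unpair, by omega, Nat.pair_unpair q⟩
  refine (Set.encard_le_encard hS).trans ?_
  rw [Set.encard_coe_eq_coe_finsetCard, Nat.cast_le]
  refine Finset.card_image_le.trans ?_
  rw [Finset.card_product, Nat.card_Icc, Nat.card_Icc, sq]
  exact Nat.mul_le_mul (by omega) (by omega)

/-- Few grid points have given approximate projections in two directions whose angles differ in
the first `t` digits. -/
theorem encard_isClose_le {r t g n₀ v v' m m' : ℕ} (ht : 2 ≤ t) (hg : t + 22 ≤ g)
    (hv : v < 2 ^ g) (hv' : v' < 2 ^ g)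
    (hne : v / 2 ^ (g - t) ≠ v' / 2 ^ (g - t))
    (hmod : v / 2 ^ (g - t) % 2 = v' / 2 ^ (g - t) % 2)
    (hdiv : v / 2 ^ (g - t) / 2 ^ (t - 1) = v' / 2 ^ (g - t) / 2 ^ (t - 1)) :
    {q | IsClose r m (projDen g (r + 2)) (projNum g v n₀ (r + 2) q) ∧
      IsClose r m' (projDen g (r + 2)) (projNum g v' n₀ (r + 2) q)}.encard ≤
        (2 ^ (2 * t + 14) : ℕ) := by
  have h7 : 7 ≤ 2 ^ g := seven_le_two_pow (by omega)
  have hη : (2 : ℝ) ^ 17 / (2 ^ g : ℕ) ≤ (2 ^ t)⁻¹ / 32 := by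
    obtain ⟨j, rfl⟩ := Nat.exists_eq_add_of_le hg
    push_cast
    rw [inv_eq_one_div, div_div, div_le_div_iff₀ (by positivity) (by positivity), pow_add, pow_add]
    have : (1 : ℝ) ≤ 2 ^ j := one_le_pow₀ (by norm_num)
    have ht0 : (0 : ℝ) < 2 ^ t := by positivity
    nlinarith [mul_le_mul_of_nonneg_left this ht0.le]
  set η : ℝ := (2 : ℝ) ^ 17 / (2 ^ g : ℕ) with hη_def
  have hη0 : 0 ≤ η := by positivity
  have hT1 : ((2 : ℝ) ^ t)⁻¹ ≤ 1 := inv_le_one_of_one_le₀ (one_le_pow₀ (by norm_num))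
  have hT0 : 0 < ((2 : ℝ) ^ t)⁻¹ := by positivity
  -- The two approximate directions have a cross product of order at least `2 ^ (-t)`.
  have htr : ∀ v : ℕ, ((v / 2 ^ (g - t) : ℕ) : ℝ) ≤ 2 ^ t * ((v : ℝ) / 2 ^ g) ∧
      2 ^ t * ((v : ℝ) / 2 ^ g) < (v / 2 ^ (g - t) : ℕ) + 1 := by
    intro v
    have e : (2 : ℝ) ^ t * ((v : ℝ) / 2 ^ g) = v / (2 ^ (g - t) : ℕ) := by
      rw [Nat.cast_pow, Nat.cast_ofNat, pow_sub₀ _ two_ne_zero (by omega)]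
      field_simp
    rw [e]
    refine ⟨Nat.cast_div_le, ?_⟩
    rw [div_lt_iff₀ (by positivity)]
    have := Nat.lt_mul_of_div_lt (Nat.lt_succ_self (v / 2 ^ (g - t))) (by positivity)
    exact_mod_cast this
  have hsin : 4 * ((2 : ℝ) ^ t)⁻¹ ≤
      |Real.sin (2 * Real.pi * ((v' : ℝ) / 2 ^ g) - 2 * Real.pi * ((v : ℝ) / 2 ^ g))| := by
    rcases Nat.lt_or_gt_of_ne hne with hlt | hlt
    · rw [← mul_sub]
      exact (le_sin_of_truncations hlt hmod hdiv ht (htr v).1 (htr v).2 (htr v').1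
        (htr v').2).trans (le_abs_self _)
    · rw [← abs_neg, ← Real.sin_neg, neg_sub, ← mul_sub]
      exact (le_sin_of_truncations hlt hmod.symm hdiv.symm ht (htr v').1 (htr v').2 (htr v).1
        (htr v).2).trans (le_abs_self _)
  obtain ⟨a1, a2⟩ := dir_approx h7 hv
  obtain ⟨b1, b2⟩ := dir_approx h7 hv'
  have hdet := le_abs_det_of_approx (D := 2 * ((2 : ℝ) ^ t)⁻¹) (by linarith) a1 a2 b1 b2
    (by linarith)
  have habs : ∀ p c : ℝ, |p - c| ≤ η → |c| ≤ 1 → |p| ≤ 2 := by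
    intro p c h1 h2
    have := abs_sub_abs_le_abs_sub p c
    linarith
  have key : ∀ q q' v m, IsClose r m (projDen g (r + 2)) (projNum g v n₀ (r + 2) q) →
      IsClose r m (projDen g (r + 2)) (projNum g v n₀ (r + 2) q') →
      |(dirX (2 ^ g) g v : ℝ) / dirDen (2 ^ g) g * ((q.unpair.1 : ℝ) - q'.unpair.1) +
        (dirY (2 ^ g) g v : ℝ) / dirDen (2 ^ g) g * ((q.unpair.2 : ℝ) - q'.unpair.2)| ≤ 16 := by
    intro q q' v m h h'
    have c1 := h.abs_sub_le (projDen_pos _ _)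
    have c2 := h'.abs_sub_le (projDen_pos _ _)
    rw [projNum_div] at c1 c2
    have c3 := (abs_sub _ _).trans (add_le_add c2 c1)
    have hr0 : (0 : ℝ) < 2 ^ (r + 2) := by positivity
    have c4 := mul_le_mul_of_nonneg_left c3 hr0.le
    rw [← abs_of_pos hr0, ← abs_mul, abs_of_pos hr0] at c4
    have e1 : (2 : ℝ) ^ (r + 2) * (2 / 2 ^ r + 2 / 2 ^ r) = 16 := by
      rw [pow_add]
      field_simp
      norm_num
    rw [e1] at c4
    have hh : ∀ p : ℝ, (2 : ℝ) ^ (r + 2) * (p / 2 ^ (r + 2)) = p := fun p =>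
      mul_div_cancel₀ p hr0.ne'
    refine (le_of_eq (congrArg _ ?_)).trans c4
    linear_combination (-((dirX (2 ^ g) g v : ℝ) / dirDen (2 ^ g) g)) * hh q.unpair.1 +
      ((dirX (2 ^ g) g v : ℝ) / dirDen (2 ^ g) g) * hh q'.unpair.1 -
      ((dirY (2 ^ g) g v : ℝ) / dirDen (2 ^ g) g) * hh q.unpair.2 +
      ((dirY (2 ^ g) g v : ℝ) / dirDen (2 ^ g) g) * hh q'.unpair.2
  have hM : ((2 * (32 * 2 ^ t) + 1) ^ 2 : ℕ) ≤ 2 ^ (2 * t + 14) := by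
    rw [show 2 * t + 14 = (t + 7) * 2 by ring, pow_mul]
    refine Nat.pow_le_pow_left ?_ 2
    have : 0 < 2 ^ t := by positivity
    rw [pow_add]
    omega
  refine (encard_le_of_unpair_near (M := 32 * 2 ^ t) ?_).trans (by exact_mod_cast hM)
  rintro q ⟨h1, h2⟩ q' ⟨h1', h2'⟩
  have h3 := abs_le_of_det (by positivity) hdet (habs _ _ a1 (Real.abs_cos_le_one _))
    (habs _ _ a2 (Real.abs_sin_le_one _)) (habs _ _ b1 (Real.abs_cos_le_one _))
    (habs _ _ b2 (Real.abs_sin_le_one _)) (key q q' v m h1 h1') (key q q' v' m' h2 h2')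
  have e : 4 * 16 / (2 * ((2 : ℝ) ^ t)⁻¹) = 32 * 2 ^ t := by
    field_simp
    norm_num
  rw [e] at h3
  have h4 := (le_abs_self _).trans h3.1
  have h5 := (le_abs_self _).trans h3.2
  constructor
  · have : (q.unpair.1 : ℝ) ≤ q'.unpair.1 + 32 * 2 ^ t := by linarith
    exact_mod_cast this
  · have : (q.unpair.2 : ℝ) ≤ q'.unpair.2 + 32 * 2 ^ t := by linarith
    exact_mod_cast this

/-- The projection of a grid point near `x` in the approximate direction is near the
projection of `x`. -/
theorem abs_projNum_sub_le {a : ℝ} (ha : a ∈ Set.Ico (0 : ℝ) 1) {x₀ x₁ : ℝ} {r n₀ ρ q : ℕ}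
    (h0 : |x₀| + 2 ≤ n₀) (h1 : |x₁| + 2 ≤ n₀)
    (hq0 : |(q.unpair.1 : ℝ) / 2 ^ ρ - n₀ - x₀| ≤ (2 ^ ρ)⁻¹)
    (hq1 : |(q.unpair.2 : ℝ) / 2 ^ ρ - n₀ - x₁| ≤ (2 ^ ρ)⁻¹) :
    |(projNum (dirPrec r n₀) ⌊2 ^ dirPrec r n₀ * a⌋₊ n₀ ρ q : ℝ) / projDen (dirPrec r n₀) ρ -
      (Real.cos (2 * Real.pi * a) * x₀ + Real.sin (2 * Real.pi * a) * x₁)| ≤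
        2 * (2 ^ ρ)⁻¹ + (2 ^ r)⁻¹ / 8 := by
  set g := dirPrec r n₀ with hg
  set v := ⌊(2 : ℝ) ^ g * a⌋₊ with hv
  have hg0 : (0 : ℝ) < 2 ^ g := by positivity
  have hv1 : (v : ℝ) ≤ 2 ^ g * a := Nat.floor_le (mul_nonneg hg0.le ha.1)
  have hv2 : 2 ^ g * a < v + 1 := Nat.lt_floor_add_one _
  have hvg : v < 2 ^ g := by
    have : (v : ℝ) < 2 ^ g := hv1.trans_lt (by nlinarith [ha.2])
    exact_mod_cast this
  have h7 : 7 ≤ 2 ^ g := seven_le_two_pow (by rw [hg, dirPrec]; omega)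
  obtain ⟨a1, a2⟩ := dir_approx h7 hvg
  have hang : |2 * Real.pi * ((v : ℝ) / 2 ^ g) - 2 * Real.pi * a| ≤ 8 / 2 ^ g := by
    rw [← mul_sub, abs_mul, abs_of_pos Real.two_pi_pos]
    have hd : |(v : ℝ) / 2 ^ g - a| ≤ 1 / 2 ^ g := by
      rw [abs_le]
      constructor
      · rw [neg_le_sub_iff_le_add, ← add_div, le_div_iff₀ hg0]
        linarith
      · rw [sub_le_iff_le_add]
        have : (v : ℝ) / 2 ^ g ≤ a := by rw [div_le_iff₀ hg0]; linarith
        have : 0 ≤ 1 / (2 : ℝ) ^ g := by positivity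
        linarith
    calc _ ≤ 8 * (1 / (2 : ℝ) ^ g) := by
          gcongr
          linarith [Real.pi_lt_d2]
      _ = _ := by ring
  have hη : (2 : ℝ) ^ 17 / (2 ^ g : ℕ) + 8 / 2 ^ g ≤ (2 ^ r)⁻¹ * (2 ^ n₀)⁻¹ / 16 := by
    push_cast
    rw [← add_div, hg, dirPrec, pow_add, pow_add, ← mul_inv, inv_eq_one_div, div_div,
      div_le_div_iff₀ (by positivity) (by positivity)]
    have : (0 : ℝ) < 2 ^ r * 2 ^ n₀ := by positivity
    generalize (2 : ℝ) ^ r * 2 ^ n₀ = T at this ⊢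
    norm_num
    linarith
  set η : ℝ := (2 ^ r)⁻¹ * (2 ^ n₀)⁻¹ / 16 with hη_def
  have c1 : |(dirX (2 ^ g) g v : ℝ) / dirDen (2 ^ g) g - Real.cos (2 * Real.pi * a)| ≤ η := by
    have hc := (Real.abs_cos_sub_cos_le (2 * Real.pi * ((v : ℝ) / 2 ^ g)) (2 * Real.pi * a))
    refine (abs_sub_le _ _ _).trans ((add_le_add a1 (hc.trans hang)).trans hη)
  have c2 : |(dirY (2 ^ g) g v : ℝ) / dirDen (2 ^ g) g - Real.sin (2 * Real.pi * a)| ≤ η := by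
    have hc := (Real.abs_sin_sub_sin_le (2 * Real.pi * ((v : ℝ) / 2 ^ g)) (2 * Real.pi * a))
    refine (abs_sub_le _ _ _).trans ((add_le_add a2 (hc.trans hang)).trans hη)
  have hρ1 : ((2 : ℝ) ^ ρ)⁻¹ ≤ 1 := inv_le_one_of_one_le₀ (one_le_pow₀ (by norm_num))
  have hQ : ∀ y Q : ℝ, |y| + 2 ≤ n₀ → |Q - n₀ - y| ≤ (2 ^ ρ)⁻¹ → |Q - n₀| ≤ n₀ := by
    intro y Q hy hQ
    have := abs_sub_abs_le_abs_sub (Q - n₀) y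
    linarith
  have hn : (n₀ : ℝ) * (2 ^ n₀)⁻¹ ≤ 1 := by
    rw [← div_eq_mul_inv, div_le_one (by positivity)]
    exact_mod_cast Nat.lt_two_pow_self.le
  rw [projNum_div]
  set X : ℝ := (dirX (2 ^ g) g v : ℝ) / dirDen (2 ^ g) g
  set Y : ℝ := (dirY (2 ^ g) g v : ℝ) / dirDen (2 ^ g) g
  set Q0 : ℝ := (q.unpair.1 : ℝ) / 2 ^ ρ
  set Q1 : ℝ := (q.unpair.2 : ℝ) / 2 ^ ρ
  set c := Real.cos (2 * Real.pi * a)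
  set s := Real.sin (2 * Real.pi * a)
  have e : X * (Q0 - n₀) + Y * (Q1 - n₀) - (c * x₀ + s * x₁) =
      ((X - c) * (Q0 - n₀) + (Y - s) * (Q1 - n₀)) + (c * (Q0 - n₀ - x₀) + s * (Q1 - n₀ - x₁)) := by
    ring
  have hη0 : 0 ≤ η := by positivity
  have t1 : |(X - c) * (Q0 - n₀) + (Y - s) * (Q1 - n₀)| ≤ η * n₀ + η * n₀ := by
    refine (abs_add_le _ _).trans (add_le_add ?_ ?_)
    · rw [abs_mul]
      exact mul_le_mul c1 (hQ _ _ h0 hq0) (abs_nonneg _) hη0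
    · rw [abs_mul]
      exact mul_le_mul c2 (hQ _ _ h1 hq1) (abs_nonneg _) hη0
  have t2 : |c * (Q0 - n₀ - x₀) + s * (Q1 - n₀ - x₁)| ≤ 1 * (2 ^ ρ)⁻¹ + 1 * (2 ^ ρ)⁻¹ := by
    refine (abs_add_le _ _).trans (add_le_add ?_ ?_)
    · rw [abs_mul]
      exact mul_le_mul (Real.abs_cos_le_one _) hq0 (abs_nonneg _) zero_le_one
    · rw [abs_mul]
      exact mul_le_mul (Real.abs_sin_le_one _) hq1 (abs_nonneg _) zero_le_one
  have t3 : η * n₀ ≤ (2 ^ r)⁻¹ / 16 := by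
    have : (0 : ℝ) < (2 ^ r)⁻¹ := by positivity
    have h := mul_le_mul_of_nonneg_left hn this.le
    calc η * n₀ = (2 ^ r)⁻¹ * (n₀ * (2 ^ n₀)⁻¹) / 16 := by rw [hη_def]; ring
      _ ≤ (2 ^ r)⁻¹ / 16 := by linarith
  rw [e]
  refine (abs_add_le _ _).trans ((add_le_add t1 t2).trans ?_)
  linarith

/-! ### Many directions through the same grid -/

/-- A lower bound for the size of a union of large sets with small pairwise intersections. -/
theorem card_mul_le_of_card_inter_le {ι β : Type*} [DecidableEq β] (I : Finset ι)
    (S : ι → Finset β) {M B k : ℕ} {X : Finset β} (hX : X.card ≤ B) (hS : ∀ i ∈ I, S i ⊆ X)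
    (hM : ∀ i ∈ I, M ≤ (S i).card) (hk : ∀ i ∈ I, ∀ j ∈ I, i ≠ j → (S i ∩ S j).card ≤ k) :
    I.card * M ≤ B + I.card ^ 2 * k := by
  classical
  have key : I.card * M ≤ (I.biUnion S).card + I.card ^ 2 * k := by
    clear hS
    induction I using Finset.induction_on with
    | empty => simp
    | insert i I hi ih =>
      have h1 := ih (fun j hj => hM j (Finset.mem_insert_of_mem hj))
        fun j hj j' hj' => hk j (Finset.mem_insert_of_mem hj) j' (Finset.mem_insert_of_mem hj')
      have h2 : (S i ∩ I.biUnion S).card ≤ I.card * k := by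
        rw [Finset.inter_biUnion]
        exact Finset.card_biUnion_le_card_mul _ _ _ fun j hj =>
          hk i (Finset.mem_insert_self _ _) j (Finset.mem_insert_of_mem hj)
            (by rintro rfl; exact hi hj)
      have h3 := Finset.card_union_add_card_inter (S i) (I.biUnion S)
      have h4 := hM i (Finset.mem_insert_self _ _)
      rw [Finset.biUnion_insert, Finset.card_insert_of_notMem hi]
      nlinarith
  exact key.trans (Nat.add_le_add_right ((Finset.card_le_card
    (Finset.biUnion_subset.2 hS)).trans hX) _)

/-- The truncations of two directions to `t` binary digits are different, but agree in the first
and in the last digit. -/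
def Separated (t : ℕ) (w w' : ℕ) : Prop :=
  w ≠ w' ∧ w % 2 = w' % 2 ∧ w / 2 ^ (t - 1) = w' / 2 ^ (t - 1)

theorem div_two_pow_div (v : ℕ) {t g u : ℕ} (h1 : t ≤ g) (h2 : g ≤ u) :
    v / 2 ^ (u - g) / 2 ^ (g - t) = v / 2 ^ (u - t) := by
  rw [Nat.div_div_eq_div_mul, ← pow_add]
  congr 2
  omega

/-- A grid point that is reached in two separated directions is determined, up to few
possibilities, by the two programs which witness this. -/
theorem card_le_of_reaches {U : OracleCode} {A : Set ℕ} {r s n₀ H t z : ℕ} {d d' : ℕ × ℕ}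
    (ht : 2 ≤ t) (htr : t ≤ r) (hd : d.2 < 2 ^ d.1) (hd' : d'.2 < 2 ^ d'.1)
    (hsep : Separated t (d.2 / 2 ^ (d.1 - t)) (d'.2 / 2 ^ (d'.1 - t))) {S : Finset ℕ}
    (hS : ∀ q ∈ S, Reaches U A (r, s, n₀, H) d z q ∧ Reaches U A (r, s, n₀, H) d' z q) :
    S.card ≤ 2 ^ (2 * t + 14) * (2 ^ (H + 1) * 2 ^ (H + 1)) := by
  classical
  rcases S.eq_empty_or_nonempty with rfl | ⟨q₀, hq₀⟩
  · simp
  have hg : dirPrec r n₀ ≤ d.1 := (hS q₀ hq₀).1.1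
  have hg' : dirPrec r n₀ ≤ d'.1 := (hS q₀ hq₀).2.1
  have htg : t + 22 ≤ dirPrec r n₀ := by unfold dirPrec; omega
  have hex : ∀ q, ∃ y : (List Bool × ℕ) × (List Bool × ℕ), q ∈ S →
      (y.1.1.length ≤ H ∧ U.runs (finJoin (pre A d.1) d.1 d.2) y.1.1
        (projCode (dirPrec r n₀) (d.2 / 2 ^ (d.1 - dirPrec r n₀)) n₀ (s + 2) z)
        (Encodable.encode [y.1.2]) ∧
      IsClose r y.1.2 (projDen (dirPrec r n₀) (r + 2))
        (projNum (dirPrec r n₀) (d.2 / 2 ^ (d.1 - dirPrec r n₀)) n₀ (r + 2) q)) ∧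
      (y.2.1.length ≤ H ∧ U.runs (finJoin (pre A d'.1) d'.1 d'.2) y.2.1
        (projCode (dirPrec r n₀) (d'.2 / 2 ^ (d'.1 - dirPrec r n₀)) n₀ (s + 2) z)
        (Encodable.encode [y.2.2]) ∧
      IsClose r y.2.2 (projDen (dirPrec r n₀) (r + 2))
        (projNum (dirPrec r n₀) (d'.2 / 2 ^ (d'.1 - dirPrec r n₀)) n₀ (r + 2) q)) := by
    intro q
    by_cases hq : q ∈ S
    · obtain ⟨⟨-, y, hy⟩, -, y', hy'⟩ := hS q hq
      exact ⟨(y, y'), fun _ => ⟨hy, hy'⟩⟩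
    · exact ⟨(([], 0), ([], 0)), fun h => absurd h hq⟩
  choose y hy using hex
  let code : List Bool → ℕ := fun π => ofBits (π ++ [true])
  have hcode : ∀ π : List Bool, π.length ≤ H → code π < 2 ^ (H + 1) := by
    intro π h
    refine (ofBits_lt _).trans_le (Nat.pow_le_pow_right two_pos ?_)
    simpa using h
  have hmain := Finset.card_le_mul_card_image_of_maps_to
    (s := S) (t := Finset.range (2 ^ (H + 1)) ×ˢ Finset.range (2 ^ (H + 1)))
    (f := fun q => (code (y q).1.1, code (y q).2.1)) (fun q hq => by
      exact Finset.mem_product.2 ⟨Finset.mem_range.2 (hcode _ (hy q hq).1.1),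
        Finset.mem_range.2 (hcode _ (hy q hq).2.1)⟩) (2 ^ (2 * t + 14)) ?_
  · rwa [Finset.card_product, Finset.card_range] at hmain
  · intro b _
    rcases (S.filter fun q => (code (y q).1.1, code (y q).2.1) = b).eq_empty_or_nonempty
      with he | ⟨q₁, hq₁⟩
    · rw [he]
      simp
    · obtain ⟨h1, h1'⟩ := Finset.mem_filter.1 hq₁
      have hgoal := encard_isClose_le (r := r) (n₀ := n₀) (m := (y q₁).1.2) (m' := (y q₁).2.2)
        (v := d.2 / 2 ^ (d.1 - dirPrec r n₀)) (v' := d'.2 / 2 ^ (d'.1 - dirPrec r n₀)) ht htg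
        (Nat.div_lt_of_lt_mul (by rwa [← pow_add, Nat.sub_add_cancel hg]))
        (Nat.div_lt_of_lt_mul (by rwa [← pow_add, Nat.sub_add_cancel hg']))
        (by rw [div_two_pow_div _ (by omega) hg, div_two_pow_div _ (by omega) hg']; exact hsep.1)
        (by rw [div_two_pow_div _ (by omega) hg, div_two_pow_div _ (by omega) hg']; exact hsep.2.1)
        (by rw [div_two_pow_div _ (by omega) hg, div_two_pow_div _ (by omega) hg']; exact hsep.2.2)
      rw [← Nat.cast_le (α := ℕ∞), ← Set.encard_coe_eq_coe_finsetCard]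
      refine (Set.encard_le_encard fun q hq => ?_).trans hgoal
      obtain ⟨h2, h2'⟩ := Finset.mem_filter.1 (Finset.mem_coe.1 hq)
      have he := Prod.ext_iff.1 (h2'.trans h1'.symm)
      have e1 : (y q).1.1 = (y q₁).1.1 := ofBits_append_true_injective he.1
      have e2 : (y q).2.1 = (y q₁).2.1 := ofBits_append_true_injective he.2
      have f1 := (hy q h2).1.2.1
      have f2 := (hy q h2).2.2.1
      rw [e1] at f1
      rw [e2] at f2
      have g1 := Encodable.encode_injective (U.runs_unique f1 (hy q₁ h1).1.2.1)
      have g2 := Encodable.encode_injective (U.runs_unique f2 (hy q₁ h1).2.2.1)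
      have k1 := (hy q h2).1.2.2
      have k2 := (hy q h2).2.2.2
      rw [(List.cons.inj g1).1] at k1
      rw [(List.cons.inj g2).1] at k2
      exact ⟨k1, k2⟩

/-- The simple grid points, given `z`, that are reached in the direction `d`. -/
def reached (U : OracleCode) (A : Set ℕ) (p : ℕ × ℕ × ℕ × ℕ) (N z : ℕ) (d : ℕ × ℕ) : Set ℕ :=
  {q | kN U A q z ≤ N ∧ Reaches U A p d z q}

/-- The truncations to `t` digits of directions in which at least `2 ^ m` simple grid points are
reached; the first and the last digit are prescribed. -/
def richDirs (U : OracleCode) (A : Set ℕ) (p : ℕ × ℕ × ℕ × ℕ) (N t m b₀ b₁ z : ℕ) : Set ℕ :=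
  {w | w % 2 = b₀ ∧ w / 2 ^ (t - 1) = b₁ ∧ ∃ d : ℕ × ℕ, (d.2 < 2 ^ d.1 ∧ d.2 / 2 ^ (d.1 - t) = w) ∧
    ((2 ^ m : ℕ) : ℕ∞) ≤ (reached U A p N z d).encard}

/-- If many directions reach many simple grid points, then the programs are long. -/
theorem le_of_card_richDirs {U : OracleCode} (hU : U.IsUniversal) {A : Set ℕ}
    {r s n₀ H t N l b₀ b₁ z : ℕ}
    (ht : 2 ≤ t) (htr : t ≤ r) (hl : l ≤ N)
    (hW : ((2 ^ (l + 2) : ℕ) : ℕ∞) ≤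
      (richDirs U A (r, s, n₀, H) N t (N - l) b₀ b₁ z).encard) :
    N ≤ 2 * H + 2 * t + 2 * l + 20 := by
  classical
  obtain ⟨W, hW1, hW2⟩ := exists_finset_of_le_encard hW
  have hex : ∀ w, ∃ d : ℕ × ℕ, ∃ S : Finset ℕ, w ∈ W → (d.2 < 2 ^ d.1 ∧ d.2 / 2 ^ (d.1 - t) = w) ∧
      ↑S ⊆ reached U A (r, s, n₀, H) N z d ∧ S.card = 2 ^ (N - l) := by
    intro w
    by_cases hw : w ∈ W
    · obtain ⟨-, -, d, hd, hc⟩ := hW1 hw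
      obtain ⟨S, hS⟩ := exists_finset_of_le_encard hc
      exact ⟨d, S, fun _ => ⟨hd, hS⟩⟩
    · exact ⟨(0, 0), ∅, fun h => absurd h hw⟩
  choose d S hdS using hex
  have hXle := encard_kN_le hU A z N
  have hXfin : {q | kN U A q z ≤ N}.Finite := by
    refine Set.finite_of_encard_le_coe (k := 2 ^ (N + 1)) ?_
    exact_mod_cast hXle
  have hX : hXfin.toFinset.card ≤ 2 ^ (N + 1) := by
    rw [hXfin.encard_eq_coe_toFinset_card] at hXle
    exact_mod_cast hXle
  have h := card_mul_le_of_card_inter_le W S (M := 2 ^ (N - l))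
    (k := 2 ^ (2 * t + 14) * (2 ^ (H + 1) * 2 ^ (H + 1))) hX
    (fun w hw q hq => hXfin.mem_toFinset.2 ((hdS w hw).2.1 hq).1)
    (fun w hw => (hdS w hw).2.2.ge) (fun w hw w' hw' hne => by
      refine card_le_of_reaches ht htr (hdS w hw).1.1 (hdS w' hw').1.1 ?_ fun q hq =>
        ⟨((hdS w hw).2.1 (Finset.mem_inter.1 hq).1).2,
          ((hdS w' hw').2.1 (Finset.mem_inter.1 hq).2).2⟩
      rw [(hdS w hw).1.2, (hdS w' hw').1.2]
      have c1 := hW1 hw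
      have c2 := hW1 hw'
      exact ⟨hne, c1.1.trans c2.1.symm, c1.2.1.trans c2.2.1.symm⟩)
  rw [hW2, ← pow_add, ← pow_add, ← pow_add, ← pow_mul, ← pow_add,
    show l + 2 + (N - l) = (N + 1) + 1 by omega, pow_succ 2 (N + 1)] at h
  have h2 : 2 ^ (N + 1) ≤ 2 ^ ((l + 2) * 2 + (2 * t + 14 + (H + 1 + (H + 1)))) := by omega
  have h3 := (Nat.pow_le_pow_iff_right (by norm_num : 1 < 2)).1 h2
  omega

theorem ce_reached {U : OracleCode} (hU : U.IsUniversal) :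
    CE fun B (y : (((ℕ × ℕ × ℕ × ℕ) × ℕ) × ℕ × (ℕ × ℕ)) × ℕ) =>
      y.2 ∈ reached U B y.1.1.1 y.1.1.2 y.1.2.1 y.1.2.2 := by
  have hz : Primrec fun y : (((ℕ × ℕ × ℕ × ℕ) × ℕ) × ℕ × (ℕ × ℕ)) × ℕ => y.1.2.1 :=
    Primrec.fst.comp (Primrec.snd.comp Primrec.fst)
  refine CE.and ((ce_kN_le hU).comp (f := fun y : (((ℕ × ℕ × ℕ × ℕ) × ℕ) × ℕ × (ℕ × ℕ)) × ℕ =>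
    (y.1.1.2, y.1.2.1, y.2)) ((Primrec.snd.comp (Primrec.fst.comp Primrec.fst)).pair
      (hz.pair Primrec.snd))) ?_
  exact (ce_reaches U).comp (f := fun y : (((ℕ × ℕ × ℕ × ℕ) × ℕ) × ℕ × (ℕ × ℕ)) × ℕ =>
    (y.1.1.1, y.1.2.2, y.1.2.1, y.2)) ((Primrec.fst.comp (Primrec.fst.comp Primrec.fst)).pair
      ((Primrec.snd.comp (Primrec.snd.comp Primrec.fst)).pair (hz.pair Primrec.snd)))

/-- If `q` is complex given `z` with the oracle of a direction in which it is reached, then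
many grid points are reached in that direction. -/
theorem exists_le_encard_reached {U : OracleCode} (hU : U.IsUniversal) :
    ∃ c : ℕ, ∀ (A : Set ℕ) (a : ℝ), 0 ≤ a → ∀ (p : ℕ × ℕ × ℕ × ℕ) (N m z q u₀ : ℕ),
      kN U A q z ≤ N → (∃ u, Reaches U A p (u, ⌊2 ^ u * a⌋₊) z q) →
      m + 2 * psize ((p, N), m) + c < kN U (join A (realOracle a)) q z →
      ∃ u, u₀ ≤ u ∧ ((2 ^ m : ℕ) : ℕ∞) ≤ (reached U A p N z (u, ⌊2 ^ u * a⌋₊)).encard := by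
  have hR : CE fun B (y : (((ℕ × ℕ × ℕ × ℕ) × ℕ) × ℕ) × ℕ) =>
      ∃ d : ℕ × ℕ, IsTrunc B d.1 d.2 ∧ y.2 ∈ reached U (leftPart B) y.1.1.1 y.1.1.2 y.1.2 d := by
    refine CE.exists (R := fun B (x : ((((ℕ × ℕ × ℕ × ℕ) × ℕ) × ℕ) × ℕ) × (ℕ × ℕ)) =>
      IsTrunc B x.2.1 x.2.2 ∧
        x.1.2 ∈ reached U (leftPart B) x.1.1.1.1 x.1.1.1.2 x.1.1.2 x.2) ?_
    refine CE.and (ce_isTrunc.comp Primrec.snd) ?_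
    exact (CE.leftPart (ce_reached hU)).comp
      (f := fun x : ((((ℕ × ℕ × ℕ × ℕ) × ℕ) × ℕ) × ℕ) × (ℕ × ℕ) =>
        ((x.1.1.1, x.1.1.2, x.2), x.1.2))
      (((Primrec.fst.comp (Primrec.fst.comp Primrec.fst)).pair
        ((Primrec.snd.comp (Primrec.fst.comp Primrec.fst)).pair Primrec.snd)).pair
        (Primrec.snd.comp Primrec.fst))
  obtain ⟨c, hc⟩ := exists_count_bound hU hR
  refine ⟨c, fun A a ha p N m z q u₀ hN hq hlt => ?_⟩
  set E := join A (realOracle a) with hE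
  have hmem : ∀ q', (∃ d : ℕ × ℕ, IsTrunc E d.1 d.2 ∧ q' ∈ reached U (leftPart E) p N z d) ↔
      ∃ u, q' ∈ reached U A p N z (u, ⌊2 ^ u * a⌋₊) := by
    intro q'
    rw [hE, leftPart_join]
    constructor
    · rintro ⟨d, hd, h⟩
      rw [isTrunc_withDir ha] at hd
      refine ⟨d.1, ?_⟩
      rwa [← hd]
    · rintro ⟨u, h⟩
      exact ⟨_, (isTrunc_withDir ha A u _).2 rfl, h⟩
  have h := hc E (p, N) z q m
  simp only [hmem] at h
  obtain ⟨u, hu⟩ := hq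
  have hle : ¬ {a' | ∃ u, a' ∈ reached U A p N z (u, ⌊2 ^ u * a⌋₊)}.encard ≤ 2 ^ m := by
    intro hle
    exact absurd (h ⟨u, hN, hu⟩ hle) (not_le.2 hlt)
  have hle' : ((2 ^ m : ℕ) : ℕ∞) ≤
      {a' | ∃ u, a' ∈ reached U A p N z (u, ⌊2 ^ u * a⌋₊)}.encard := by
    push_cast
    exact (not_le.1 hle).le
  obtain ⟨S, hS1, hS2⟩ := exists_finset_of_le_encard hle'
  have hex : ∀ q', ∃ u, q' ∈ S → q' ∈ reached U A p N z (u, ⌊2 ^ u * a⌋₊) := by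
    intro q'
    by_cases hq' : q' ∈ S
    · obtain ⟨u, hu⟩ := hS1 hq'
      exact ⟨u, fun _ => hu⟩
    · exact ⟨0, fun h => absurd h hq'⟩
  choose f hf using hex
  refine ⟨max u₀ (S.sup f), le_max_left _ _, ?_⟩
  rw [← hS2, ← Set.encard_coe_eq_coe_finsetCard]
  refine Set.encard_le_encard fun q' hq' => ⟨(hf q' hq').1, ?_⟩
  exact (hf q' hq').2.mono ha ((Finset.le_sup (f := f) hq').trans (le_max_right _ _))

/-- If the truncation of a direction is complex given `z`, then there are many other directions
in which as many simple grid points are reached. -/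
theorem exists_le_encard_richDirs {U : OracleCode} (hU : U.IsUniversal) :
    ∃ c : ℕ, ∀ (A : Set ℕ) (p : ℕ × ℕ × ℕ × ℕ) (N t m b₀ b₁ n z w : ℕ),
      w ∈ richDirs U A p N t m b₀ b₁ z →
      n + 2 * psize (((p, N), (t, m), (b₀, b₁)), n) + c < kN U A w z →
      ((2 ^ n : ℕ) : ℕ∞) ≤ (richDirs U A p N t m b₀ b₁ z).encard := by
  let α := ((ℕ × ℕ × ℕ × ℕ) × ℕ) × (ℕ × ℕ) × (ℕ × ℕ)
  have hpow : ∀ {β : Type} [Primcodable β] {f : β → ℕ}, Primrec f → Primrec fun x => 2 ^ f x :=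
    fun h => primrec_nat_pow (Primrec.const 2) h
  have hR : CE fun B (y : (α × ℕ) × ℕ) =>
      y.2 ∈ richDirs U B y.1.1.1.1 y.1.1.1.2 y.1.1.2.1.1 y.1.1.2.1.2 y.1.1.2.2.1 y.1.1.2.2.2
        y.1.2 := by
    have ht : Primrec fun y : (α × ℕ) × ℕ => y.1.1.2.1.1 := Primrec.fst.comp (Primrec.fst.comp
      (Primrec.snd.comp (Primrec.fst.comp Primrec.fst)))
    have hm : Primrec fun y : (α × ℕ) × ℕ => y.1.1.2.1.2 := Primrec.snd.comp (Primrec.fst.comp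
      (Primrec.snd.comp (Primrec.fst.comp Primrec.fst)))
    have hb : Primrec fun y : (α × ℕ) × ℕ => y.1.1.2.2 := Primrec.snd.comp
      (Primrec.snd.comp (Primrec.fst.comp Primrec.fst))
    refine CE.and (CE.of_primrecPred (Primrec.eq.comp
      (Primrec.nat_mod.comp Primrec.snd (Primrec.const 2)) (Primrec.fst.comp hb))) ?_
    refine CE.and (CE.of_primrecPred (Primrec.eq.comp
      (Primrec.nat_div.comp Primrec.snd (hpow (Primrec.nat_sub.comp ht (Primrec.const 1))))
      (Primrec.snd.comp hb))) ?_
    refine CE.exists (R := fun B (x : ((α × ℕ) × ℕ) × (ℕ × ℕ)) =>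
      (x.2.2 < 2 ^ x.2.1 ∧ x.2.2 / 2 ^ (x.2.1 - x.1.1.1.2.1.1) = x.1.2) ∧
      ((2 ^ x.1.1.1.2.1.2 : ℕ) : ℕ∞) ≤
        (reached U B x.1.1.1.1.1 x.1.1.1.1.2 x.1.1.2 x.2).encard) ?_
    refine CE.and (CE.of_primrecPred (PrimrecPred.and (Primrec.nat_lt.comp
      (Primrec.snd.comp Primrec.snd) (hpow (Primrec.fst.comp Primrec.snd))) (Primrec.eq.comp
      (Primrec.nat_div.comp (Primrec.snd.comp Primrec.snd) (hpow (Primrec.nat_sub.comp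
      (Primrec.fst.comp Primrec.snd) (ht.comp Primrec.fst)))) (Primrec.snd.comp Primrec.fst)))) ?_
    refine CE.le_encard (R := fun B (x : (((α × ℕ) × ℕ) × (ℕ × ℕ)) × ℕ) =>
      x.2 ∈ reached U B x.1.1.1.1.1.1 x.1.1.1.1.1.2 x.1.1.1.2 x.1.2) ?_
      (hpow (hm.comp Primrec.fst))
    exact (ce_reached hU).comp (f := fun x : (((α × ℕ) × ℕ) × (ℕ × ℕ)) × ℕ =>
      ((x.1.1.1.1.1, x.1.1.1.2, x.1.2), x.2))
      (((Primrec.fst.comp (Primrec.fst.comp (Primrec.fst.comp (Primrec.fst.comp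
        Primrec.fst)))).pair ((Primrec.snd.comp (Primrec.fst.comp (Primrec.fst.comp
        Primrec.fst))).pair (Primrec.snd.comp Primrec.fst))).pair Primrec.snd)
  obtain ⟨c, hc⟩ := exists_count_bound hU hR
  refine ⟨c, fun A p N t m b₀ b₁ n z w hw hlt => ?_⟩
  have h := hc A ((p, N), (t, m), (b₀, b₁)) z w n hw
  by_contra hcon
  rw [not_le] at hcon
  push_cast at hcon
  exact absurd (h hcon.le) (not_le.2 hlt)

/-! ### Complexity of a grid point given a coarser one -/

/-- The grid point that is obtained from `q` by omitting the last `j` binary digits of both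
coordinates. -/
def shift (j q : ℕ) : ℕ := Nat.pair (q.unpair.1 / 2 ^ j) (q.unpair.2 / 2 ^ j)

theorem primrec_shift : Primrec₂ shift := by
  have h : Primrec fun p : ℕ × ℕ => 2 ^ p.1 := primrec_nat_pow (Primrec.const 2) Primrec.fst
  have hu : Primrec fun p : ℕ × ℕ => p.2.unpair := Primrec.unpair.comp Primrec.snd
  exact Primrec₂.mk (Primrec₂.natPair.comp (Primrec.nat_div.comp (Primrec.fst.comp hu) h)
    (Primrec.nat_div.comp (Primrec.snd.comp hu) h))

/-- A transformation of the output, which may use a parameter and the condition. -/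
theorem exists_output_bound (hU : U.IsUniversal) {P : Type} [Primcodable P]
    {f : P × ℕ × ℕ → ℕ} (hf : Primrec f) :
    ∃ c : ℕ, ∀ B p a b, kN U B (f (p, a, b)) b ≤ kN U B a b + 2 * psize p + c := by
  obtain ⟨c, hc⟩ := exists_transform_bound hU (L := fun B => B) (fun _ h => h) hf
    (T := fun _ y => y.2.1 = y.2.2) (CE.of_primrecPred (Primrec.eq.comp
      (Primrec.fst.comp Primrec.snd) (Primrec.snd.comp Primrec.snd)))
    (fun _ _ _ _ _ h h' => h.symm.trans h')
  exact ⟨c, fun B p a b => hc B p a b b rfl⟩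

/-- A program that uses only one half of a join does not notice the other half. -/
theorem exists_join_bound (hU : U.IsUniversal) :
    ∃ c : ℕ, ∀ A C a b, kN U (join A C) a b ≤ kN U A a b + c := by
  obtain ⟨c, hc⟩ := exists_transform_bound hU (P := ℕ) (L := leftPart) (fun _ h => CE.leftPart h)
    (f := fun y => y.2.1) (Primrec.fst.comp Primrec.snd)
    (T := fun _ y => y.2.1 = y.2.2) (CE.of_primrecPred (Primrec.eq.comp
      (Primrec.fst.comp Primrec.snd) (Primrec.snd.comp Primrec.snd)))
    (fun _ _ _ _ _ h h' => h.symm.trans h')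
  refine ⟨2 * psize 0 + c, fun A C a b => ?_⟩
  have := hc (join A C) 0 a b b rfl
  rwa [leftPart_join, add_assoc] at this

/-- The oracle of a direction replaces the condition on its truncation. -/
theorem exists_trunc_bound (hU : U.IsUniversal) :
    ∃ c : ℕ, ∀ (A : Set ℕ) (a : ℝ), 0 ≤ a → ∀ (t z : ℕ),
      kN U (join A (realOracle a)) z 0 ≤ kN U A z ⌊2 ^ t * a⌋₊ + 2 * psize t + c := by
  obtain ⟨c, hc⟩ := exists_transform_bound hU (P := ℕ) (L := leftPart) (fun _ h => CE.leftPart h)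
    (f := fun y => y.2.1) (Primrec.fst.comp Primrec.snd)
    (T := fun B y => IsTrunc B y.1 y.2.2)
    (ce_isTrunc.comp (Primrec.fst.pair (Primrec.snd.comp Primrec.snd)))
    (fun _ _ _ _ _ h h' => h.unique h')
  refine ⟨c, fun A a ha t z => ?_⟩
  have := hc (join A (realOracle a)) t z 0 _ ((isTrunc_withDir ha A t _).2 rfl)
  rwa [leftPart_join] at this

/-- The oracle of a direction helps with `q` only by the amount `D`. Then, for a grid point `z`
with fewer digits than `q`, it helps with `q` given `z` by not much more, and `z` helps with the
truncations of the direction by not much more. -/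
theorem exists_oracle_bounds (hU : U.IsUniversal) :
    ∃ c : ℕ, ∀ (A : Set ℕ) (a : ℝ), 0 ≤ a → ∀ j t q D i : ℕ, j < 2 ^ i → t < 2 ^ i →
      kN U A (Nat.pair (shift j q) q) 0 < 2 ^ i →
      kN U A (Nat.pair ⌊2 ^ t * a⌋₊ (shift j q)) 0 < 2 ^ i →
      kN U A q 0 ≤ kN U (join A (realOracle a)) q 0 + D →
      kN U A q (shift j q) ≤ kN U (join A (realOracle a)) q (shift j q) + D + 14 * i + c ∧
      kN U A ⌊2 ^ t * a⌋₊ 0 ≤ kN U A ⌊2 ^ t * a⌋₊ (shift j q) + D + 28 * i + c := by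
  obtain ⟨c₁, h₁⟩ := exists_chain_lower hU
  obtain ⟨c₂, h₂⟩ := exists_output_bound hU (P := ℕ)
    (f := fun y => Nat.pair (shift y.1 y.2.1) y.2.1)
    (Primrec₂.natPair.comp (primrec_shift.comp Primrec.fst (Primrec.fst.comp Primrec.snd))
      (Primrec.fst.comp Primrec.snd))
  obtain ⟨c₃, h₃⟩ := exists_chain_upper hU (f := fun _ w => w) Primrec₂.right
  obtain ⟨c₄, h₄⟩ := exists_join_bound hU
  obtain ⟨c₅, h₅⟩ := exists_trunc_bound hU
  obtain ⟨c₆, h₆⟩ := exists_chain_upper hU (f := fun z w => Nat.pair w z)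
    (Primrec₂.natPair.comp Primrec.snd Primrec.fst)
  refine ⟨2 * c₁ + c₂ + c₃ + c₄ + c₅ + c₆, fun A a ha j t q D i hj ht hz hw hD => ?_⟩
  set z := shift j q with hz_def
  set w := ⌊2 ^ t * a⌋₊ with hw_def
  set E := join A (realOracle a)
  have e1 := h₁ A z q i hz
  have e2 := h₂ A j q 0
  dsimp only at e2
  rw [← hz_def] at e2
  have e3 := h₃ E z q 0
  have e4 : kN U E z 0 ≤ kN U A z 0 + c₄ := h₄ A (realOracle a) z 0
  have e4' : kN U E q z ≤ kN U A q z + c₄ := h₄ A (realOracle a) q z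
  have e5 : kN U E z 0 ≤ kN U A z w + 2 * psize t + c₅ := h₅ A a ha t z
  have e6 := h₆ A z w 0
  have e7 := h₁ A w z i hw
  have p1 := psize_nat_le hj
  have p2 := psize_nat_le ht
  constructor
  · omega
  · omega

/-- The heart of the argument: the complexity of `q` given `z` is at most about twice the length
of the programs that produce the projection of `q` from the projection of `z`. -/
theorem exists_core_bound (hU : U.IsUniversal) :
    ∃ c : ℕ, ∀ (A : Set ℕ) (a : ℝ), a ∈ Set.Ico (0 : ℝ) 1 → ∀ r s n₀ H t q D l i : ℕ,
      2 ≤ t → t ≤ r → r < 2 ^ i → s < 2 ^ i → n₀ < 2 ^ i → H < 2 ^ i → l + 2 < 2 ^ i →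
      kN U A q (shift (r - s) q) < 2 ^ i →
      kN U A (Nat.pair (shift (r - s) q) q) 0 < 2 ^ i →
      kN U A (Nat.pair ⌊2 ^ t * a⌋₊ (shift (r - s) q)) 0 < 2 ^ i →
      kN U A q 0 ≤ kN U (join A (realOracle a)) q 0 + D →
      (∃ u, Reaches U A (r, s, n₀, H) (u, ⌊2 ^ u * a⌋₊) (shift (r - s) q) q) →
      D + c * (i + 1) ≤ l → D + l + c * (i + 1) ≤ kN U A ⌊2 ^ t * a⌋₊ 0 →
      kN U A q (shift (r - s) q) ≤ 2 * H + 2 * t + 2 * l + 20 := by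
  obtain ⟨c₁, h₁⟩ := exists_oracle_bounds hU
  obtain ⟨c₂, h₂⟩ := exists_le_encard_reached hU
  obtain ⟨c₃, h₃⟩ := exists_le_encard_richDirs hU
  refine ⟨c₁ + c₂ + c₃ + 200, fun A a ha r s n₀ H t q D l i ht htr hr hs hn hH hl hN hzq hwz hD hq
    hDl hw => ?_⟩
  have hci : (c₁ + c₂ + c₃ + 200) * (i + 1) ≥ 200 * i + (c₁ + c₂ + c₃ + 200) := by
    rw [mul_add, mul_one]
    exact Nat.add_le_add_right (Nat.mul_le_mul_right i (by omega)) _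
  set z := shift (r - s) q with hz
  set N := kN U A q z with hN_def
  set w := ⌊2 ^ t * a⌋₊ with hw_def
  rcases Nat.lt_or_ge N l with hNl | hNl
  · omega
  have htr' : t < 2 ^ i := htr.trans_lt hr
  have hb := h₁ A a ha.1 (r - s) t q D i ((Nat.sub_le _ _).trans_lt hr) htr' hzq hwz hD
  rw [← hz, ← hN_def, ← hw_def] at hb
  obtain ⟨b1, b2⟩ := hb
  have hm : N - l < 2 ^ i := (Nat.sub_le _ _).trans_lt hN
  -- All parameters have codes with `O(i)` binary digits.
  have p1 : psize (n₀, H) ≤ 2 * i := psize_pair_le (psize_nat_le hn) (psize_nat_le hH)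
  have p2 : psize (s, n₀, H) ≤ 2 * (2 * i) :=
    psize_pair_le ((psize_nat_le hs).trans (by omega)) p1
  have p3 : psize (r, s, n₀, H) ≤ 2 * (2 * (2 * i)) :=
    psize_pair_le ((psize_nat_le hr).trans (by omega)) p2
  have p4 : psize ((r, s, n₀, H), N) ≤ 16 * i :=
    (psize_pair_le p3 ((psize_nat_le hN).trans (by omega))).trans (by omega)
  have p5 : psize (((r, s, n₀, H), N), N - l) ≤ 2 * (16 * i) :=
    psize_pair_le p4 ((psize_nat_le hm).trans (by omega))
  obtain ⟨u, hu, hcard⟩ := h₂ A a ha.1 (r, s, n₀, H) N (N - l) z q t le_rfl hq (by omega)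
  have hw2 : ∀ u : ℕ, ⌊2 ^ u * a⌋₊ < 2 ^ u := by
    intro u
    have hu0 : (0 : ℝ) < 2 ^ u := by positivity
    rw [Nat.floor_lt (mul_nonneg hu0.le ha.1)]
    push_cast
    nlinarith [ha.2]
  have hmem : w ∈ richDirs U A (r, s, n₀, H) N t (N - l) (w % 2) (w / 2 ^ (t - 1)) z :=
    ⟨rfl, rfl, (u, ⌊2 ^ u * a⌋₊), ⟨hw2 u, floor_two_pow_mul_div a hu⟩, hcard⟩
  have hi2 : 2 < 2 ^ i := by omega
  have hb0 : w % 2 < 2 ^ i := (Nat.mod_lt _ two_pos).trans hi2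
  have hb1 : w / 2 ^ (t - 1) < 2 ^ i := by
    refine lt_trans (Nat.div_lt_of_lt_mul ?_) hi2
    rw [← pow_succ, Nat.sub_add_cancel (by omega)]
    exact hw2 t
  have p6 : psize (t, N - l) ≤ 2 * i := psize_pair_le (psize_nat_le htr') (psize_nat_le hm)
  have p7 : psize (w % 2, w / 2 ^ (t - 1)) ≤ 2 * i :=
    psize_pair_le (psize_nat_le hb0) (psize_nat_le hb1)
  have p8 : psize ((t, N - l), (w % 2, w / 2 ^ (t - 1))) ≤ 16 * i :=
    (psize_pair_le p6 p7).trans (by omega)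
  have p9 : psize ((((r, s, n₀, H), N), (t, N - l), (w % 2, w / 2 ^ (t - 1))), l + 2) ≤
      2 * (2 * (16 * i)) :=
    psize_pair_le (psize_pair_le p4 p8) ((psize_nat_le hl).trans (by omega))
  exact le_of_card_richDirs hU ht htr hNl
    (h₃ A (r, s, n₀, H) N t (N - l) _ _ (l + 2) z w hmem (by omega))

/-! ### Complexity of points and of grid points -/

/-- The grid point of mesh `2 ^ (-ρ)` below `x`; the grid is shifted so that its coordinates are
natural numbers. -/
noncomputable def gridPt (ρ n₀ : ℕ) (x : EuclideanSpace ℝ (Fin 2)) : ℕ :=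
  Nat.pair ⌊2 ^ ρ * (x 0 + n₀)⌋₊ ⌊2 ^ ρ * (x 1 + n₀)⌋₊

theorem shift_gridPt {ρ ρ' : ℕ} (h : ρ ≤ ρ') (n₀ : ℕ) (x : EuclideanSpace ℝ (Fin 2)) :
    shift (ρ' - ρ) (gridPt ρ' n₀ x) = gridPt ρ n₀ x := by
  simp only [shift, gridPt, Nat.unpair_pair, floor_two_pow_mul_div _ h]

theorem abs_floor_div_sub_le {y : ℝ} {n₀ : ℕ} (ρ : ℕ) (hy : |y| + 2 ≤ n₀) :
    |(⌊2 ^ ρ * (y + n₀)⌋₊ : ℝ) / 2 ^ ρ - n₀ - y| ≤ (2 ^ ρ)⁻¹ := by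
  have h0 : (0 : ℝ) < 2 ^ ρ := by positivity
  have h1 : 0 ≤ y + n₀ := by linarith [neg_abs_le y]
  have h2 := Nat.floor_le (mul_nonneg h0.le h1)
  have h3 := Nat.lt_floor_add_one (2 ^ ρ * (y + n₀))
  have e : (⌊2 ^ ρ * (y + n₀)⌋₊ : ℝ) / 2 ^ ρ - n₀ - y =
      (⌊2 ^ ρ * (y + n₀)⌋₊ - 2 ^ ρ * (y + n₀)) * (2 ^ ρ)⁻¹ := by
    field_simp
    ring
  rw [e, abs_mul, abs_of_pos (inv_pos.2 h0)]
  refine mul_le_of_le_one_left (inv_pos.2 h0).le ?_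
  rw [abs_le]
  constructor <;> linarith

theorem abs_gridPt_fst_le {n₀ : ℕ} {x : EuclideanSpace ℝ (Fin 2)} (ρ : ℕ)
    (h : ∀ i, |x i| + 2 ≤ n₀) :
    |((gridPt ρ n₀ x).unpair.1 : ℝ) / 2 ^ ρ - n₀ - x 0| ≤ (2 ^ ρ)⁻¹ := by
  rw [gridPt, Nat.unpair_pair]
  exact abs_floor_div_sub_le ρ (h 0)

theorem abs_gridPt_snd_le {n₀ : ℕ} {x : EuclideanSpace ℝ (Fin 2)} (ρ : ℕ)
    (h : ∀ i, |x i| + 2 ≤ n₀) :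
    |((gridPt ρ n₀ x).unpair.2 : ℝ) / 2 ^ ρ - n₀ - x 1| ≤ (2 ^ ρ)⁻¹ := by
  rw [gridPt, Nat.unpair_pair]
  exact abs_floor_div_sub_le ρ (h 1)

theorem gridPt_lt {n₀ : ℕ} {x : EuclideanSpace ℝ (Fin 2)} (ρ : ℕ) (h : ∀ i, |x i| + 2 ≤ n₀) :
    gridPt ρ n₀ x < 2 ^ (2 * (ρ + 2 * n₀)) := by
  have key : ∀ i, ⌊2 ^ ρ * (x i + n₀)⌋₊ < 2 ^ (ρ + 2 * n₀) := by
    intro i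
    have h0 : (0 : ℝ) < 2 ^ ρ := by positivity
    have h1 : 0 ≤ x i + n₀ := by linarith [neg_abs_le (x i), h i]
    rw [Nat.floor_lt (mul_nonneg h0.le h1)]
    have h2 : x i + n₀ < ((2 * n₀ : ℕ) : ℝ) := by
      push_cast
      linarith [le_abs_self (x i), h i]
    have h3 : ((2 * n₀ : ℕ) : ℝ) < 2 ^ (2 * n₀) := by exact_mod_cast Nat.lt_two_pow_self
    push_cast
    rw [pow_add]
    exact mul_lt_mul_of_pos_left (h2.trans h3) h0
  calc gridPt ρ n₀ x < _ := Nat.pair_lt_max_add_one_sq _ _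
    _ ≤ (2 ^ (ρ + 2 * n₀)) ^ 2 := Nat.pow_le_pow_left (max_lt (key 0) (key 1)) 2
    _ = _ := by rw [← pow_mul]; ring_nf

/-- The grid point with natural coordinates `q` as a rational vector. -/
def gridVec (ρ n₀ q : ℕ) : Fin 2 → ℚ :=
  ![(((q.unpair.1 : ℤ) - (n₀ * 2 ^ ρ : ℕ) : ℤ) : ℚ) / (2 ^ ρ : ℕ),
    (((q.unpair.2 : ℤ) - (n₀ * 2 ^ ρ : ℕ) : ℤ) : ℚ) / (2 ^ ρ : ℕ)]

/-- The code of a grid point as a rational vector. -/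
def gridCode (ρ n₀ q : ℕ) : ℕ :=
  Encodable.encode [rcode (gridVec ρ n₀ q 0), rcode (gridVec ρ n₀ q 1)]

theorem ratCode_gridVec (ρ n₀ q : ℕ) : ratCode (gridVec ρ n₀ q) = (gridCode ρ n₀ q).bits :=
  ratCode_two _

theorem primrec_gridCode {α : Type*} [Primcodable α] {ρ n₀ q : α → ℕ} (hρ : Primrec ρ)
    (hn : Primrec n₀) (hq : Primrec q) : Primrec fun a => gridCode (ρ a) (n₀ a) (q a) := by
  have hp : Primrec fun a => 2 ^ ρ a := primrec_nat_pow (Primrec.const 2) hρ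
  have hc : PrimInt fun a => ((n₀ a * 2 ^ ρ a : ℕ) : ℤ) :=
    PrimInt.of_primrec (Primrec.nat_mul.comp hn hp)
  have hu : Primrec fun a => (q a).unpair := Primrec.unpair.comp hq
  have hpos : ∀ a, 2 ^ ρ a ≠ 0 := fun a => by positivity
  exact primrec_encode_list_two.comp
    ((primrec_rcode ((PrimInt.of_primrec (Primrec.fst.comp hu)).sub hc) hp hpos).pair
      (primrec_rcode ((PrimInt.of_primrec (Primrec.snd.comp hu)).sub hc) hp hpos))

theorem gridVec_mem_ball {n₀ : ℕ} {x : EuclideanSpace ℝ (Fin 2)} (r : ℕ)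
    (h : ∀ i, |x i| + 2 ≤ n₀) :
    ratPoint (gridVec (r + 2) n₀ (gridPt (r + 2) n₀ x)) ∈ Metric.ball x ((2 : ℝ)⁻¹ ^ r) := by
  have h0 := abs_gridPt_fst_le (r + 2) h
  have h1 := abs_gridPt_snd_le (r + 2) h
  have hp : (0 : ℝ) < 2 ^ (r + 2) := by positivity
  have hR : (2 : ℝ)⁻¹ ^ r = 4 * (2 ^ (r + 2))⁻¹ := by
    rw [inv_pow, pow_add]
    field_simp
    norm_num
  have hη : (0 : ℝ) < (2 ^ (r + 2))⁻¹ := by positivity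
  have e0 : (ratPoint (gridVec (r + 2) n₀ (gridPt (r + 2) n₀ x)) 0 : ℝ) =
      ((gridPt (r + 2) n₀ x).unpair.1 : ℝ) / 2 ^ (r + 2) - n₀ := by
    simp only [ratPoint, gridVec, Matrix.cons_val_zero]
    push_cast
    field_simp
  have e1 : (ratPoint (gridVec (r + 2) n₀ (gridPt (r + 2) n₀ x)) 1 : ℝ) =
      ((gridPt (r + 2) n₀ x).unpair.2 : ℝ) / 2 ^ (r + 2) - n₀ := by
    simp only [ratPoint, gridVec, Matrix.cons_val_one]
    push_cast
    field_simp
  rw [Metric.mem_ball, EuclideanSpace.dist_eq, Fin.sum_univ_two, Real.dist_eq, Real.dist_eq, e0, e1,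
    hR, Real.sqrt_lt' (by positivity)]
  have s0 := pow_le_pow_left₀ (abs_nonneg _) h0 2
  have s1 := pow_le_pow_left₀ (abs_nonneg _) h1 2
  nlinarith

/-- The coordinate, on the grid of mesh `2 ^ (-ρ)`, of the rational number with code `m`, with a
correction by `c - 8`. The natural number `c` encodes a correction of either sign. -/
def snapCoord (ρ n₀ c m : ℕ) : ℕ :=
  (rnum m + (n₀ * rden m : ℕ)).toNat * 2 ^ ρ / rden m + c - 8

theorem snapCoord_rcode {y : ℚ} {ρ n₀ c : ℕ} (hy : 0 ≤ y + n₀) :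
    snapCoord ρ n₀ c (rcode y) = ⌊2 ^ ρ * ((y : ℝ) + n₀)⌋₊ + c - 8 := by
  have hd : (0 : ℝ) < y.den := by exact_mod_cast y.den_pos
  have e : (y : ℝ) = (y.num : ℝ) / y.den := by exact_mod_cast (Rat.num_div_den y).symm
  have hq : y = (y.num : ℚ) / y.den := (Rat.num_div_den y).symm
  have h0 : 0 ≤ y.num + ((n₀ * y.den : ℕ) : ℤ) := by
    have hd' : (0 : ℚ) < y.den := by exact_mod_cast y.den_pos
    have h1 : 0 ≤ (y.num : ℚ) + n₀ * y.den := by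
      have h2 := mul_nonneg hy hd'.le
      have h3 : y * y.den = y.num := Rat.mul_den_eq_num y
      nlinarith
    have h4 : (0 : ℚ) ≤ ((y.num + ((n₀ * y.den : ℕ) : ℤ) : ℤ) : ℚ) := by
      push_cast
      exact h1
    exact_mod_cast h4
  have hnat : (((y.num + ((n₀ * y.den : ℕ) : ℤ)).toNat : ℕ) : ℝ) = y.num + n₀ * y.den := by
    have h1 : (((y.num + ((n₀ * y.den : ℕ) : ℤ)).toNat : ℤ) : ℝ) = _ :=
      congrArg _ (Int.toNat_of_nonneg h0)
    push_cast at h1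
    exact_mod_cast h1
  have e2 : 2 ^ ρ * ((y : ℝ) + n₀) =
      (((y.num + ((n₀ * y.den : ℕ) : ℤ)).toNat * 2 ^ ρ : ℕ) : ℝ) / y.den := by
    rw [Nat.cast_mul, hnat, e]
    push_cast
    field_simp
  rw [snapCoord, rnum_rcode, rden_rcode, e2, Nat.floor_div_eq_div]

/-- A rational number at distance less than `2 ^ (-s)` from `x` is off by at most five steps of the
grid of mesh `2 ^ (-(s + 2))`, so that a correction with boundedly many values leads from it to the
grid point of `x`. -/
theorem exists_snapCoord {y : ℚ} {x : ℝ} {s n₀ : ℕ} (hx : |x| + 2 ≤ n₀)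
    (hy : |(y : ℝ) - x| < (2 : ℝ)⁻¹ ^ s) :
    ∃ c, c < 16 ∧ snapCoord (s + 2) n₀ c (rcode y) = ⌊2 ^ (s + 2) * (x + n₀)⌋₊ := by
  have h1 : (2 : ℝ)⁻¹ ^ s ≤ 1 := pow_le_one₀ (by norm_num) (by norm_num)
  have hp : (0 : ℝ) < 2 ^ (s + 2) := by positivity
  obtain ⟨g1, g2⟩ := abs_lt.1 hy
  have hxn : 1 ≤ x + n₀ := by linarith [neg_abs_le x]
  have hyn : (0 : ℝ) ≤ y + n₀ := by linarith
  have h4 : (2 : ℝ) ^ (s + 2) * (2 : ℝ)⁻¹ ^ s = 4 := by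
    rw [inv_pow, pow_add]
    field_simp
    norm_num
  have d1 : 2 ^ (s + 2) * ((y : ℝ) + n₀) < 2 ^ (s + 2) * (x + n₀) + 4 := by nlinarith
  have d2 : 2 ^ (s + 2) * (x + n₀) < 2 ^ (s + 2) * ((y : ℝ) + n₀) + 4 := by nlinarith
  set F := ⌊2 ^ (s + 2) * ((y : ℝ) + n₀)⌋₊ with hF
  set G := ⌊2 ^ (s + 2) * (x + n₀)⌋₊ with hG
  have f1 : (F : ℝ) ≤ 2 ^ (s + 2) * ((y : ℝ) + n₀) := Nat.floor_le (by positivity)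
  have f2 : 2 ^ (s + 2) * ((y : ℝ) + n₀) < F + 1 := Nat.lt_floor_add_one _
  have f3 : (G : ℝ) ≤ 2 ^ (s + 2) * (x + n₀) := Nat.floor_le (by positivity)
  have f4 : 2 ^ (s + 2) * (x + n₀) < G + 1 := Nat.lt_floor_add_one _
  have k1 : (F : ℝ) < ((G + 5 : ℕ) : ℝ) := by push_cast; linarith
  have k2 : (G : ℝ) < ((F + 5 : ℕ) : ℝ) := by push_cast; linarith
  rw [Nat.cast_lt] at k1 k2
  refine ⟨G + 8 - F, by omega, ?_⟩
  rw [snapCoord_rcode (by exact_mod_cast hyn), ← hF]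
  omega

/-- The grid point near the rational vector with code `b`, with corrections. -/
def snap (p : (ℕ × ℕ) × ℕ × ℕ) (b : ℕ) : ℕ :=
  Nat.pair (snapCoord p.1.1 p.1.2 p.2.1 (entry 0 b)) (snapCoord p.1.1 p.1.2 p.2.2 (entry 1 b))

section

variable {α : Type*} [Primcodable α]

theorem primrec_snapCoord {ρ n₀ c m : α → ℕ} (hρ : Primrec ρ) (hn : Primrec n₀) (hc : Primrec c)
    (hm : Primrec m) : Primrec fun a => snapCoord (ρ a) (n₀ a) (c a) (m a) := by
  have h1 : PrimInt fun a => rnum (m a) + (n₀ a * rden (m a) : ℕ) :=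
    (primInt_rnum.comp hm).add (PrimInt.of_primrec (Primrec.nat_mul.comp hn (primrec_rden.comp hm)))
  have h2 := Primrec.nat_mul.comp h1.toNat (primrec_nat_pow (Primrec.const 2) hρ)
  have h3 := Primrec.nat_add.comp (Primrec.nat_div.comp h2 (primrec_rden.comp hm)) hc
  exact Primrec.nat_sub.comp h3 (Primrec.const 8)

theorem primrec_snap {p : α → (ℕ × ℕ) × ℕ × ℕ} {b : α → ℕ} (hp : Primrec p) (hb : Primrec b) :
    Primrec fun a => snap (p a) (b a) := by
  have h1 : Primrec fun a => (p a).1 := Primrec.fst.comp hp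
  have h2 : Primrec fun a => (p a).2 := Primrec.snd.comp hp
  exact Primrec₂.natPair.comp
    (primrec_snapCoord (Primrec.fst.comp h1) (Primrec.snd.comp h1) (Primrec.fst.comp h2)
      ((primrec_entry 0).comp hb))
    (primrec_snapCoord (Primrec.fst.comp h1) (Primrec.snd.comp h1) (Primrec.snd.comp h2)
      ((primrec_entry 1).comp hb))

end

theorem exists_snap {y : Fin 2 → ℚ} {x : EuclideanSpace ℝ (Fin 2)} {s n₀ : ℕ}
    (hx : ∀ i, |x i| + 2 ≤ n₀) (hy : ratPoint y ∈ Metric.ball x ((2 : ℝ)⁻¹ ^ s)) :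
    ∃ c₀ c₁ b, c₀ < 16 ∧ c₁ < 16 ∧ ratCode y = Nat.bits b ∧
      snap ((s + 2, n₀), c₀, c₁) b = gridPt (s + 2) n₀ x := by
  have hc : ∀ i, |(y i : ℝ) - x i| < (2 : ℝ)⁻¹ ^ s := by
    intro i
    rw [Metric.mem_ball, dist_eq_norm] at hy
    exact (PiLp.norm_apply_le (ratPoint y - x) i).trans_lt hy
  obtain ⟨c₀, h0, e0⟩ := exists_snapCoord (hx 0) (hc 0)
  obtain ⟨c₁, h1, e1⟩ := exists_snapCoord (hx 1) (hc 1)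
  refine ⟨c₀, c₁, _, h0, h1, ratCode_two y, ?_⟩
  rw [snap, entry_encode, entry_encode]
  simp only [List.getElem?_cons_zero, List.getElem?_cons_succ, Option.getD_some]
  rw [e0, e1, gridPt]

theorem nil_eq_bits : ([] : List Bool) = Nat.bits 0 := Nat.zero_bits.symm

/-- The grid point below `x` is in the ball around `x`. -/
theorem exists_Kr_le (hU : U.IsUniversal) :
    ∃ c : ℕ, ∀ (A : Set ℕ) (r n₀ i : ℕ) (x : EuclideanSpace ℝ (Fin 2)), (∀ j, |x j| + 2 ≤ n₀) →
      r + 2 < 2 ^ i → n₀ < 2 ^ i →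
      Kr U A r x ≤ ((kN U A (gridPt (r + 2) n₀ x) 0 + 4 * i + c : ℕ) : ℕ∞) := by
  obtain ⟨c, hc⟩ := exists_output_bound hU (P := ℕ × ℕ)
    (f := fun y => gridCode y.1.1 y.1.2 y.2.1)
    (primrec_gridCode (Primrec.fst.comp Primrec.fst) (Primrec.snd.comp Primrec.fst)
      (Primrec.fst.comp Primrec.snd))
  refine ⟨c, fun A r n₀ i x hx hr hn => ?_⟩
  refine (iInf₂_le (gridVec (r + 2) n₀ (gridPt (r + 2) n₀ x)) (gridVec_mem_ball r hx)).trans ?_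
  rw [ratCode_gridVec, nil_eq_bits, K_eq_kN hU]
  have h := hc A (r + 2, n₀) (gridPt (r + 2) n₀ x) 0
  have h2 := psize_pair_le (psize_nat_le hr) (psize_nat_le hn)
  dsimp only at h
  exact_mod_cast (by omega : _ ≤ _)

theorem psize_corrections {p : ℕ × ℕ} {c₀ c₁ i : ℕ} (hp : psize p ≤ 2 * i) (h0 : c₀ < 16)
    (h1 : c₁ < 16) (hi : 4 ≤ i) : psize (p, c₀, c₁) ≤ 4 * i := by
  have h16 : 16 ≤ 2 ^ i := le_trans (by norm_num : 16 ≤ 2 ^ 4) (Nat.pow_le_pow_right two_pos hi)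
  exact (psize_pair_le hp (psize_pair_le (psize_nat_le (h0.trans_le h16))
    (psize_nat_le (h1.trans_le h16)))).trans (by omega)

/-- From any rational point in the ball around `x` the grid point is found with a bounded
correction. -/
theorem exists_le_Kr (hU : U.IsUniversal) :
    ∃ c : ℕ, ∀ (A : Set ℕ) (r n₀ i : ℕ) (x : EuclideanSpace ℝ (Fin 2)), (∀ j, |x j| + 2 ≤ n₀) →
      r + 2 < 2 ^ i → n₀ < 2 ^ i → 4 ≤ i →
      (kN U A (gridPt (r + 2) n₀ x) 0 : ℕ∞) ≤ Kr U A r x + (8 * i + c : ℕ) := by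
  obtain ⟨c, hc⟩ := exists_output_bound hU (P := (ℕ × ℕ) × ℕ × ℕ)
    (f := fun y => snap y.1 y.2.1)
    (primrec_snap Primrec.fst (Primrec.fst.comp Primrec.snd))
  refine ⟨c, fun A r n₀ i x hx hr hn hi => ?_⟩
  rw [Kr, KSet, ENat.iInf_add]
  refine le_iInf fun y => ?_
  by_cases hy : ratPoint y ∈ Metric.ball x ((2 : ℝ)⁻¹ ^ r)
  · obtain ⟨c₀, c₁, b, h0, h1, hb, hs⟩ := exists_snap hx hy
    rw [iInf_pos hy, hb, nil_eq_bits, K_eq_kN hU, ← hs]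
    have h := hc A ((r + 2, n₀), c₀, c₁) b 0
    have h2 := psize_corrections (psize_pair_le (psize_nat_le hr) (psize_nat_le hn)) h0 h1 hi
    dsimp only at h
    exact_mod_cast (by omega : _ ≤ _)
  · rw [iInf_neg hy, top_add]
    exact le_top

/-- With the grid point of `x` as an output and as a condition, the maximum over the rational
conditions near `x` disappears, because all of them yield the same grid point. -/
theorem exists_Krs_le (hU : U.IsUniversal) :
    ∃ c : ℕ, ∀ (A : Set ℕ) (r s n₀ i : ℕ) (x : EuclideanSpace ℝ (Fin 2)),
      (∀ j, |x j| + 2 ≤ n₀) → r + 2 < 2 ^ i → s + 2 < 2 ^ i → n₀ < 2 ^ i → 4 ≤ i →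
      Krs U A r s x x ≤
        ((kN U A (gridPt (r + 2) n₀ x) (gridPt (s + 2) n₀ x) + 16 * i + c : ℕ) : ℕ∞) := by
  obtain ⟨c, hc⟩ := exists_transform_bound hU (P := ℕ × (ℕ × ℕ) × ℕ × ℕ) (L := fun B => B)
    (fun _ h => h) (f := fun y => gridCode y.1.1 y.1.2.1.2 y.2.1)
    (primrec_gridCode (Primrec.fst.comp Primrec.fst) (Primrec.snd.comp (Primrec.fst.comp
      (Primrec.snd.comp Primrec.fst))) (Primrec.fst.comp Primrec.snd))
    (T := fun _ y => snap y.1.2 y.2.1 = y.2.2) (CE.of_primrecPred (Primrec.eq.comp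
      (primrec_snap (Primrec.snd.comp Primrec.fst) (Primrec.fst.comp Primrec.snd))
      (Primrec.snd.comp Primrec.snd)))
    (fun _ _ _ _ _ h h' => h.symm.trans h')
  refine ⟨c, fun A r s n₀ i x hx hr hs hn hi => iSup₂_le fun y hy => ?_⟩
  obtain ⟨c₀, c₁, b, h0, h1, hb, hsn⟩ := exists_snap hx hy
  refine (iInf₂_le (gridVec (r + 2) n₀ (gridPt (r + 2) n₀ x)) (gridVec_mem_ball r hx)).trans ?_
  rw [ratCode_gridVec, hb, K_eq_kN hU]
  have h : kN U A (gridCode (r + 2) n₀ (gridPt (r + 2) n₀ x)) b ≤ _ :=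
    hc A (r + 2, (s + 2, n₀), c₀, c₁) (gridPt (r + 2) n₀ x) b (gridPt (s + 2) n₀ x) hsn
  have h2 := psize_corrections (psize_pair_le (psize_nat_le hs) (psize_nat_le hn)) h0 h1 hi
  have h3 := psize_pair_le ((psize_nat_le hr).trans (by omega)) h2
  exact_mod_cast (by omega : _ ≤ _)

/-- At a precision not above that of the condition, nothing has to be computed. -/
theorem exists_Krs_le_const (hU : U.IsUniversal) :
    ∃ c : ℕ, ∀ (A : Set ℕ) (r s : ℕ) (x : EuclideanSpace ℝ (Fin 2)), r ≤ s →
      Krs U A r s x x ≤ (c : ℕ∞) := by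
  have hR : CE fun (_ : Set ℕ) (p : List Bool × ℕ × ℕ) => p.1 = [] ∧ p.2.2 = p.2.1 :=
    CE.of_primrecPred (PrimrecPred.and (Primrec.eq.comp Primrec.fst (Primrec.const []))
      (Primrec.eq.comp (Primrec.snd.comp Primrec.snd) (Primrec.fst.comp Primrec.snd)))
  obtain ⟨c, hc⟩ := exists_machine_bound hU hR fun _ π π' b a a' h h' _ =>
    ⟨h.1.trans h'.1.symm, h.2.trans h'.2.symm⟩
  refine ⟨c, fun A r s x hrs => iSup₂_le fun y hy => ?_⟩
  have hy' : ratPoint y ∈ Metric.ball x ((2 : ℝ)⁻¹ ^ r) :=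
    Metric.ball_subset_ball (pow_le_pow_of_le_one (by norm_num) (by norm_num) hrs) hy
  refine (iInf₂_le y hy').trans ?_
  rw [ratCode_two, K_eq_kN hU]
  have := hc A [] (Encodable.encode [rcode (y 0), rcode (y 1)]) _ ⟨rfl, rfl⟩
  rw [List.length_nil, zero_add] at this
  exact_mod_cast this

/-- The self-delimiting code of a number is a description, which gives a crude upper bound. -/
theorem exists_kN_le (hU : U.IsUniversal) :
    ∃ c : ℕ, ∀ (A : Set ℕ) (a b j : ℕ), a < 2 ^ j → kN U A a b ≤ 2 * j + c := by
  have hR : CE fun (_ : Set ℕ) (p : List Bool × ℕ × ℕ) => p.1 = header p.2.2 :=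
    CE.of_primrecPred (Primrec.eq.comp Primrec.fst
      (primrec_header.comp (Primrec.snd.comp Primrec.snd)))
  obtain ⟨c, hc⟩ := exists_machine_bound hU hR fun _ π π' _ a a' h h' hp => by
    have := header_prefix (p := a) (p' := a') (x := []) (y := []) (by simpa [← h, ← h'] using hp)
    exact ⟨h.trans ((congrArg header this.1).trans h'.symm), this.1⟩
  refine ⟨c + 1, fun A a b j ha => ?_⟩
  have h := hc A (header a) b a rfl
  rw [length_header] at h
  have := psize_nat_le ha
  omega

theorem exists_Kr_dirPoint_le (hU : U.IsUniversal) :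
    ∃ c : ℕ, ∀ (A : Set ℕ) (e : EuclideanSpace ℝ (Fin 2)) (t i : ℕ), 0 ≤ angle e → t < 2 ^ i →
      Kr U A t (dirPoint e) ≤ ((kN U A ⌊2 ^ t * angle e⌋₊ 0 + 2 * i + c : ℕ) : ℕ∞) := by
  obtain ⟨c, hc⟩ := exists_output_bound hU (P := ℕ)
    (f := fun y => Encodable.encode [rcode (((y.2.1 : ℤ) : ℚ) / (2 ^ y.1 : ℕ))])
    (primrec_encode_list_one.comp (primrec_rcode
      (PrimInt.of_primrec (Primrec.fst.comp Primrec.snd))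
      (primrec_nat_pow (Primrec.const 2) Primrec.fst) fun _ => by positivity))
  refine ⟨c, fun A e t i he ht => ?_⟩
  set v := ⌊2 ^ t * angle e⌋₊ with hv
  have hp : (0 : ℝ) < 2 ^ t := by positivity
  let y : Fin 1 → ℚ := fun _ => ((v : ℤ) : ℚ) / (2 ^ t : ℕ)
  have hy : ratPoint y ∈ Metric.ball (dirPoint e) ((2 : ℝ)⁻¹ ^ t) := by
    have e1 : (ratPoint y 0 : ℝ) = v / 2 ^ t := by
      simp [ratPoint, y]
    have e2 : dirPoint e 0 = angle e := by simp [dirPoint]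
    have h1 : (v : ℝ) ≤ 2 ^ t * angle e := Nat.floor_le (by positivity)
    have h2 : 2 ^ t * angle e < v + 1 := Nat.lt_floor_add_one _
    rw [Metric.mem_ball, EuclideanSpace.dist_eq, Fin.sum_univ_one, Real.sqrt_sq dist_nonneg,
      Real.dist_eq, e1, e2, inv_pow, abs_lt]
    have e3 : (v : ℝ) / 2 ^ t - angle e = (v - 2 ^ t * angle e) * (2 ^ t)⁻¹ := by
      field_simp
    have hi : (0 : ℝ) < (2 ^ t)⁻¹ := by positivity
    rw [e3]
    constructor <;> nlinarith
  refine (iInf₂_le y hy).trans ?_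
  rw [ratCode_one, nil_eq_bits, K_eq_kN hU]
  have h := hc A t v 0
  have h2 := psize_nat_le ht
  have h3 : kN U A (Encodable.encode [rcode (y 0)]) 0 ≤ kN U A v 0 + 2 * psize t + c := h
  exact_mod_cast (by omega : _ ≤ _)

theorem inner_eq_of_angle {e : EuclideanSpace ℝ (Fin 2)} (he : e ∈ Metric.sphere 0 1)
    (x : EuclideanSpace ℝ (Fin 2)) :
    inner ℝ e x = Real.cos (2 * Real.pi * angle e) * x 0 +
      Real.sin (2 * Real.pi * angle e) * x 1 := by
  have h := (angle_spec e he).2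
  have h0 : e 0 = Real.cos (2 * Real.pi * angle e) := by
    conv_lhs => rw [h]
    simp
  have h1 : e 1 = Real.sin (2 * Real.pi * angle e) := by
    conv_lhs => rw [h]
    simp
  rw [PiLp.inner_apply, Fin.sum_univ_two, ← h0, ← h1]
  simp [mul_comm]

theorem mem_ball_one_iff {y : Fin 1 → ℚ} {p R : ℝ} :
    ratPoint y ∈ Metric.ball (!₂[p] : EuclideanSpace ℝ (Fin 1)) R ↔ |(y 0 : ℝ) - p| < R := by
  rw [Metric.mem_ball, EuclideanSpace.dist_eq, Fin.sum_univ_one, Real.sqrt_sq dist_nonneg,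
    Real.dist_eq]
  simp [ratPoint]

/-- If the projection of `x` is simple given the projection of `x` at a lower precision, then the
grid point near `x` is reached in the direction of the projection. -/
theorem exists_reaches (hU : U.IsUniversal) {A : Set ℕ} {e x : EuclideanSpace ℝ (Fin 2)}
    (he : e ∈ Metric.sphere 0 1) {r s n₀ H : ℕ} (hx : ∀ i, |x i| + 2 ≤ n₀) (hsr : s ≤ r)
    (hH : Krs U (withDir A e) r s (proj e x) (proj e x) ≤ (H : ℕ∞)) :
    ∃ u, Reaches U A (r, s, n₀, H) (u, ⌊2 ^ u * angle e⌋₊) (gridPt (s + 2) n₀ x)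
      (gridPt (r + 2) n₀ x) := by
  have ha := (angle_spec e he).1
  set a := angle e with ha_def
  set g := dirPrec r n₀ with hg
  set w := ⌊2 ^ g * a⌋₊ with hw
  set z := gridPt (s + 2) n₀ x with hz
  set q := gridPt (r + 2) n₀ x with hq
  have hin := inner_eq_of_angle he x
  have hs := abs_projNum_sub_le (r := r) ha (hx 0) (hx 1) (abs_gridPt_fst_le (s + 2) hx)
    (abs_gridPt_snd_le (s + 2) hx)
  have hr := abs_projNum_sub_le (r := r) ha (hx 0) (hx 1) (abs_gridPt_fst_le (r + 2) hx)
    (abs_gridPt_snd_le (r + 2) hx)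
  rw [← hin, ← hg, ← hw] at hs hr
  rw [← hz] at hs
  rw [← hq] at hr
  have i1 : ((2 : ℝ) ^ (s + 2))⁻¹ = (2 ^ s)⁻¹ / 4 := by rw [pow_add]; field_simp; norm_num
  have i2 : ((2 : ℝ) ^ (r + 2))⁻¹ = (2 ^ r)⁻¹ / 4 := by rw [pow_add]; field_simp; norm_num
  have i3 : ((2 : ℝ) ^ r)⁻¹ ≤ (2 ^ s)⁻¹ := by
    gcongr
    norm_num
  have i4 : (0 : ℝ) < (2 ^ r)⁻¹ := by positivity
  rw [i1] at hs
  rw [i2] at hr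
  let Y : Fin 1 → ℚ := fun _ => (projNum g w n₀ (s + 2) z : ℚ) / projDen g (s + 2)
  have hY : ratPoint Y ∈ Metric.ball (proj e x) ((2 : ℝ)⁻¹ ^ s) := by
    rw [proj, mem_ball_one_iff, inv_pow]
    refine lt_of_le_of_lt ?_ (by linarith : 2 * ((2 ^ s)⁻¹ / 4) + (2 ^ r)⁻¹ / 8 < ((2 : ℝ) ^ s)⁻¹)
    simpa [Y] using hs
  have hK : KSet U (withDir A e) (Metric.ball (proj e x) ((2 : ℝ)⁻¹ ^ r)) (ratCode Y) <
      (H + 1 : ℕ) := by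
    refine lt_of_le_of_lt ((le_iSup₂ (f := fun (q : Fin 1 → ℚ)
      (_ : ratPoint q ∈ Metric.ball (proj e x) ((2 : ℝ)⁻¹ ^ s)) =>
        KSet U (withDir A e) (Metric.ball (proj e x) ((2 : ℝ)⁻¹ ^ r)) (ratCode q)) Y hY).trans hH)
        ?_
    exact_mod_cast Nat.lt_succ_self H
  obtain ⟨y, hy⟩ := iInf_lt_iff.1 hK
  obtain ⟨hyb, hyK⟩ := iInf_lt_iff.1 hy
  rw [ratCode_one, ratCode_one, K_eq_kN hU, Nat.cast_lt, Nat.lt_succ_iff] at hyK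
  obtain ⟨π, hπ, hrun⟩ := (kN_le_iff hU).1 hyK
  obtain ⟨k, hk⟩ := (U.mem_run_iff _ _ _ _).1 hrun
  refine ⟨max g k, le_max_left _ _, (π, rcode (y 0)), hπ, ?_, ?_⟩
  · have h1 := U.runs_mono (pre_prefix _ (le_max_right g k)) hk
    rw [withDir, pre_join_realOracle A ha.1] at h1
    dsimp only
    rw [floor_two_pow_mul_div _ (le_max_left g k)]
    exact h1
  · dsimp only
    rw [floor_two_pow_mul_div _ (le_max_left g k)]
    refine isClose_of_abs_sub_le (projDen_pos _ _) (by rw [rden_rcode]; exact (y 0).den_pos) ?_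
    have hy0 : ((y 0 : ℚ) : ℝ) = ((y 0).num : ℝ) / (y 0).den := by
      exact_mod_cast (Rat.num_div_den (y 0)).symm
    rw [rnum_rcode, rden_rcode, ← hy0]
    rw [proj, mem_ball_one_iff, inv_pow] at hyb
    have h2 : |(y 0 : ℝ) - (projNum g w n₀ (r + 2) q : ℝ) / projDen g (r + 2)| ≤
        (2 ^ r)⁻¹ + (2 * ((2 ^ r)⁻¹ / 4) + (2 ^ r)⁻¹ / 8) := by
      refine (abs_sub_le _ (inner ℝ e x) _).trans (add_le_add hyb.le ?_)
      rw [abs_sub_comm]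
      exact hr
    refine h2.trans ?_
    rw [div_eq_mul_inv (2 : ℝ)]
    linarith

/-! ### Asymptotic estimates -/

theorem sq_le_four_mul_two_pow (m : ℕ) : m ^ 2 ≤ 4 * 2 ^ m := by
  induction m with
  | zero => norm_num
  | succ m ih =>
    rcases Nat.lt_or_ge m 3 with h | h
    · interval_cases m <;> norm_num
    · rw [pow_succ 2 m]
      nlinarith

/-- Terms of logarithmic size are absorbed by a linear term. -/
theorem exists_size_le (C K : ℕ) {η : ℝ} (hη : 0 < η) :
    ∃ R : ℕ, ∀ r : ℕ, R ≤ r → (K : ℝ) * (Nat.size (C * (r + 1)) + 1) ≤ η * r := by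
  obtain ⟨R, hR⟩ := exists_nat_ge ((K : ℝ) ^ 2 * (16 * C + 8) / η ^ 2)
  refine ⟨R + 1, fun r hr => ?_⟩
  set i := Nat.size (C * (r + 1)) with hi
  have h1 : (i + 1) ^ 2 ≤ 8 * (C * (r + 1)) + 8 := by
    rcases Nat.eq_zero_or_pos i with h0 | h0
    · rw [h0]
      omega
    · obtain ⟨m, hm⟩ : ∃ m, i = m + 1 := ⟨i - 1, by omega⟩
      have h2 : 2 ^ m ≤ C * (r + 1) := Nat.lt_size.1 (by omega)
      have h3 := sq_le_four_mul_two_pow m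
      rw [hm]
      rcases Nat.eq_zero_or_pos m with h4 | h4
      · subst h4
        simp at h2
        nlinarith
      · nlinarith [sq_nonneg ((m : ℤ) - 2)]
  have hr1 : (1 : ℝ) ≤ r := by exact_mod_cast (by omega : 1 ≤ r)
  have hrR : (R : ℝ) ≤ r := by exact_mod_cast (by omega : R ≤ r)
  have h2 : ((i : ℝ) + 1) ^ 2 ≤ (16 * C + 8) * r := by
    have h3 : ((i : ℝ) + 1) ^ 2 ≤ 8 * (C * (r + 1)) + 8 := by exact_mod_cast h1
    have hC : (0 : ℝ) ≤ C := Nat.cast_nonneg C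
    nlinarith
  have h4 : (K : ℝ) ^ 2 * (16 * C + 8) ≤ η ^ 2 * r := by
    rw [div_le_iff₀ (by positivity)] at hR
    nlinarith [sq_nonneg η]
  have h5 : ((K : ℝ) * (i + 1)) ^ 2 ≤ (η * r) ^ 2 := by
    calc ((K : ℝ) * (i + 1)) ^ 2 = (K : ℝ) ^ 2 * ((i : ℝ) + 1) ^ 2 := by ring
      _ ≤ (K : ℝ) ^ 2 * ((16 * C + 8) * r) := by gcongr
      _ = (K : ℝ) ^ 2 * (16 * C + 8) * r := by ring
      _ ≤ η ^ 2 * r * r := by gcongr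
      _ = (η * r) ^ 2 := by ring
  exact (pow_le_pow_iff_left₀ (by positivity) (by positivity) two_ne_zero).1 h5

/-- The truncations of a direction are as complex as its dimension demands. -/
theorem exists_le_kN_trunc (hU : U.IsUniversal) {A : Set ℕ} {e : EuclideanSpace ℝ (Fin 2)}
    (he : 0 ≤ angle e) {κ : ℝ} (hκ0 : 0 ≤ κ)
    (hκ : ENNReal.ofReal κ < effDim U A (dirPoint e)) :
    ∃ c T : ℕ, ∀ t : ℕ, T ≤ t → ∀ i : ℕ, t < 2 ^ i →
      κ * t ≤ kN U A ⌊2 ^ t * angle e⌋₊ 0 + 2 * i + c := by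
  obtain ⟨c, hc⟩ := exists_Kr_dirPoint_le hU
  obtain ⟨T, hT⟩ := Filter.eventually_atTop.1 (Filter.eventually_lt_of_lt_liminf hκ)
  refine ⟨c, T, fun t ht i hi => ?_⟩
  have h1 := ENNReal.mul_le_of_le_div (hT t ht).le
  have h2 := h1.trans (ENat.toENNReal_le.2 (hc A e t i he hi))
  rw [← ENNReal.ofReal_natCast, ← ENNReal.ofReal_mul hκ0, ENat.toENNReal_coe,
    ← ENNReal.ofReal_natCast, ENNReal.ofReal_le_ofReal_iff (Nat.cast_nonneg _)] at h2
  exact_mod_cast h2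

theorem floor_lt_two_pow {a : ℝ} (ha : a ∈ Set.Ico (0 : ℝ) 1) (t : ℕ) :
    ⌊2 ^ t * a⌋₊ < 2 ^ t := by
  have h0 : (0 : ℝ) < 2 ^ t := by positivity
  rw [Nat.floor_lt (mul_nonneg h0.le ha.1)]
  push_cast
  nlinarith [ha.2]

/-- A crude upper bound for the dimension of a direction. -/
theorem le_two_of_lt_effDim (hU : U.IsUniversal) {A : Set ℕ} {e : EuclideanSpace ℝ (Fin 2)}
    (he : angle e ∈ Set.Ico (0 : ℝ) 1) {κ : ℝ} (hκ0 : 0 ≤ κ)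
    (hκ : ENNReal.ofReal κ < effDim U A (dirPoint e)) : κ ≤ 2 := by
  obtain ⟨c, T, hT⟩ := exists_le_kN_trunc hU he.1 hκ0 hκ
  obtain ⟨c', hc'⟩ := exists_kN_le hU
  by_contra hlt
  rw [not_le] at hlt
  obtain ⟨R, hR⟩ := exists_size_le 1 (2 + c + c') (half_pos (sub_pos.2 hlt))
  set t := R + T + 1 with ht
  have h1 := hR t (by omega)
  rw [one_mul] at h1
  have h2 := hT t (by omega) (Nat.size (t + 1)) ((Nat.lt_succ_self t).trans (Nat.lt_size_self _))
  have h3 : (kN U A ⌊2 ^ t * angle e⌋₊ 0 : ℝ) ≤ 2 * t + c' := by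
    exact_mod_cast hc' A _ 0 t (floor_lt_two_pow he t)
  have ht0 : (0 : ℝ) < t := by exact_mod_cast (by omega : 0 < t)
  have hi : (0 : ℝ) ≤ Nat.size (t + 1) := Nat.cast_nonneg _
  have hc0 : (0 : ℝ) ≤ c := Nat.cast_nonneg _
  have hc0' : (0 : ℝ) ≤ c' := Nat.cast_nonneg _
  push_cast at h1
  nlinarith [mul_nonneg hc0 hi, mul_nonneg hc0' hi, mul_pos ht0 (sub_pos.2 hlt)]

/-- The transition from real numbers to the extended nonnegative numbers of the final inequality. -/
theorem half_le_add_ofReal {k h : ℕ∞} {M H : ℕ} {y : ℝ} (hk : k ≤ M) (hh : (H : ℕ∞) ≤ h)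
    (hy : 0 ≤ y) (hM : (M : ℝ) ≤ 2 * H + 2 * y) :
    (k : ℝ≥0∞) / 2 ≤ (h : ℝ≥0∞) + ENNReal.ofReal y := by
  have h1 : (k : ℝ≥0∞) ≤ (M : ℝ≥0∞) := by exact_mod_cast ENat.toENNReal_le.2 hk
  have h2 : (H : ℝ≥0∞) ≤ (h : ℝ≥0∞) := by exact_mod_cast ENat.toENNReal_le.2 hh
  refine ENNReal.div_le_of_le_mul ?_
  calc (k : ℝ≥0∞) ≤ M := h1
    _ = ENNReal.ofReal M := (ENNReal.ofReal_natCast _).symm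
    _ ≤ ENNReal.ofReal ((H + y) * 2) := ENNReal.ofReal_le_ofReal (by linarith)
    _ = (H + ENNReal.ofReal y) * 2 := by
      rw [ENNReal.ofReal_mul (by positivity), ENNReal.ofReal_add (by positivity) hy,
        ENNReal.ofReal_natCast, ENNReal.ofReal_ofNat]
    _ ≤ (h + ENNReal.ofReal y) * 2 := by gcongr

end AlgInfo

open AlgInfo in
theorem mainTheorem2 (U : OracleCode) (hU : U.IsUniversal)
    (A : Set ℕ) (x e : EuclideanSpace ℝ (Fin 2)) (he : e ∈ Metric.sphere 0 1)
    (δ ε : ℚ) (hδ : δ ∈ Set.Ioo (0 : ℚ) 1) (hε : ε ∈ Set.Ioo (0 : ℚ) 1)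
    (hdim : ENNReal.ofReal (δ : ℝ) < ENNReal.ofReal (ε : ℝ) * effDim U A (dirPoint e) / 4) :
    ∃ R : ℕ, ∀ r : ℕ, R ≤ r →
      (Kr U A r x : ℝ≥0∞) ≤ (Kr U (withDir A e) r x : ℝ≥0∞) + ENNReal.ofReal ((δ : ℝ) * r) →
      ∀ s : ℕ,
        (Krs U A r s x x : ℝ≥0∞) / 2 ≤
          (Krs U (withDir A e) r s (proj e x) (proj e x) : ℝ≥0∞) +
            ENNReal.ofReal ((ε : ℝ) * r) := by
  have hδ0 : (0 : ℝ) < δ := by exact_mod_cast hδ.1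
  have hδ1 : (δ : ℝ) < 1 := by exact_mod_cast hδ.2
  have hε0 : (0 : ℝ) < ε := by exact_mod_cast hε.1
  have hε1 : (ε : ℝ) < 1 := by exact_mod_cast hε.2
  have ha := (angle_spec e he).1
  -- A real number `κ` below the dimension of `e` that still satisfies `4 * δ < ε * κ`.
  have hdim' : ENNReal.ofReal (4 * δ / ε) < effDim U A (dirPoint e) := by
    by_contra hle
    rw [not_lt] at hle
    refine absurd hdim (not_lt.2 ?_)
    refine ENNReal.div_le_of_le_mul ?_
    calc _ ≤ ENNReal.ofReal ε * ENNReal.ofReal (4 * δ / ε) := by gcongr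
      _ = ENNReal.ofReal (δ * 4) := by
        rw [← ENNReal.ofReal_mul hε0.le]
        congr 1
        field_simp
      _ = ENNReal.ofReal δ * 4 := by rw [ENNReal.ofReal_mul hδ0.le, ENNReal.ofReal_ofNat]
  obtain ⟨κ', hκ1, hκ2⟩ := ENNReal.lt_iff_exists_nnreal_btwn.1 hdim'
  set κ : ℝ := NNReal.toReal κ' with hκ_def
  have hκ0 : 0 ≤ κ := κ'.2
  have hκ2' : ENNReal.ofReal κ < effDim U A (dirPoint e) := by
    rwa [hκ_def, ENNReal.ofReal_coe_nnreal]
  have hκ1' : 4 * δ < ε * κ := by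
    rw [← ENNReal.ofReal_coe_nnreal, ENNReal.ofReal_lt_ofReal_iff_of_nonneg (by positivity),
      div_lt_iff₀ hε0] at hκ1
    linarith
  have hκ3 := le_two_of_lt_effDim hU ha hκ0 hκ2'
  obtain ⟨c₁, h₁⟩ := exists_core_bound hU
  obtain ⟨c₂, h₂⟩ := exists_Kr_le hU
  obtain ⟨c₃, h₃⟩ := exists_le_Kr hU
  obtain ⟨c₄, h₄⟩ := exists_Krs_le hU
  obtain ⟨c₅, h₅⟩ := exists_Krs_le_const hU
  obtain ⟨c₆, h₆⟩ := exists_kN_le hU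
  obtain ⟨c₇, T, h₇⟩ := exists_le_kN_trunc hU ha.1 hκ0 hκ2'
  obtain ⟨n₀, hn₀⟩ := exists_nat_ge (|x 0| + |x 1| + 2)
  have hx : ∀ i, |x i| + 2 ≤ n₀ := by
    intro i
    have e0 := abs_nonneg (x 0)
    have e1 := abs_nonneg (x 1)
    fin_cases i <;> simp <;> linarith
  -- All error terms are to be at most `η * r`. The last two bounds on `η` leave room in the
  -- estimate `N ≤ 2 * H + 2 * t + 2 * δ * r + o(r)` and in the complexity of the truncation to
  -- `t` digits, which has to exceed `2 * δ * r`; here `t` is about `ε * r / 2`.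
  set η : ℝ := min 1 (min (ε - 2 * δ) (ε * κ / 2 - 2 * δ)) with hη_def
  have hη : 0 < η := lt_min one_pos (lt_min (by nlinarith) (by linarith))
  have hη1 : η ≤ 1 := min_le_left _ _
  have hη2 : η ≤ ε - 2 * δ := (min_le_right _ _).trans (min_le_left _ _)
  have hη3 : η ≤ ε * κ / 2 - 2 * δ := (min_le_right _ _).trans (min_le_right _ _)
  set C := 100 * (n₀ + c₆ + 1) with hC
  set K := 100 + 2 * (c₁ + c₂ + c₃) + c₄ + c₅ + c₇ with hK
  obtain ⟨R, hR⟩ := exists_size_le C K hη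
  obtain ⟨R', hR'⟩ := exists_nat_ge ((T + 2) * 2 / (ε : ℝ))
  refine ⟨R + R', fun r hr hKr s => ?_⟩
  have hKη := hR r (by omega)
  have hr0 : (0 : ℝ) ≤ r := Nat.cast_nonneg r
  have hI : C * (r + 1) < 2 ^ Nat.size (C * (r + 1)) := Nat.lt_size_self _
  set i := Nat.size (C * (r + 1)) with hi_def
  have hi0 : (0 : ℝ) ≤ i := Nat.cast_nonneg i
  have hη1r : η * r ≤ r := mul_le_of_le_one_left hr0 hη1
  have hη2r : η * r ≤ (ε - 2 * δ) * r := by gcongr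
  have hη3r : η * r ≤ (ε * κ / 2 - 2 * δ) * r := by gcongr
  have hδr : 0 ≤ δ * (r : ℝ) := by positivity
  have hδ1r : δ * (r : ℝ) ≤ r := mul_le_of_le_one_left hr0 hδ1.le
  have hεr : 0 ≤ (ε : ℝ) * r := by positivity
  have hKi : (100 + 2 * (c₁ + c₂ + c₃) + c₄ + c₅ + c₇ : ℝ) + 100 * i + 2 * (c₁ * i) ≤ η * r := by
    refine le_trans ?_ hKη
    rw [hK]
    push_cast
    have q2 : (0 : ℝ) ≤ c₂ * i := by positivity
    have q3 : (0 : ℝ) ≤ c₃ * i := by positivity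
    have q4 : (0 : ℝ) ≤ c₄ * i := by positivity
    have q5 : (0 : ℝ) ≤ c₅ * i := by positivity
    have q7 : (0 : ℝ) ≤ c₇ * i := by positivity
    linarith
  have p1 : (0 : ℝ) ≤ c₁ := Nat.cast_nonneg _
  have p2 : (0 : ℝ) ≤ c₂ := Nat.cast_nonneg _
  have p3 : (0 : ℝ) ≤ c₃ := Nat.cast_nonneg _
  have p4 : (0 : ℝ) ≤ c₄ := Nat.cast_nonneg _
  have p5 : (0 : ℝ) ≤ c₅ := Nat.cast_nonneg _
  have p7 : (0 : ℝ) ≤ c₇ := Nat.cast_nonneg _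
  have p1i : (0 : ℝ) ≤ c₁ * i := by positivity
  rcases le_or_gt r s with hrs | hrs
  · refine half_le_add_ofReal (M := c₅) (H := 0) (h₅ A r s x hrs) (by simp) hεr ?_
    push_cast
    linarith
  set H' := Krs U (withDir A e) r s (proj e x) (proj e x) with hH'
  rcases eq_or_ne H' ⊤ with htop | htop
  · rw [htop]
    simp
  obtain ⟨H, hH⟩ := ENat.ne_top_iff_exists.1 htop
  -- All parameters are less than `2 ^ i`.
  have hCr : 100 * (r + 1) + 100 * n₀ + 100 * c₆ ≤ C * (r + 1) := by
    rw [hC]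
    nlinarith only [Nat.zero_le (n₀ * r), Nat.zero_le (c₆ * r)]
  have hi4 : 4 ≤ i := by
    by_contra hlt
    have : 2 ^ i ≤ 2 ^ 3 := Nat.pow_le_pow_right two_pos (by omega)
    omega
  set q := gridPt (r + 2) n₀ x with hq
  set z := gridPt (s + 2) n₀ x with hz
  set t := ⌊(ε : ℝ) * r / 2⌋₊ with ht
  set w := ⌊2 ^ t * angle e⌋₊ with hw
  have hzq : shift (r - s) q = z := by
    have := shift_gridPt (ρ := s + 2) (ρ' := r + 2) (by omega) n₀ x
    rwa [Nat.add_sub_add_right] at this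
  have htr : t ≤ r := by
    have : (t : ℝ) ≤ r := (Nat.floor_le (by positivity)).trans (by
      linarith [mul_le_of_le_one_left hr0 hε1.le])
    exact_mod_cast this
  have ht1 : (t : ℝ) ≤ ε * r / 2 := Nat.floor_le (by positivity)
  have ht2 : ε * r / 2 < (t : ℝ) + 1 := Nat.lt_floor_add_one _
  have hTt : T + 2 ≤ t := by
    refine Nat.le_floor ?_
    have : (R' : ℝ) ≤ r := by exact_mod_cast (by omega : R' ≤ r)
    have h := (div_le_iff₀ hε0).1 (hR'.trans this)
    push_cast
    linarith
  set j := 2 * (r + 2 + 2 * n₀) with hj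
  have hqj : q < 2 ^ j := gridPt_lt (r + 2) hx
  have hzj : z < 2 ^ j := (gridPt_lt (s + 2) hx).trans_le
    (Nat.pow_le_pow_right two_pos (by omega))
  have hwj : w < 2 ^ j := (floor_lt_two_pow ha t).trans_le
    (Nat.pow_le_pow_right two_pos (by omega))
  have hpair : ∀ a b : ℕ, a < 2 ^ j → b < 2 ^ j → kN U A (Nat.pair a b) 0 < 2 ^ i := by
    intro a b ha hb
    have h1 : Nat.pair a b < 2 ^ (j * 2) := by
      rw [pow_mul]
      exact (Nat.pair_lt_max_add_one_sq _ _).trans_le (Nat.pow_le_pow_left (max_lt ha hb) 2)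
    have h2 := h₆ A _ 0 _ h1
    omega
  have hN : kN U A q z < 2 ^ i := by
    have := h₆ A q z j hqj
    omega
  -- The oracle `e` helps with `x` at precision `r`, hence with `q`, by at most `D`.
  set D := ⌈δ * (r : ℝ)⌉₊ + 12 * i + c₂ + c₃ with hD
  have hDr : (D : ℝ) ≤ δ * r + 1 + 12 * i + c₂ + c₃ := by
    rw [hD]
    push_cast
    linarith [(Nat.ceil_lt_add_one hδr).le]
  have hqD : kN U A q 0 ≤ kN U (withDir A e) q 0 + D := by
    have g1 := ENat.toENNReal_le.2 (h₃ A r n₀ i x hx (by omega) (by omega) hi4)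
    have g2 := ENat.toENNReal_le.2 (h₂ (withDir A e) r n₀ i x hx (by omega) (by omega))
    have g3 : ENNReal.ofReal (δ * (r : ℝ)) ≤ (⌈δ * (r : ℝ)⌉₊ : ℝ≥0∞) := by
      rw [← ENNReal.ofReal_natCast]
      exact ENNReal.ofReal_le_ofReal (Nat.le_ceil _)
    rw [ENat.toENNReal_add, ENat.toENNReal_coe, ENat.toENNReal_coe] at g1
    rw [ENat.toENNReal_coe] at g2
    have g4 := g1.trans (add_le_add (hKr.trans (add_le_add g2 g3)) le_rfl)
    rw [← hq] at g4
    have g5 : kN U A q 0 ≤ kN U (withDir A e) q 0 + 4 * i + c₂ + ⌈δ * (r : ℝ)⌉₊ +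
        (8 * i + c₃) := by exact_mod_cast g4
    omega
  set l := D + c₁ * (i + 1) with hl
  have hlr : (l : ℝ) ≤ δ * r + 1 + 12 * i + c₂ + c₃ + c₁ * i + c₁ := by
    rw [hl]
    push_cast
    linarith
  have hl2 : l + 2 < 2 ^ i := by
    have : ((l + 2 : ℕ) : ℝ) ≤ ((2 * r : ℕ) : ℝ) := by
      push_cast
      linarith
    have : l + 2 ≤ 2 * r := by exact_mod_cast this
    omega
  have hwl : D + l + c₁ * (i + 1) ≤ kN U A w 0 := by
    have g1 := h₇ t (by omega) i (by omega)
    rw [← hw] at g1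
    have g2 : κ * (ε * r / 2 - 1) ≤ κ * t := mul_le_mul_of_nonneg_left (by linarith) hκ0
    have g3 : ((D + l + c₁ * (i + 1) : ℕ) : ℝ) ≤ (kN U A w 0 : ℝ) := by
      push_cast
      linarith
    exact_mod_cast g3
  refine half_le_add_ofReal (M := kN U A q z + 16 * i + c₄) (H := H)
    (h₄ A r s n₀ i x hx (by omega) (by omega) (by omega) hi4) hH.le hεr ?_
  push_cast
  rcases Nat.lt_or_ge (kN U A q z) H with hNH | hNH
  · have : (kN U A q z : ℝ) ≤ H := by exact_mod_cast hNH.le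
    have hH0 : (0 : ℝ) ≤ H := Nat.cast_nonneg H
    linarith
  · have hreach := exists_reaches hU he hx hrs.le hH.ge
    have hcore := h₁ A (angle e) ha r s n₀ H t q D l i (by omega) htr (by omega) (by omega)
      (by omega) (by omega) hl2 (by rwa [hzq]) (by rw [hzq]; exact hpair z q hzj hqj)
      (by rw [hzq]; exact hpair w z hwj hzj) hqD (by rw [hzq]; exact hreach) le_rfl hwl
    rw [hzq] at hcore
    have hcore' : (kN U A q z : ℝ) ≤ 2 * H + 2 * t + 2 * l + 20 := by exact_mod_cast hcore
    linarith
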